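/- Let $I=\mathbb R$ or $I=[a_1,a_2]$ with $a_1<a_2$. Let $v_0,w_0:I\to\mathbb R$ satisfy: $v_0\ge w_0$ on $I$; $v_0=w_0$ at $a_1$ and $a_2$ if $I=[a_1,a_2]$; $v_0$ and $w_0$ are Lipschitz on $I$; and $v_0$ and $w_0$ have only finitely many (not necessarily strict) local extrema on every bounded interval. **Solutions.** A *solution* is a pair of jointly continuous functions $v,w$ on $I\times[0,\infty)$ with $v\ge w$, and $v=w$ at $x=a_1,a_2$ if $I=[a_1,a_2]$, solving $$v_t=-v_x\mathbf 1_{\{v>w\}},\qquad w_t=w_x\mathbf 1_{\{v>w\}}$$ in the following sense. In every open space-time rectangle where $v>w$, $v$ is constant along lines $x-t=\mathrm{const}$ and $w$ along lines $x+t=\mathrm{const}$. In every open rectangle where $v=w$, both are independent of $t$. Moreover, suppose that $s\ge0$, $x_1<x_2$, $(x_1,x_2)\subset I$, $U=\{(x,t):t\ge s,\ x_1+(t-s)<x<x_2-(t-s)\}$, and $\tilde v\geq\tilde w$ are continuous on $U$, satisfy $\tilde v>\tilde w$ and the equations in the interior of $U$, and agree with $v,w$ at time $s$ on $(x_1,x_2)$.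 Then $v=\tilde v$, $w=\tilde w$ in the interior of $U$. **Local construction.** Let $f\ge g$ be data at some time on $I$, let $z\in I$, $\varepsilon>0$, and suppose that $[z-\varepsilon,z+\varepsilon]\subset I$, or $z=a_1$ and $a_1+\varepsilon\in I$, or $z=a_2$ and $a_2-\varepsilon\in I$. Suppose $f$ and $g$ are strictly monotone on $[z-\varepsilon,z]\cap I$ and on $[z,z+\varepsilon]\cap I$, and that $\inf f\ge\sup g$ over $[z-\varepsilon,z+\varepsilon]\cap I$ or $f(z)=g(z)$. On $U=\{(x,t):t\ge0,\ x\in(z-\varepsilon+t,z+\varepsilon-t)\cap I\}$ define $V,W$ as follows ("increasing" and "decreasing" are strict; in 2–6, $f(z)=g(z)$; in 1–4, $[z-\varepsilon,z+\varepsilon]\subset I$). 1. If $\inf f\ge\sup g$ over $[z-\varepsilon,z+\varepsilon]$: $V(x,t)=f(x-t)$, $W(x,t)=g(x+t)$. 2. The same formulas if $f$ is decreasing on $[z-\varepsilon,z+\varepsilon]$, or $g$ is, or $f$ is decreasing then increasing and $g$ is increasing then decreasing (with the change at $z$). 3. If $f,g$ are increasing on $[z-\varepsilon,z+\varepsilon]$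 (*freezing formula*): $V(x,t)=f(x-t)$, $W(x,t)=g(x+t)$ if there is no $s\in[0,t]$ with $x-s\in I$ and $f(x-s)=g(x+s)$; otherwise $V(x,t)=W(x,t)=f(x-s)$ for that $s$. 4. If $f,g$ are increasing on $[z-\varepsilon,z]$ and $g$ is decreasing on $[z,z+\varepsilon]$: the freezing formula holds where $x+t\le z$. Let $\mathcal T=\{(x,t)\in U: x\le z\le x+t,\ V(x,z-x)=g(x+t)\}$. If $x\le z\le x+t$ and there is no $(x,s)\in\mathcal T$ with $s<t$, then $V(x,t)=W(x,t)=V(x,z-x)$. At the remaining points with $x+t\ge z$, $W(x,t)=g(x+t)$, and $V$ is transported with speed $1$ from its values on $\mathcal T$ and from $V(\cdot,0)=f$ on $[z,z+\varepsilon]$. If $f,g$ are increasing on $[z,z+\varepsilon]$ and $f$ is decreasing on $[z-\varepsilon,z]$, use the image of this under the symmetry $(v,w)(x,t)\mapsto(-w,-v)(-x,t)$. 5. If $z=a_1$ and $g$ is decreasing on $[a_1,a_1+\varepsilon]$: $W(x,t)=g(x+t)$; $V(x,t)=f(x-t)$ if $x\ge a_1+t$, and $V(x,t)=g(a_1+t-(x-a_1))$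 if $x<a_1+t$. 6. If $z=a_1$ and $f,g$ are increasing on $[a_1,a_1+\varepsilon]$: the freezing formula holds on $U$. If $z=a_2$, use the images of 5 and 6 under the same symmetry. A *constructed solution* with initial data $(v_0,w_0)$ is a solution $(v,w)$ with $v(\cdot,0)=v_0$, $w(\cdot,0)=w_0$ such that for every $s\ge0$ and $z\in I$ there is $\varepsilon>0$ as above for the data $f=v(\cdot,s)$, $g=w(\cdot,s)$, for which $(v,w)(x,s+t)=(V,W)(x,t)$ on $U$. **Explicit formulas.** For $b\in\mathbb R$ let $$q_b(z)=\mathbf 1_{\{z\in I,\,v_0(z)\le b\}}+\mathbf 1_{\{z\le a_1\}}-\mathbf 1_{\{z\in I,\,w_0(z)\ge b\}}-\mathbf 1_{\{z\ge a_2\}},$$ where the second and fourth terms are absent if $I=\mathbb R$. For $x\in\mathbb R$, $t\ge0$ let $$\alpha(v,b,x)=\inf\Big\{y\ge x:\int_x^y q_b(z)\,dz<0\Big\},\qquad \alpha(w,b,x)=\sup\Big\{y\le x:\int_y^x q_b(z)\,dz>0\Big\},$$ $$A(v,b,t)=\{x+t\in I:\ t\le(\alpha(v,b,x)-x)/2,\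 (x\in I\text{ and }v_0(x)\le b)\text{ or }x\le a_1\},$$ $$A(w,b,t)=\{x-t\in I:\ t\le(x-\alpha(w,b,x))/2,\ (x\in I\text{ and }w_0(x)\ge b)\text{ or }x\ge a_2\}$$ (the alternatives with $a_1,a_2$ are absent if $I=\mathbb R$), and $$v_*(x,t)=\inf\{b\in\mathbb R:x\in A(v,b,t)\},\qquad w_*(x,t)=\sup\{b\in\mathbb R:x\in A(w,b,t)\}.$$ Infima and suprema are in $[-\infty,\infty]$, with $\inf\emptyset=+\infty$ and $\sup\emptyset=-\infty$. **Claim.** A constructed solution with initial data $(v_0,w_0)$ exists, and every constructed solution $(v,w)$ satisfies, for all $x\in I$ and $t\ge0$, $$v(x,t)=v_*(x,t)\quad\text{and}\quad w(x,t)=w_*(x,t),$$ except that, if $I=[a_1,a_2]$, the first equality is claimed only for $x\ne a_1$ and the second only for $x\ne a_2$; at these points $v(a_1,t)=w(a_1,t)=w_*(a_1,t)$ and $w(a_2,t)=v(a_2,t)=v_*(a_2,t)$. In particular the constructed solution is unique. -/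

import Mathlib

open Set

noncomputable section

/-! Throughout, `S` is the space interval `I`: the whole line or `[a₁, a₂]`. Functions of space and
time are curried, `v x t`; only their values for `x ∈ S` and `t ≥ 0` matter. The left endpoint `a₁`
is the point with `IsLeast S`, the right endpoint `a₂` the point with `IsGreatest S`; the whole
line has neither. -/

/-- The assumption on the initial data. A local extremum of `f` is a point `x` of `S` such that
`f x` is the maximum or the minimum (not necessarily strict) of `f` over the points of `S` near
`x`. -/
structure InitialAssumption (S : Set ℝ) (v₀ w₀ : ℝ → ℝ) : Prop where
  le : ∀ x ∈ S, w₀ x ≤ v₀ x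
  eq_left : ∀ x, IsLeast S x → v₀ x = w₀ x
  eq_right : ∀ x, IsGreatest S x → v₀ x = w₀ x
  lipschitz : ∃ K : NNReal, LipschitzOnWith K v₀ S ∧ LipschitzOnWith K w₀ S
  finite_extr_v : ∀ c d : ℝ, {x | x ∈ S ∧ x ∈ Icc c d ∧ IsLocalExtrOn v₀ S x}.Finite
  finite_extr_w : ∀ c d : ℝ, {x | x ∈ S ∧ x ∈ Icc c d ∧ IsLocalExtrOn w₀ S x}.Finite

/-! ### Solutions -/

/-- `v` is constant along lines of slope `1` and `w` along lines of slope `-1` in the open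
space-time rectangle `(x₁, x₂) × (t₁, t₂)`. -/
def TransportOn (v w : ℝ → ℝ → ℝ) (x₁ x₂ t₁ t₂ : ℝ) : Prop :=
  ∀ x t δ : ℝ, x ∈ Ioo x₁ x₂ → t ∈ Ioo t₁ t₂ → t + δ ∈ Ioo t₁ t₂ →
    (x + δ ∈ Ioo x₁ x₂ → v (x + δ) (t + δ) = v x t) ∧
    (x - δ ∈ Ioo x₁ x₂ → w (x - δ) (t + δ) = w x t)

/-- `v` and `w` do not depend on time in the open rectangle `(x₁, x₂) × (t₁, t₂)`. -/
def StationaryOn (v w : ℝ → ℝ → ℝ) (x₁ x₂ t₁ t₂ : ℝ) : Prop :=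
  ∀ x t δ : ℝ, x ∈ Ioo x₁ x₂ → t ∈ Ioo t₁ t₂ → t + δ ∈ Ioo t₁ t₂ →
    v x (t + δ) = v x t ∧ w x (t + δ) = w x t

/-- The triangle `{(x, t) : t ≥ s, x₁ + (t - s) < x < x₂ - (t - s)}`. -/
def triangle (x₁ x₂ s : ℝ) : Set (ℝ × ℝ) :=
  {p | s ≤ p.2 ∧ x₁ + (p.2 - s) < p.1 ∧ p.1 < x₂ - (p.2 - s)}

/-- The interior of `triangle x₁ x₂ s`. -/
def openTriangle (x₁ x₂ s : ℝ) : Set (ℝ × ℝ) :=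
  {p | s < p.2 ∧ x₁ + (p.2 - s) < p.1 ∧ p.1 < x₂ - (p.2 - s)}

/-- Jointly continuous solutions on `S × [0, ∞)` of
`v_t = - v_x 1_{v > w}`, `w_t = w_x 1_{v > w}`, `v ≥ w`, `v = w` at the endpoints of `S`,
the two equations being understood through characteristics in open liquid (`v > w`) and open
frozen (`v = w`) rectangles, together with the requirement `thaw` that the system be liquid in a
triangle whenever a liquid evolution from the data at the base of the triangle exists. -/
structure IsSolution (S : Set ℝ) (v w : ℝ → ℝ → ℝ) : Prop where
  cont_v : ContinuousOn (fun p : ℝ × ℝ => v p.1 p.2) (S ×ˢ Ici 0)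
  cont_w : ContinuousOn (fun p : ℝ × ℝ => w p.1 p.2) (S ×ˢ Ici 0)
  le : ∀ x ∈ S, ∀ t, 0 ≤ t → w x t ≤ v x t
  boundary : ∀ x, IsLeast S x ∨ IsGreatest S x → ∀ t, 0 ≤ t → v x t = w x t
  liquid : ∀ x₁ x₂ t₁ t₂ : ℝ, Ioo x₁ x₂ ⊆ S → 0 ≤ t₁ →
    (∀ x ∈ Ioo x₁ x₂, ∀ t ∈ Ioo t₁ t₂, w x t < v x t) → TransportOn v w x₁ x₂ t₁ t₂
  frozen : ∀ x₁ x₂ t₁ t₂ : ℝ, Ioo x₁ x₂ ⊆ S → 0 ≤ t₁ →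
    (∀ x ∈ Ioo x₁ x₂, ∀ t ∈ Ioo t₁ t₂, v x t = w x t) → StationaryOn v w x₁ x₂ t₁ t₂
  thaw : ∀ (s x₁ x₂ : ℝ) (v' w' : ℝ → ℝ → ℝ), 0 ≤ s → x₁ < x₂ → Ioo x₁ x₂ ⊆ S →
    ContinuousOn (fun p : ℝ × ℝ => v' p.1 p.2) (triangle x₁ x₂ s) →
    ContinuousOn (fun p : ℝ × ℝ => w' p.1 p.2) (triangle x₁ x₂ s) →
    (∀ p ∈ triangle x₁ x₂ s, w' p.1 p.2 ≤ v' p.1 p.2) →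
    (∀ p ∈ openTriangle x₁ x₂ s, w' p.1 p.2 < v' p.1 p.2) →
    (∀ y₁ y₂ t₁ t₂ : ℝ, Ioo y₁ y₂ ×ˢ Ioo t₁ t₂ ⊆ openTriangle x₁ x₂ s →
      TransportOn v' w' y₁ y₂ t₁ t₂) →
    (∀ x ∈ Ioo x₁ x₂, v' x s = v x s ∧ w' x s = w x s) →
    ∀ p ∈ openTriangle x₁ x₂ s, v p.1 p.2 = v' p.1 p.2 ∧ w p.1 p.2 = w' p.1 p.2

/-! ### The local construction

`f` and `g` are the data of `v` and `w` at some time, `z` is a point of `S`, `ε > 0`, and `V x t`,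
`W x t` are the values of the solution `t` units of time later. -/

/-- `{(x, t) : t ≥ 0, x ∈ (z - ε + t, z + ε - t) ∩ S}`. -/
def window (S : Set ℝ) (z ε : ℝ) : Set (ℝ × ℝ) :=
  {p | 0 ≤ p.2 ∧ p.1 ∈ S ∧ z - ε + p.2 < p.1 ∧ p.1 < z + ε - p.2}

def StrictMonotoneOn (f : ℝ → ℝ) (A : Set ℝ) : Prop := StrictMonoOn f A ∨ StrictAntiOn f A

/-- The requirements on `z` and `ε`: either `[z - ε, z + ε] ⊆ S`, or `z` is an endpoint of `S` and
`S` contains the half of `[z - ε, z + ε]` on the other side of `z`; `f` and `g` are strictly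
monotone on both sides of `z`; and either `inf f ≥ sup g` near `z`, or `f z = g z`. -/
structure IsWindow (S : Set ℝ) (f g : ℝ → ℝ) (z ε : ℝ) : Prop where
  pos : 0 < ε
  subset : Icc (z - ε) (z + ε) ⊆ S ∨ (IsLeast S z ∧ z + ε ∈ S) ∨ (IsGreatest S z ∧ z - ε ∈ S)
  f_left : StrictMonotoneOn f (Icc (z - ε) z ∩ S)
  f_right : StrictMonotoneOn f (Icc z (z + ε) ∩ S)
  g_left : StrictMonotoneOn g (Icc (z - ε) z ∩ S)
  g_right : StrictMonotoneOn g (Icc z (z + ε) ∩ S)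
  sep : (∀ x ∈ Icc (z - ε) (z + ε) ∩ S, ∀ y ∈ Icc (z - ε) (z + ε) ∩ S, g y ≤ f x) ∨ f z = g z

/-- Everything is liquid in `D`. -/
def LiquidFormula (D : Set (ℝ × ℝ)) (f g : ℝ → ℝ) (V W : ℝ → ℝ → ℝ) : Prop :=
  ∀ p ∈ D, V p.1 p.2 = f (p.1 - p.2) ∧ W p.1 p.2 = g (p.1 + p.2)

/-- The freezing curve is `{(x, s) : f (x - s) = g (x + s)}`. Below it `V` and `W` are transported
with speeds `1` and `-1`; a point on or above it carries the common value of `V` and `W` at the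
point of the curve with the same space coordinate. -/
def FreezingFormula (S : Set ℝ) (D : Set (ℝ × ℝ)) (f g : ℝ → ℝ) (V W : ℝ → ℝ → ℝ) : Prop :=
  ∀ p ∈ D,
    ((∀ s ∈ Icc 0 p.2, p.1 - s ∈ S → f (p.1 - s) ≠ g (p.1 + s)) →
      V p.1 p.2 = f (p.1 - p.2) ∧ W p.1 p.2 = g (p.1 + p.2)) ∧
    (∀ s ∈ Icc 0 p.2, p.1 - s ∈ S → f (p.1 - s) = g (p.1 + s) →
      V p.1 p.2 = f (p.1 - s) ∧ W p.1 p.2 = f (p.1 - s))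

/-- The thawing curve starting at `(z, 0)`; `V x (z - x)` is the frozen value on the line
`x + t = z`. -/
def thawingCurve (S : Set ℝ) (g : ℝ → ℝ) (z ε : ℝ) (V : ℝ → ℝ → ℝ) : Set (ℝ × ℝ) :=
  {p | p ∈ window S z ε ∧ p.1 ≤ z ∧ z ≤ p.1 + p.2 ∧ V p.1 (z - p.1) = g (p.1 + p.2)}

/-- `f z = g z`, both `f` and `g` increase to the left of `z`, and `g` decreases to the right of
`z`. The freezing formula holds where `x + t ≤ z`. Where `x + t ≥ z`: below (and on) the thawing
curve the system stays frozen; at a point above it, `W` is transported with speed `-1` from time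
`0`, and `V` is transported with speed `1` from the thawing curve or from `[z, z + ε] × {0}`. -/
structure ThawingCase (S : Set ℝ) (f g : ℝ → ℝ) (z ε : ℝ) (V W : ℝ → ℝ → ℝ) : Prop where
  meet : f z = g z
  f_left : StrictMonoOn f (Icc (z - ε) z)
  g_left : StrictMonoOn g (Icc (z - ε) z)
  g_right : StrictAntiOn g (Icc z (z + ε))
  freezing : FreezingFormula S {p | p ∈ window S z ε ∧ p.1 + p.2 ≤ z} f g V W
  below : ∀ p ∈ window S z ε, p.1 ≤ z → z ≤ p.1 + p.2 →
    (∀ s, s < p.2 → (p.1, s) ∉ thawingCurve S g z ε V) →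
      V p.1 p.2 = V p.1 (z - p.1) ∧ W p.1 p.2 = V p.1 (z - p.1)
  above_curve : ∀ p ∈ thawingCurve S g z ε V, ∀ s, 0 ≤ s → (p.1 + s, p.2 + s) ∈ window S z ε →
    V (p.1 + s) (p.2 + s) = V p.1 p.2 ∧ W (p.1 + s) (p.2 + s) = g (p.1 + p.2 + 2 * s)
  above_base : ∀ x s, z ≤ x → 0 ≤ s → (x + s, s) ∈ window S z ε →
    V (x + s) s = f x ∧ W (x + s) s = g (x + 2 * s)

/-- `z` is the left endpoint and `g` decreases to the right of `z`: the values of `W` are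
transported with speed `-1` and reflected at `z` into values of `V`. -/
structure ReflectionCase (S : Set ℝ) (f g : ℝ → ℝ) (z ε : ℝ) (V W : ℝ → ℝ → ℝ) : Prop where
  least : IsLeast S z
  meet : f z = g z
  g_right : StrictAntiOn g (Icc z (z + ε))
  w_eq : ∀ p ∈ window S z ε, W p.1 p.2 = g (p.1 + p.2)
  v_eq_of_ge : ∀ p ∈ window S z ε, z + p.2 ≤ p.1 → V p.1 p.2 = f (p.1 - p.2)
  v_eq_of_lt : ∀ p ∈ window S z ε, p.1 < z + p.2 → V p.1 p.2 = g (z + p.2 - (p.1 - z))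

/-- `z` is the left endpoint and both `f` and `g` increase to the right of `z`. -/
structure EndpointFreezingCase (S : Set ℝ) (f g : ℝ → ℝ) (z ε : ℝ) (V W : ℝ → ℝ → ℝ) : Prop where
  least : IsLeast S z
  meet : f z = g z
  f_right : StrictMonoOn f (Icc z (z + ε))
  g_right : StrictMonoOn g (Icc z (z + ε))
  freezing : FreezingFormula S (window S z ε) f g V W

/-- The problem is invariant under `(v, w)(x, t) ↦ (-w, -v)(-x, t)`. -/
def reflectSet (S : Set ℝ) : Set ℝ := {x | -x ∈ S}

def reflectData (f : ℝ → ℝ) : ℝ → ℝ := fun x => -f (-x)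

def reflectSol (V : ℝ → ℝ → ℝ) : ℝ → ℝ → ℝ := fun x t => -V (-x) t

/-- All the cases of the local construction. -/
inductive LocalConstruction (S : Set ℝ) (f g : ℝ → ℝ) (z ε : ℝ) (V W : ℝ → ℝ → ℝ) : Prop
  | separated (hS : Icc (z - ε) (z + ε) ⊆ S)
      (h : ∀ x ∈ Icc (z - ε) (z + ε), ∀ y ∈ Icc (z - ε) (z + ε), g y ≤ f x)
      (hVW : LiquidFormula (window S z ε) f g V W)
  | decreasing_v (hS : Icc (z - ε) (z + ε) ⊆ S) (meet : f z = g z)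
      (hf : StrictAntiOn f (Icc (z - ε) (z + ε)))
      (hVW : LiquidFormula (window S z ε) f g V W)
  | decreasing_w (hS : Icc (z - ε) (z + ε) ⊆ S) (meet : f z = g z)
      (hg : StrictAntiOn g (Icc (z - ε) (z + ε)))
      (hVW : LiquidFormula (window S z ε) f g V W)
  | valley_peak (hS : Icc (z - ε) (z + ε) ⊆ S) (meet : f z = g z)
      (hf₁ : StrictAntiOn f (Icc (z - ε) z)) (hf₂ : StrictMonoOn f (Icc z (z + ε)))
      (hg₁ : StrictMonoOn g (Icc (z - ε) z)) (hg₂ : StrictAntiOn g (Icc z (z + ε)))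
      (hVW : LiquidFormula (window S z ε) f g V W)
  | increasing (hS : Icc (z - ε) (z + ε) ⊆ S) (meet : f z = g z)
      (hf : StrictMonoOn f (Icc (z - ε) (z + ε))) (hg : StrictMonoOn g (Icc (z - ε) (z + ε)))
      (hVW : FreezingFormula S (window S z ε) f g V W)
  | thaw_right (hS : Icc (z - ε) (z + ε) ⊆ S) (h : ThawingCase S f g z ε V W)
  | thaw_left (hS : Icc (z - ε) (z + ε) ⊆ S)
      (h : ThawingCase (reflectSet S) (reflectData g) (reflectData f) (-z) ε
        (reflectSol W) (reflectSol V))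
  | left_liquid (h : ReflectionCase S f g z ε V W)
  | left_freezing (h : EndpointFreezingCase S f g z ε V W)
  | right_liquid
      (h : ReflectionCase (reflectSet S) (reflectData g) (reflectData f) (-z) ε
        (reflectSol W) (reflectSol V))
  | right_freezing
      (h : EndpointFreezingCase (reflectSet S) (reflectData g) (reflectData f) (-z) ε
        (reflectSol W) (reflectSol V))

/-- The constructed solution with initial data `v₀`, `w₀`: a solution that, started afresh at any
time `s ≥ 0`, is given near every point `z` of `S` by the local construction from its values at
time `s`. (By continuity this determines the solution for all times.) -/
structure IsConstructedSolution (S : Set ℝ) (v₀ w₀ : ℝ → ℝ) (v w : ℝ → ℝ → ℝ) : Prop where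
  initial : ∀ x ∈ S, v x 0 = v₀ x ∧ w x 0 = w₀ x
  solution : IsSolution S v w
  construction : ∀ s, 0 ≤ s → ∀ z ∈ S, ∃ ε,
    IsWindow S (fun x => v x s) (fun x => w x s) z ε ∧
    LocalConstruction S (fun x => v x s) (fun x => w x s) z ε
      (fun x t => v x (s + t)) (fun x t => w x (s + t))

/-! ### The explicit formulas -/

/-- `1_{z ∈ S, v z ≤ b} + 1_{z ≤ a₁} - 1_{z ∈ S, w z ≥ b} - 1_{z ≥ a₂}`; the terms with `a₁` and
`a₂` are absent (that is, zero) if `S` is the whole line. -/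
def charge (S : Set ℝ) (v w : ℝ → ℝ) (b z : ℝ) : ℝ :=
  indicator {y | y ∈ S ∧ v y ≤ b} 1 z + indicator (lowerBounds S) 1 z
    - indicator {y | y ∈ S ∧ b ≤ w y} 1 z - indicator (upperBounds S) 1 z

/-- The matching point `α(v, b, x)`; it is `+∞` if there is no `y` as required. -/
def alphaV (S : Set ℝ) (v w : ℝ → ℝ) (b x : ℝ) : EReal :=
  sInf ((fun y : ℝ => (y : EReal)) '' {y | x ≤ y ∧ ∫ z in x..y, charge S v w b z < 0})

/-- The matching point `α(w, b, x)`; it is `-∞` if there is no `y` as required. -/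
def alphaW (S : Set ℝ) (v w : ℝ → ℝ) (b x : ℝ) : EReal :=
  sSup ((fun y : ℝ => (y : EReal)) '' {y | y ≤ x ∧ 0 < ∫ z in y..x, charge S v w b z})

/-- `A(v, b, t)`. The last condition is `t ≤ (α(v, b, x) - x) / 2`. -/
def setAV (S : Set ℝ) (v w : ℝ → ℝ) (b t : ℝ) : Set ℝ :=
  {z | z ∈ S ∧ ∃ x : ℝ, z = x + t ∧ ((x ∈ S ∧ v x ≤ b) ∨ x ∈ lowerBounds S) ∧
    ((x + 2 * t : ℝ) : EReal) ≤ alphaV S v w b x}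

/-- `A(w, b, t)`. The last condition is `t ≤ (x - α(w, b, x)) / 2`. -/
def setAW (S : Set ℝ) (v w : ℝ → ℝ) (b t : ℝ) : Set ℝ :=
  {z | z ∈ S ∧ ∃ x : ℝ, z = x - t ∧ ((x ∈ S ∧ b ≤ w x) ∨ x ∈ upperBounds S) ∧
    alphaW S v w b x ≤ ((x - 2 * t : ℝ) : EReal)}

/-- `v_*(x, t)`, an infimum in the extended reals. -/
def vStar (S : Set ℝ) (v w : ℝ → ℝ) (x t : ℝ) : EReal :=
  sInf ((fun b : ℝ => (b : EReal)) '' {b | x ∈ setAV S v w b t})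

/-- `w_*(x, t)`, a supremum in the extended reals. -/
def wStar (S : Set ℝ) (v w : ℝ → ℝ) (x t : ℝ) : EReal :=
  sSup ((fun b : ℝ => (b : EReal)) '' {b | x ∈ setAW S v w b t})

end

/-! Fix a level b. Put particles of speed 1 where v₀ ≤ b and particles of speed -1 where w₀ ≥ b, and
let particles of opposite speeds annihilate when they meet. If the space is [a₁, a₂], the half-line
left of a₁ is a reservoir of particles of speed 1 and the half-line right of a₂ one of particles of
speed -1; this encodes the boundary condition. The explicit formulas say that v(x, t) ≤ b iff the
particle started at x - t survives until time t (`lowV`), and w(x, t) ≥ b iff the one started at x +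
t does (`highW`).

Survival is a property of a primitive H of the charge: the foot of the characteristic must minimize
H over [x - t, x + t]. The surviving particles are the derivative of the sliding minimum of H
(`deriv_erosion`, `integral_surviving`), and sliding minima compose by adding the radii of the
windows. Hence the explicit formulas form a semigroup in time (`Evolves.evolvesAt_iff`), and short
times suffice.

For short times the formulas are evaluated by counting charge in blocks (`isV_transport`,
`isV_thaw`, `isV_reflection`). The results are the cases of the local construction. Since the
explicit values are unique, the local construction and the explicit formulas are equivalent in a
window (`LocalConstruction.evolvesOn`, `EvolvesOn.localConstruction`).

For existence, the explicit values at every later time must again be continuous, ordered and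
strictly monotone on each side of every point (`IsExplicit.regularData`). Order and continuity rest
on `lowV.le_of_totalCharge_nonpos`: where no charge is gained between two levels, the data cannot
pass through the values in between. One-sided monotonicity follows from a local quasiconvexity in
space (`IsV.le_max`) and the absence of intervals of constancy (`not_isV_const`). For uniqueness, a
constructed solution follows the explicit formulas for a short time after any moment at which it
agrees with them, and induction on time inside a backward cone concludes
(`IsConstructedSolution.eq_explicit`). Statements about w come from those about v by the reflection
(v, w)(x, t) ↦ (-w, -v)(-x, t). -/

noncomputable section

open MeasureTheory Filter Topology

/-! ### Annihilating particles and the sliding minimum of a primitive of their charge. -/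

section erosions

/-! ### Ballistic annihilation at one level

`R` and `L` are the sets occupied by particles of speeds `1` and `-1`, and `H` is a primitive of the
charge `1_R - 1_L`. After time `t` the primitive is the minimum of `H` over `[x - t, x + t]`. -/

/-- The positions after time `t` of the surviving particles of speed `1`. -/
def survR (H : ℝ → ℝ) (R : Set ℝ) (t : ℝ) : Set ℝ :=
  {x | x - t ∈ R ∧ ∀ y ∈ Icc (x - t) (x + t), H (x - t) ≤ H y}

/-- The positions after time `t` of the surviving particles of speed `-1`. -/
def survL (H : ℝ → ℝ) (L : Set ℝ) (t : ℝ) : Set ℝ :=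
  {x | x + t ∈ L ∧ ∀ y ∈ Icc (x - t) (x + t), H (x + t) ≤ H y}

/-- The minimum of `H` over `[x - t, x + t]`. -/
noncomputable def erosion (H : ℝ → ℝ) (t x : ℝ) : ℝ := sInf (H '' Icc (x - t) (x + t))

section erosion

variable {H : ℝ → ℝ} {t x y : ℝ}

theorem erosion_exists (hH : Continuous H) (ht : 0 ≤ t) (x : ℝ) :
    ∃ y ∈ Icc (x - t) (x + t), erosion H t x = H y := by
  obtain ⟨y, hy, h⟩ := (isCompact_Icc (a := x - t) (b := x + t)).exists_sInf_image_eq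
    ⟨x, by constructor <;> linarith⟩ hH.continuousOn
  exact ⟨y, hy, h⟩

theorem erosion_le (hH : Continuous H) (hy : y ∈ Icc (x - t) (x + t)) : erosion H t x ≤ H y :=
  csInf_le (isCompact_Icc.image hH).bddBelow ⟨y, hy, rfl⟩

theorem erosion_le_iff (hH : Continuous H) (ht : 0 ≤ t) {c : ℝ} :
    c ≤ erosion H t x ↔ ∀ y ∈ Icc (x - t) (x + t), c ≤ H y := by
  constructor
  · intro h y hy
    exact h.trans (erosion_le hH hy)
  · intro h
    obtain ⟨y, hy, h'⟩ := erosion_exists hH ht x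
    rw [h']; exact h y hy

theorem erosion_lipschitz (hH : LipschitzWith 1 H) (ht : 0 ≤ t) :
    LipschitzWith 1 (erosion H t) := by
  apply LipschitzWith.of_le_add
  intro x y
  obtain ⟨z, hz, h⟩ := erosion_exists hH.continuous ht y
  have h1 : erosion H t x ≤ H (z + (x - y)) :=
    erosion_le hH.continuous ⟨by linarith [hz.1], by linarith [hz.2]⟩
  have h2 : H (z + (x - y)) ≤ H z + dist (z + (x - y)) z := by
    have := hH.dist_le_mul (z + (x - y)) z
    rw [Real.dist_eq] at this
    have h3 := le_abs_self (H (z + (x - y)) - H z)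
    simp only [NNReal.coe_one, one_mul] at this
    linarith
  have h3 : dist (z + (x - y)) z = dist x y := by
    rw [Real.dist_eq, Real.dist_eq]; congr 1; ring
  linarith

/-- At almost every point, the erosion has slope `1` on surviving particles of speed `1`, slope
`-1` on surviving particles of speed `-1`, and slope `0` elsewhere. -/
theorem deriv_erosion {R L : Set ℝ} (hH : Continuous H) (ht : 0 < t)
    {d₁ d₂ m : ℝ} (hm : HasDerivAt (erosion H t) m x)
    (h₁ : HasDerivAt H d₁ (x - t)) (h₂ : HasDerivAt H d₂ (x + t))
    (hd₁ : d₁ = indicator R 1 (x - t) - indicator L 1 (x - t))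
    (hd₂ : d₂ = indicator R 1 (x + t) - indicator L 1 (x + t))
    (hn₁ : x - t ∉ R ∩ L) (hn₂ : x + t ∉ R ∩ L) :
    m = indicator (survR H R t) 1 x - indicator (survL H L t) 1 x := by
  have left : (∀ y ∈ Icc (x - t) (x + t), H (x - t) ≤ H y) → m = d₁ := by
    intro h
    have e : erosion H t x = H (x - t) :=
      le_antisymm (erosion_le hH ⟨le_rfl, by linarith⟩) ((erosion_le_iff hH ht.le).2 h)
    -- The erosion lies below the translate `H (u - t)` and touches it at `u = x`, so both have the
    -- same derivative there.
    have hmax : IsLocalMax (fun u => erosion H t u - H (u - t)) x := by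
      filter_upwards with u
      have := erosion_le (t := t) (x := u) (y := u - t) hH ⟨le_rfl, by linarith⟩
      simp only [e]; linarith
    have h1' : HasDerivAt (fun u => H (u - t)) d₁ x := by
      simpa using HasDerivAt.comp_sub_const x t h₁
    have := hmax.hasDerivAt_eq_zero (hm.sub h1')
    linarith
  have right : (∀ y ∈ Icc (x - t) (x + t), H (x + t) ≤ H y) → m = d₂ := by
    intro h
    have e : erosion H t x = H (x + t) :=
      le_antisymm (erosion_le hH ⟨by linarith, le_rfl⟩) ((erosion_le_iff hH ht.le).2 h)
    have hmax : IsLocalMax (fun u => erosion H t u - H (u + t)) x := by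
      filter_upwards with u
      have := erosion_le (t := t) (x := u) (y := u + t) hH ⟨by linarith, le_rfl⟩
      simp only [e]; linarith
    have h1' : HasDerivAt (fun u => H (u + t)) d₂ x := by
      simpa using HasDerivAt.comp_add_const x t h₂
    have := hmax.hasDerivAt_eq_zero (hm.sub h1')
    linarith
  -- With the minimum at the left end, difference quotients of `H` into the window are nonnegative.
  -- This rules out slope -1 at the foot.
  have nonneg₁ : (∀ y ∈ Icc (x - t) (x + t), H (x - t) ≤ H y) → 0 ≤ d₁ := by
    intro h
    refine ge_of_tendsto ((hasDerivWithinAt_iff_tendsto_slope' (by simp)).1 (h₁.hasDerivWithinAt (s := Ioi (x - t)))) ?_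
    have : Ioo (x - t) (x + t) ∈ nhdsWithin (x - t) (Ioi (x - t)) := Ioo_mem_nhdsGT (by linarith)
    filter_upwards [this] with y hy
    rw [slope_def_field]
    exact div_nonneg (by linarith [h y ⟨hy.1.le, hy.2.le⟩]) (by linarith [hy.1])
  have nonpos₂ : (∀ y ∈ Icc (x - t) (x + t), H (x + t) ≤ H y) → d₂ ≤ 0 := by
    intro h
    refine le_of_tendsto ((hasDerivWithinAt_iff_tendsto_slope' (by simp)).1 (h₂.hasDerivWithinAt (s := Iio (x + t)))) ?_
    have : Ioo (x - t) (x + t) ∈ nhdsWithin (x + t) (Iio (x + t)) := Ioo_mem_nhdsLT (by linarith)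
    filter_upwards [this] with y hy
    rw [slope_def_field]
    exact div_nonpos_of_nonneg_of_nonpos (by linarith [h y ⟨hy.1.le, hy.2.le⟩]) (by linarith [hy.2])
  -- A minimizer strictly inside the window stays inside the windows of nearby points, so the
  -- erosion has a local maximum at `x`.
  have interior : ∀ y ∈ Ioo (x - t) (x + t), erosion H t x = H y → m = 0 := by
    intro y hy e
    have hmax : IsLocalMax (erosion H t) x := by
      have h1 : ∀ᶠ u in nhds x, y - t < u := eventually_gt_nhds (by linarith [hy.2])
      have h2 : ∀ᶠ u in nhds x, u < y + t := eventually_lt_nhds (by linarith [hy.1])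
      filter_upwards [h1, h2] with u hu1 hu2
      rw [e]
      exact erosion_le hH ⟨by linarith, by linarith⟩
    exact hmax.hasDerivAt_eq_zero hm
  have key : ∀ d : ℝ, ∀ z, d = indicator R 1 z - indicator L 1 z → z ∉ R ∩ L →
      (z ∈ R → d = 1) ∧ (z ∈ L → d = -1) ∧ (z ∉ R → z ∉ L → d = 0) := by
    intro d z hd hz
    by_cases hR : z ∈ R <;> by_cases hL : z ∈ L <;> simp_all
  obtain ⟨a1, a2, a3⟩ := key d₁ _ hd₁ hn₁
  obtain ⟨b1, b2, b3⟩ := key d₂ _ hd₂ hn₂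
  by_cases hA : ∀ y ∈ Icc (x - t) (x + t), H (x - t) ≤ H y
  · have hm1 := left hA
    have hd := nonneg₁ hA
    by_cases hR : x - t ∈ R
    · have hx : x ∈ survR H R t := ⟨hR, hA⟩
      -- If both particles survived at `x`, the slope of the erosion would be 1 and -1 at once.
      have hx' : x ∉ survL H L t := by
        rintro ⟨hL, hB⟩
        have := right hB
        rw [b2 hL] at this
        rw [a1 hR] at hm1
        linarith
      rw [indicator_of_mem hx, indicator_of_notMem hx', hm1, a1 hR]; simp
    · have hx : x ∉ survR H R t := fun h => hR h.1
      have hL : x - t ∉ L := fun h => by rw [a2 h] at hd; linarith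
      have hx' : x ∉ survL H L t := by
        rintro ⟨hL', hB⟩
        have := right hB
        rw [b2 hL'] at this
        rw [a3 hR hL] at hm1
        linarith
      rw [indicator_of_notMem hx, indicator_of_notMem hx', hm1, a3 hR hL]; simp
  · have hx : x ∉ survR H R t := fun h => hA h.2
    by_cases hB : ∀ y ∈ Icc (x - t) (x + t), H (x + t) ≤ H y
    · have hm1 := right hB
      have hd := nonpos₂ hB
      by_cases hL : x + t ∈ L
      · have hx' : x ∈ survL H L t := ⟨hL, hB⟩
        rw [indicator_of_notMem hx, indicator_of_mem hx', hm1, b2 hL]; simp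
      · have hx' : x ∉ survL H L t := fun h => hL h.1
        have hR : x + t ∉ R := fun h => by rw [b1 h] at hd; linarith
        rw [indicator_of_notMem hx, indicator_of_notMem hx', hm1, b3 hR hL]; simp
    · have hx' : x ∉ survL H L t := fun h => hB h.2
      rw [indicator_of_notMem hx, indicator_of_notMem hx']
      obtain ⟨y, hy, e⟩ := erosion_exists hH ht.le x
      have hy1 : y ≠ x - t := by
        rintro rfl
        exact hA fun z hz => e ▸ erosion_le hH hz
      have hy2 : y ≠ x + t := by
        rintro rfl
        exact hB fun z hz => e ▸ erosion_le hH hz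
      rw [interior y ⟨lt_of_le_of_ne hy.1 (Ne.symm hy1), lt_of_le_of_ne hy.2 hy2⟩ e]; simp

/-- The windows of radius s about the points of a window of radius t fill the window of radius s +
t. This is the semigroup law for a single level. -/
theorem erosion_erosion_le_iff {s : ℝ} (hH : Continuous H) (hs : 0 ≤ s) (ht : 0 ≤ t) {c : ℝ} :
    (∀ y ∈ Icc (x - t) (x + t), c ≤ erosion H s y) ↔
      ∀ y ∈ Icc (x - (s + t)) (x + (s + t)), c ≤ H y := by
  simp only [erosion_le_iff hH hs]
  constructor
  · intro h y hy
    rcases le_total y (x - t) with h1 | h1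
    · exact h (x - t) ⟨le_rfl, by linarith⟩ y ⟨by linarith [hy.1], by linarith⟩
    rcases le_total (x + t) y with h2 | h2
    · exact h (x + t) ⟨by linarith, le_rfl⟩ y ⟨by linarith, by linarith [hy.2]⟩
    · exact h y ⟨h1, h2⟩ y ⟨by linarith, by linarith⟩
  · intro h y hy z hz
    exact h z ⟨by linarith [hy.1, hz.1], by linarith [hy.2, hz.2]⟩

end erosion

section primitive

variable {q : ℝ → ℝ} {R L : Set ℝ}

theorem lipschitz_primitive (hq : LocallyIntegrable q) (hb : ∀ᵐ z, |q z| ≤ 1) :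
    LipschitzWith 1 (fun y => ∫ z in (0 : ℝ)..y, q z) := by
  have hi : ∀ a b, IntervalIntegrable q volume a b := fun a b =>
    (hq.integrableOn_isCompact isCompact_uIcc).intervalIntegrable
  apply LipschitzWith.of_dist_le_mul
  intro x y
  rw [Real.dist_eq, intervalIntegral.integral_interval_sub_left (hi _ _) (hi _ _), Real.dist_eq]
  have := intervalIntegral.norm_integral_le_of_norm_le_const_ae (a := y) (b := x) (C := 1)
    (f := q) (hb.mono fun z hz _ => by simpa using hz)
  simpa using this

/-- The surviving particles of both kinds form the derivative of the erosion. -/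
theorem integral_surviving (hq : LocallyIntegrable q) (hb : ∀ᵐ z, |q z| ≤ 1)
    (hRL : ∀ᵐ z, q z = indicator R 1 z - indicator L 1 z) (hn : ∀ᵐ z : ℝ, z ∉ R ∩ L)
    {t : ℝ} (ht : 0 < t) {q' : ℝ → ℝ}
    (hq' : ∀ᵐ z, q' z = indicator (survR (fun y => ∫ z in (0 : ℝ)..y, q z) R t) 1 z
      - indicator (survL (fun y => ∫ z in (0 : ℝ)..y, q z) L t) 1 z) (a b : ℝ) :
    ∫ z in a..b, q' z = erosion (fun y => ∫ z in (0 : ℝ)..y, q z) t b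
      - erosion (fun y => ∫ z in (0 : ℝ)..y, q z) t a := by
  set H : ℝ → ℝ := fun y => ∫ z in (0 : ℝ)..y, q z with hHdef
  have hH : LipschitzWith 1 H := lipschitz_primitive hq hb
  have hE := erosion_lipschitz hH ht.le
  -- The erosion is Lipschitz, hence absolutely continuous, hence the integral of its derivative;
  -- only an almost everywhere identity remains.
  rw [← (hE.lipschitzOnWith (s := uIcc a b)).absolutelyContinuousOnInterval.integral_deriv_eq_sub]
  apply intervalIntegral.integral_congr_ae'
  all_goals
    -- `deriv_erosion` needs its hypotheses at z - t and z + t; translations preserve null sets.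
    have tr : ∀ (p : ℝ → Prop) (c : ℝ), (∀ᵐ z, p z) → ∀ᵐ z, p (z + c) := fun p c hp =>
      (measurePreserving_add_right volume c).quasiMeasurePreserving.ae hp
    have hd : ∀ᵐ z, HasDerivAt H (q z) z := by
      filter_upwards [_root_.LocallyIntegrable.ae_hasDerivAt_integral hq] with z hz using hz 0
    have hall := (hd.and hRL).and hn
    filter_upwards [hE.ae_differentiableAt_real, tr _ (-t) hall, tr _ t hall, hq']
      with z h1 h2 h3 h4 _
    rw [h4]
    simp only [← sub_eq_add_neg] at h2
    exact (deriv_erosion hH.continuous ht h1.hasDerivAt h2.1.1 h3.1.1 h2.1.2 h3.1.2 h2.2 h3.2).symm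

end primitive

end erosions

/-! ### The space interval, regular data and the charge of a level. -/

section data

/-! ### The space interval -/

/-- `S` is the whole line or a compact interval with nonempty interior. -/
def IsSpace (S : Set ℝ) : Prop := S = univ ∨ ∃ a₁ a₂ : ℝ, a₁ < a₂ ∧ S = Icc a₁ a₂

theorem exists_lt_of_not_isLeast {S : Set ℝ} {x : ℝ} (hx : x ∈ S) (h : ¬ IsLeast S x) : ∃ a ∈ S, a < x := by
  by_contra! hc
  exact h ⟨hx, hc⟩

theorem exists_gt_of_not_isGreatest {S : Set ℝ} {x : ℝ} (hx : x ∈ S) (h : ¬ IsGreatest S x) : ∃ a ∈ S, x < a := by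
  by_contra! hc
  exact h ⟨hx, hc⟩

namespace IsSpace

variable {S : Set ℝ}

theorem isClosed (hS : IsSpace S) : IsClosed S := by
  rcases hS with rfl | ⟨a, b, _, rfl⟩
  exacts [isClosed_univ, isClosed_Icc]

theorem ordConnected (hS : IsSpace S) : S.OrdConnected := by
  rcases hS with rfl | ⟨a, b, _, rfl⟩
  exacts [ordConnected_univ, ordConnected_Icc]

theorem Icc_subset (hS : IsSpace S) {x y : ℝ} (hx : x ∈ S) (hy : y ∈ S) : Icc x y ⊆ S := hS.ordConnected.out hx hy

theorem exists_isLeast (hS : IsSpace S) {x a : ℝ} (hx : x ∉ S) (ha : a ∈ S) (h : x < a) :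
    ∃ a₁, IsLeast S a₁ ∧ x < a₁ := by
  rcases hS with rfl | ⟨c, d, hcd, rfl⟩
  · exact absurd (mem_univ x) hx
  · refine ⟨c, isLeast_Icc hcd.le, ?_⟩
    by_contra hc
    exact hx ⟨not_lt.1 hc, h.le.trans ha.2⟩

theorem exists_isGreatest (hS : IsSpace S) {x a : ℝ} (hx : x ∉ S) (ha : a ∈ S) (h : a < x) :
    ∃ a₂, IsGreatest S a₂ ∧ a₂ < x := by
  rcases hS with rfl | ⟨c, d, hcd, rfl⟩
  · exact absurd (mem_univ x) hx
  · refine ⟨d, isGreatest_Icc hcd.le, ?_⟩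
    by_contra hc
    exact hx ⟨ha.1.trans h.le, not_lt.1 hc⟩

theorem not_isLeast_isGreatest (hS : IsSpace S) {x : ℝ} (h₁ : IsLeast S x) (h₂ : IsGreatest S x) : False := by
  rcases hS with rfl | ⟨c, d, hcd, rfl⟩
  · linarith [h₁.2 (mem_univ (x - 1))]
  · have := h₁.2 (left_mem_Icc.2 hcd.le)
    have := h₂.2 (right_mem_Icc.2 hcd.le)
    linarith

theorem reflect (hS : IsSpace S) : IsSpace (reflectSet S) := by
  rcases hS with rfl | ⟨c, d, hcd, rfl⟩
  · left; ext; simp [reflectSet]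
  · refine Or.inr ⟨-d, -c, by linarith, ?_⟩
    ext x
    simp only [reflectSet, mem_ofPred_eq, mem_Icc]
    constructor <;> rintro ⟨h1, h2⟩ <;> constructor <;> linarith

end IsSpace

/-! ### The reflection that exchanges the two components. -/

section reflect

variable {S : Set ℝ} {f : ℝ → ℝ} {x : ℝ}

@[simp] theorem reflectSet_reflectSet : reflectSet (reflectSet S) = S := by
  ext; simp [reflectSet]

@[simp] theorem reflectData_reflectData : reflectData (reflectData f) = f := by
  ext; simp [reflectData]

@[simp] theorem neg_mem_reflectSet : -x ∈ reflectSet S ↔ x ∈ S := by simp [reflectSet]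

theorem mem_reflectSet : x ∈ reflectSet S ↔ -x ∈ S := Iff.rfl

theorem lowerBounds_reflectSet : x ∈ lowerBounds (reflectSet S) ↔ -x ∈ upperBounds S := by
  constructor
  · intro h a ha
    have := h (show -a ∈ reflectSet S by simpa using ha)
    linarith
  · intro h a ha
    have := h ha
    linarith

theorem upperBounds_reflectSet : x ∈ upperBounds (reflectSet S) ↔ -x ∈ lowerBounds S := by
  have := lowerBounds_reflectSet (S := reflectSet S) (x := -x)
  simpa using this.symm

theorem isLeast_reflectSet : IsLeast (reflectSet S) x ↔ IsGreatest S (-x) :=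
  and_congr Iff.rfl lowerBounds_reflectSet

theorem isGreatest_reflectSet : IsGreatest (reflectSet S) x ↔ IsLeast S (-x) :=
  and_congr Iff.rfl upperBounds_reflectSet

theorem strictMonoOn_reflectData {A : Set ℝ} :
    StrictMonoOn (reflectData f) (reflectSet A) ↔ StrictMonoOn f A := by
  have key : ∀ {f : ℝ → ℝ} {A : Set ℝ}, StrictMonoOn f A →
      StrictMonoOn (reflectData f) (reflectSet A) := fun h x hx y hy hxy => by
    have := h (a := -y) hy (b := -x) hx (by linarith)
    simp only [reflectData]; linarith
  exact ⟨fun h => by simpa using key h, key⟩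

theorem strictAntiOn_reflectData {A : Set ℝ} :
    StrictAntiOn (reflectData f) (reflectSet A) ↔ StrictAntiOn f A := by
  have key : ∀ {f : ℝ → ℝ} {A : Set ℝ}, StrictAntiOn f A →
      StrictAntiOn (reflectData f) (reflectSet A) := fun h x hx y hy hxy => by
    have := h (a := -y) hy (b := -x) hx (by linarith)
    simp only [reflectData]; linarith
  exact ⟨fun h => by simpa using key h, key⟩

theorem strictMonotoneOn_reflectData {A : Set ℝ} :
    StrictMonotoneOn (reflectData f) (reflectSet A) ↔ StrictMonotoneOn f A :=
  or_congr strictMonoOn_reflectData strictAntiOn_reflectData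

theorem reflectSet_Icc {a b : ℝ} : reflectSet (Icc a b) = Icc (-b) (-a) := by
  ext x
  simp only [reflectSet, mem_ofPred_eq, mem_Icc]
  constructor <;> rintro ⟨h1, h2⟩ <;> constructor <;> linarith

theorem reflectSet_inter {A B : Set ℝ} : reflectSet (A ∩ B) = reflectSet A ∩ reflectSet B := rfl

theorem continuousOn_reflectData (h : ContinuousOn f S) :
    ContinuousOn (reflectData f) (reflectSet S) :=
  (h.comp continuous_neg.continuousOn fun _ hx => hx).neg

end reflect

/-! ### Regular data -/

/-- Continuous ordered data which agree at the endpoints and are strictly monotone on both sides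
of every point. -/
structure RegularData (S : Set ℝ) (f g : ℝ → ℝ) : Prop where
  cont_f : ContinuousOn f S
  cont_g : ContinuousOn g S
  le : ∀ x ∈ S, g x ≤ f x
  eq_left : ∀ x, IsLeast S x → f x = g x
  eq_right : ∀ x, IsGreatest S x → f x = g x
  f_left : ∀ z ∈ S, ∃ ε > 0, StrictMonotoneOn f (Icc (z - ε) z ∩ S)
  f_right : ∀ z ∈ S, ∃ ε > 0, StrictMonotoneOn f (Icc z (z + ε) ∩ S)
  g_left : ∀ z ∈ S, ∃ ε > 0, StrictMonotoneOn g (Icc (z - ε) z ∩ S)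
  g_right : ∀ z ∈ S, ∃ ε > 0, StrictMonotoneOn g (Icc z (z + ε) ∩ S)

section

variable {S : Set ℝ} {f g : ℝ → ℝ}

theorem StrictMonotoneOn.mono {A B : Set ℝ} (h : StrictMonotoneOn f A) (hB : B ⊆ A) :
    StrictMonotoneOn f B := h.imp (fun h => h.mono hB) (fun h => h.mono hB)

theorem StrictMonotoneOn.injOn {A : Set ℝ} (h : StrictMonotoneOn f A) : InjOn f A :=
  h.elim (fun h => h.injOn) (fun h => h.injOn)

theorem RegularData.reflect (h : RegularData S f g) :
    RegularData (reflectSet S) (reflectData g) (reflectData f) where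
  cont_f := continuousOn_reflectData h.cont_g
  cont_g := continuousOn_reflectData h.cont_f
  le x hx := neg_le_neg (h.le _ hx)
  eq_left x hx := congrArg Neg.neg (h.eq_right _ (isLeast_reflectSet.1 hx)).symm
  eq_right x hx := congrArg Neg.neg (h.eq_left _ (isGreatest_reflectSet.1 hx)).symm
  f_left z hz := by
    obtain ⟨ε, h0, h1⟩ := h.g_right _ hz
    refine ⟨ε, h0, ?_⟩
    have := strictMonotoneOn_reflectData.2 h1
    rw [reflectSet_inter, reflectSet_Icc] at this
    convert this using 3 <;> ring
  f_right z hz := by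
    obtain ⟨ε, h0, h1⟩ := h.g_left _ hz
    refine ⟨ε, h0, ?_⟩
    have := strictMonotoneOn_reflectData.2 h1
    rw [reflectSet_inter, reflectSet_Icc] at this
    convert this using 3 <;> ring
  g_left z hz := by
    obtain ⟨ε, h0, h1⟩ := h.f_right _ hz
    refine ⟨ε, h0, ?_⟩
    have := strictMonotoneOn_reflectData.2 h1
    rw [reflectSet_inter, reflectSet_Icc] at this
    convert this using 3 <;> ring
  g_right z hz := by
    obtain ⟨ε, h0, h1⟩ := h.f_left _ hz
    refine ⟨ε, h0, ?_⟩
    have := strictMonotoneOn_reflectData.2 h1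
    rw [reflectSet_inter, reflectSet_Icc] at this
    convert this using 3 <;> ring

/-- On each side of a point the data are injective, so a level set is locally finite. Hence almost
no point carries particles of both kinds, and the total charge is continuous in the level. -/
theorem volume_level_eq_zero
    (hl : ∀ z ∈ S, ∃ ε > 0, StrictMonotoneOn f (Icc (z - ε) z ∩ S))
    (hr : ∀ z ∈ S, ∃ ε > 0, StrictMonotoneOn f (Icc z (z + ε) ∩ S)) (b : ℝ) :
    volume {y | y ∈ S ∧ f y = b} = 0 := by
  apply measure_null_of_locally_null
  rintro z ⟨hz, -⟩
  obtain ⟨ε, h0, h1⟩ := hl z hz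
  obtain ⟨δ, h0', h2⟩ := hr z hz
  refine ⟨{y | y ∈ S ∧ f y = b} ∩ Ioo (z - ε) (z + δ),
    inter_mem_nhdsWithin _ (Ioo_mem_nhds (by linarith) (by linarith)), ?_⟩
  apply Set.Finite.measure_zero
  refine Set.Finite.subset (s := ({y | y ∈ Icc (z - ε) z ∩ S ∧ f y = b} ∪
    {y | y ∈ Icc z (z + δ) ∩ S ∧ f y = b})) (Finite.union ?_ ?_) ?_
  · exact Subsingleton.finite fun x hx y hy => h1.injOn hx.1 hy.1 (hx.2.trans hy.2.symm)
  · exact Subsingleton.finite fun x hx y hy => h2.injOn hx.1 hy.1 (hx.2.trans hy.2.symm)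
  · rintro y ⟨⟨h3, h4⟩, h5, h6⟩
    rcases le_total y z with h | h
    · exact Or.inl ⟨⟨⟨h5.le, h⟩, h3⟩, h4⟩
    · exact Or.inr ⟨⟨⟨h, h6.le⟩, h3⟩, h4⟩

end

theorem isClosed_setOf_lowerBounds (S : Set ℝ) : IsClosed (lowerBounds S) := by
  have : lowerBounds S = ⋂ a ∈ S, Iic a := by ext x; simp [lowerBounds]
  rw [this]
  exact isClosed_biInter fun _ _ => isClosed_Iic

theorem isClosed_setOf_upperBounds (S : Set ℝ) : IsClosed (upperBounds S) := by
  have : upperBounds S = ⋂ a ∈ S, Ici a := by ext x; simp [upperBounds]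
  rw [this]
  exact isClosed_biInter fun _ _ => isClosed_Ici

/-! ### The charge -/

/-- The set occupied by particles of speed `1` at level `b`. -/
def rightSet (S : Set ℝ) (f : ℝ → ℝ) (b : ℝ) : Set ℝ := {y | y ∈ S ∧ f y ≤ b} ∪ lowerBounds S

/-- The set occupied by particles of speed `-1` at level `b`. -/
def leftSet (S : Set ℝ) (g : ℝ → ℝ) (b : ℝ) : Set ℝ := {y | y ∈ S ∧ b ≤ g y} ∪ upperBounds S

/-- The total charge of `[x, y]`. -/
def totalCharge (S : Set ℝ) (f g : ℝ → ℝ) (b x y : ℝ) : ℝ := ∫ z in x..y, charge S f g b z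

section charge

variable {S : Set ℝ} {f g : ℝ → ℝ} {b b' x y z : ℝ}

theorem charge_nonneg (h : z ∉ leftSet S g b) : 0 ≤ charge S f g b z := by
  have h1 : z ∉ {y | y ∈ S ∧ b ≤ g y} := fun h' => h (Or.inl h')
  have h2 : z ∉ upperBounds S := fun h' => h (Or.inr h')
  rw [charge, indicator_of_notMem h1, indicator_of_notMem h2]
  have h3 := indicator_nonneg (s := {y | y ∈ S ∧ f y ≤ b}) (f := (1 : ℝ → ℝ))
    (fun _ _ => zero_le_one) z
  have h4 := indicator_nonneg (s := lowerBounds S) (f := (1 : ℝ → ℝ)) (fun _ _ => zero_le_one) z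
  linarith

theorem one_le_charge (h : z ∈ rightSet S f b) (h' : z ∉ leftSet S g b) :
    1 ≤ charge S f g b z := by
  have h1 : z ∉ {y | y ∈ S ∧ b ≤ g y} := fun h => h' (Or.inl h)
  have h2 : z ∉ upperBounds S := fun h => h' (Or.inr h)
  rw [charge, indicator_of_notMem h1, indicator_of_notMem h2]
  have h3 := indicator_nonneg (s := {y | y ∈ S ∧ f y ≤ b}) (f := (1 : ℝ → ℝ))
    (fun _ _ => zero_le_one) z
  have h4 := indicator_nonneg (s := lowerBounds S) (f := (1 : ℝ → ℝ)) (fun _ _ => zero_le_one) z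
  rcases h with h | h
  · rw [indicator_of_mem h]; simp; exact h4
  · rw [indicator_of_mem (s := lowerBounds S) h]; simp; exact h3

theorem indicator_one_congr {A B : Set ℝ} {z w : ℝ} (h : z ∈ A ↔ w ∈ B) :
    indicator A (1 : ℝ → ℝ) z = indicator B 1 w := by
  by_cases hw : w ∈ B
  · rw [indicator_of_mem hw, indicator_of_mem (h.2 hw)]; rfl
  · rw [indicator_of_notMem hw, indicator_of_notMem (mt h.1 hw)]

/-- Reflection exchanges the two kinds of particles, which changes the sign of the charge, and
negates the level. -/
theorem charge_reflect : charge (reflectSet S) (reflectData g) (reflectData f) b z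
    = - charge S f g (-b) (-z) := by
  have e1 := indicator_one_congr (A := {y | y ∈ reflectSet S ∧ reflectData g y ≤ b})
    (B := {y | y ∈ S ∧ -b ≤ g y}) (z := z) (w := -z) (and_congr Iff.rfl neg_le)
  have e2 := indicator_one_congr (A := {y | y ∈ reflectSet S ∧ b ≤ reflectData f y})
    (B := {y | y ∈ S ∧ f y ≤ -b}) (z := z) (w := -z) (and_congr Iff.rfl le_neg)
  have e3 := indicator_one_congr (lowerBounds_reflectSet (S := S) (x := z))
  have e4 := indicator_one_congr (upperBounds_reflectSet (S := S) (x := z))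
  rw [charge, charge, e1, e2, e3, e4]; ring

theorem rightSet_reflect : z ∈ rightSet (reflectSet S) (reflectData g) b
    ↔ -z ∈ leftSet S g (-b) := by
  apply or_congr _ lowerBounds_reflectSet
  simp only [mem_ofPred_eq, reflectSet, reflectData]
  rw [neg_le]

theorem leftSet_reflect : z ∈ leftSet (reflectSet S) (reflectData f) b
    ↔ -z ∈ rightSet S f (-b) := by
  apply or_congr _ upperBounds_reflectSet
  simp only [mem_ofPred_eq, reflectSet, reflectData]
  rw [le_neg]

theorem indicator_one_mono {A B : Set ℝ} (h : A ⊆ B) (z : ℝ) :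
    indicator A (1 : ℝ → ℝ) z ≤ indicator B 1 z :=
  indicator_le_indicator_of_subset h (fun _ => zero_le_one) z

/-- Raising the level adds particles of speed 1 and removes particles of speed -1. -/
theorem charge_mono (h : b ≤ b') : charge S f g b z ≤ charge S f g b' z := by
  have h1 := indicator_one_mono (A := {y | y ∈ S ∧ f y ≤ b}) (B := {y | y ∈ S ∧ f y ≤ b'})
    (fun y hy => ⟨hy.1, hy.2.trans h⟩) z
  have h2 := indicator_one_mono (A := {y | y ∈ S ∧ b' ≤ g y}) (B := {y | y ∈ S ∧ b ≤ g y})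
    (fun y hy => ⟨hy.1, h.trans hy.2⟩) z
  simp only [charge]; linarith

/-- The charge of a point grows by at least one if the level passes one of the two data. -/
theorem charge_add_one_le (hbb : b ≤ b') (hz : z ∈ S)
    (h : (b < f z ∧ f z ≤ b') ∨ (b ≤ g z ∧ g z < b')) :
    charge S f g b z + 1 ≤ charge S f g b' z := by
  have h1 := indicator_one_mono (A := {y | y ∈ S ∧ f y ≤ b}) (B := {y | y ∈ S ∧ f y ≤ b'})
    (fun y hy => ⟨hy.1, hy.2.trans hbb⟩) z
  have h2 := indicator_one_mono (A := {y | y ∈ S ∧ b' ≤ g y}) (B := {y | y ∈ S ∧ b ≤ g y})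
    (fun y hy => ⟨hy.1, hbb.trans hy.2⟩) z
  simp only [charge]
  rcases h with h | h
  · rw [indicator_of_notMem (s := {y | y ∈ S ∧ f y ≤ b}) (fun h' => not_le.2 h.1 h'.2),
      indicator_of_mem (s := {y | y ∈ S ∧ f y ≤ b'}) ⟨hz, h.2⟩]
    simp only [Pi.one_apply]; linarith
  · rw [indicator_of_notMem (s := {y | y ∈ S ∧ b' ≤ g y}) (fun h' => not_le.2 h.2 h'.2),
      indicator_of_mem (s := {y | y ∈ S ∧ b ≤ g y}) ⟨hz, h.1⟩]
    simp only [Pi.one_apply]; linarith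

theorem ae_not_endpoint (S : Set ℝ) : ∀ᵐ z : ℝ, ¬ IsLeast S z ∧ ¬ IsGreatest S z := by
  rw [← Filter.eventually_and.symm]
  constructor
  · exact measure_mono_null (t := {z | IsLeast S z}) (fun z hz => by simpa using hz)
      (Subsingleton.measure_zero (fun x hx y hy => hx.unique hy) _)
  · exact measure_mono_null (t := {z | IsGreatest S z}) (fun z hz => by simpa using hz)
      (Subsingleton.measure_zero (fun x hx y hy => hx.unique hy) _)

/-- At an endpoint `charge` can count the data and the reservoir twice; elsewhere the two parts of
`rightSet`, and those of `leftSet`, exclude each other. -/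
theorem charge_eq_indicator (h : ¬ IsLeast S z ∧ ¬ IsGreatest S z) :
    charge S f g b z = indicator (rightSet S f b) 1 z - indicator (leftSet S g b) 1 z := by
  have d1 : ¬ (z ∈ {y | y ∈ S ∧ f y ≤ b} ∧ z ∈ lowerBounds S) := fun h' => h.1 ⟨h'.1.1, h'.2⟩
  have d2 : ¬ (z ∈ {y | y ∈ S ∧ b ≤ g y} ∧ z ∈ upperBounds S) := fun h' => h.2 ⟨h'.1.1, h'.2⟩
  have key : ∀ A B : Set ℝ, ¬ (z ∈ A ∧ z ∈ B) →
      indicator (A ∪ B) (1 : ℝ → ℝ) z = indicator A 1 z + indicator B 1 z := by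
    intro A B h
    by_cases hA : z ∈ A <;> by_cases hB : z ∈ B <;> simp_all
  rw [rightSet, leftSet, key _ _ d1, key _ _ d2, charge]; ring

theorem ae_abs_charge_le_one : ∀ᵐ z : ℝ, |charge S f g b z| ≤ 1 := by
  filter_upwards [ae_not_endpoint S] with z hz
  rw [charge_eq_indicator hz]
  by_cases h1 : z ∈ rightSet S f b <;> by_cases h2 : z ∈ leftSet S g b <;> simp [h1, h2]

theorem isClosed_rightSet (hS : IsSpace S) (hf : ContinuousOn f S) (b : ℝ) :
    IsClosed (rightSet S f b) :=
  (hf.preimage_isClosed_of_isClosed hS.isClosed isClosed_Iic).union (isClosed_setOf_lowerBounds S)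

theorem measurable_charge (hS : IsSpace S) (h : RegularData S f g) (b : ℝ) :
    Measurable (charge S f g b) := by
  have h1 : IsClosed {y | y ∈ S ∧ f y ≤ b} :=
    h.cont_f.preimage_isClosed_of_isClosed hS.isClosed isClosed_Iic
  have h2 : IsClosed {y | y ∈ S ∧ b ≤ g y} :=
    h.cont_g.preimage_isClosed_of_isClosed hS.isClosed isClosed_Ici
  unfold charge
  have m : Measurable (1 : ℝ → ℝ) := measurable_const
  exact (((m.indicator h1.measurableSet).add (m.indicator (isClosed_setOf_lowerBounds S).measurableSet)).sub
    (m.indicator h2.measurableSet)).sub (m.indicator (isClosed_setOf_upperBounds S).measurableSet)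

theorem locallyIntegrable_charge (hS : IsSpace S) (h : RegularData S f g) (b : ℝ) :
    LocallyIntegrable (charge S f g b) := by
  refine (locallyIntegrable_const (1 : ℝ)).mono (measurable_charge hS h b).aestronglyMeasurable ?_
  filter_upwards [ae_abs_charge_le_one] with z hz
  simpa using hz

theorem intervalIntegrable_charge (hS : IsSpace S) (h : RegularData S f g) (b x y : ℝ) :
    IntervalIntegrable (charge S f g b) volume x y :=
  ((locallyIntegrable_charge hS h b).integrableOn_isCompact isCompact_uIcc).intervalIntegrable

/-- A point of `S` carrying both kinds because of the data satisfies f ≤ b ≤ g ≤ f, so it lies on a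
null level set; the reservoirs contribute at most endpoints. -/
theorem ae_notMem_inter (h : RegularData S f g) (hS : IsSpace S) (b : ℝ) :
    ∀ᵐ z, z ∉ rightSet S f b ∩ leftSet S g b := by
  have h1 := volume_level_eq_zero h.f_left h.f_right b
  filter_upwards [ae_not_endpoint S, compl_mem_ae_iff.2 h1] with z hz hz'
  rintro ⟨h3 | h3, h4 | h4⟩
  · exact hz' ⟨h3.1, le_antisymm h3.2 (h4.2.trans (h.le _ h3.1))⟩
  · exact hz.2 ⟨h3.1, h4⟩
  · exact hz.1 ⟨h4.1, h3⟩
  · rcases hS with rfl | ⟨c, d, hcd, rfl⟩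
    · linarith [h3 (mem_univ (z - 1))]
    · have := h3 (right_mem_Icc.2 hcd.le)
      have := h4 (left_mem_Icc.2 hcd.le)
      have := h3 (left_mem_Icc.2 hcd.le)
      linarith [h4 (right_mem_Icc.2 hcd.le)]

end charge

/-! ### The total charge of an interval -/

section totalCharge

variable {S : Set ℝ} {f g : ℝ → ℝ} {b b' x y z : ℝ}

theorem totalCharge_reflect : totalCharge (reflectSet S) (reflectData g) (reflectData f) b x y
    = - totalCharge S f g (-b) (-y) (-x) := by
  simp only [totalCharge, charge_reflect]
  rw [intervalIntegral.integral_neg, intervalIntegral.integral_comp_neg (charge S f g (-b))]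

@[simp] theorem totalCharge_self : totalCharge S f g b x x = 0 := intervalIntegral.integral_same

theorem totalCharge_add (hS : IsSpace S) (h : RegularData S f g) (b x y z : ℝ) :
    totalCharge S f g b x y + totalCharge S f g b y z = totalCharge S f g b x z :=
  intervalIntegral.integral_add_adjacent_intervals (intervalIntegrable_charge hS h b x y)
    (intervalIntegrable_charge hS h b y z)

theorem abs_totalCharge_le (x y : ℝ) : |totalCharge S f g b x y| ≤ |y - x| := by
  have := intervalIntegral.norm_integral_le_of_norm_le_const_ae (a := x) (b := y) (C := 1)
    (f := charge S f g b) (ae_abs_charge_le_one.mono fun z hz _ => by simpa using hz)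
  simpa [totalCharge] using this

theorem totalCharge_le (hxy : x ≤ y) : totalCharge S f g b x y ≤ y - x := by
  have := (abs_le.1 (abs_totalCharge_le (S := S) (f := f) (g := g) (b := b) x y)).2
  rwa [abs_of_nonneg (by linarith)] at this

theorem le_totalCharge (hxy : x ≤ y) : -(y - x) ≤ totalCharge S f g b x y := by
  have := (abs_le.1 (abs_totalCharge_le (S := S) (f := f) (g := g) (b := b) x y)).1
  rwa [abs_of_nonneg (by linarith)] at this

theorem continuous_totalCharge (hS : IsSpace S) (h : RegularData S f g) (b x : ℝ) :
    Continuous (totalCharge S f g b x) :=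
  intervalIntegral.continuous_primitive (intervalIntegrable_charge hS h b) x

theorem totalCharge_mono (hS : IsSpace S) (h : RegularData S f g) (hb : b ≤ b') (hxy : x ≤ y) :
    totalCharge S f g b x y ≤ totalCharge S f g b' x y :=
  intervalIntegral.integral_mono_on hxy (intervalIntegrable_charge hS h b x y)
    (intervalIntegrable_charge hS h b' x y) fun _ _ => charge_mono hb

theorem const_le_totalCharge (hS : IsSpace S) (h : RegularData S f g) {c : ℝ} (hxy : x ≤ y)
    (hc : ∀ z ∈ Ioo x y, c ≤ charge S f g b z) : c * (y - x) ≤ totalCharge S f g b x y := by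
  have := intervalIntegral.integral_mono_on_of_le_Ioo hxy
    (_root_.intervalIntegrable_const (μ := volume) (c := c))
    (intervalIntegrable_charge hS h b x y) hc
  simpa [mul_comm, totalCharge] using this

theorem totalCharge_nonneg (hS : IsSpace S) (h : RegularData S f g) (hxy : x ≤ y)
    (hc : ∀ z ∈ Ioo x y, z ∉ leftSet S g b) : 0 ≤ totalCharge S f g b x y := by
  simpa using const_le_totalCharge hS h hxy fun z hz => charge_nonneg (hc z hz)

theorem sub_le_totalCharge (hS : IsSpace S) (h : RegularData S f g) (hxy : x ≤ y)
    (hc : ∀ z ∈ Ioo x y, z ∈ rightSet S f b ∧ z ∉ leftSet S g b) :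
    y - x ≤ totalCharge S f g b x y := by
  simpa using const_le_totalCharge hS h hxy fun z hz => one_le_charge (hc z hz).1 (hc z hz).2

theorem totalCharge_nonpos (hS : IsSpace S) (h : RegularData S f g) (hxy : x ≤ y)
    (hc : ∀ z ∈ Ioo x y, z ∉ rightSet S f b) : totalCharge S f g b x y ≤ 0 := by
  have := totalCharge_nonneg hS.reflect h.reflect (b := -b) (x := -y) (y := -x) (by linarith)
    (fun z hz => by
      rw [leftSet_reflect, neg_neg]
      exact hc _ ⟨by linarith [hz.2], by linarith [hz.1]⟩)
  rw [totalCharge_reflect] at this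
  simpa using this

theorem totalCharge_le_neg (hS : IsSpace S) (h : RegularData S f g) (hxy : x ≤ y)
    (hc : ∀ z ∈ Ioo x y, z ∈ leftSet S g b ∧ z ∉ rightSet S f b) :
    totalCharge S f g b x y ≤ -(y - x) := by
  have := sub_le_totalCharge hS.reflect h.reflect (b := -b) (x := -y) (y := -x) (by linarith)
    (fun z hz => by
      rw [leftSet_reflect, rightSet_reflect, neg_neg]
      exact hc _ ⟨by linarith [hz.2], by linarith [hz.1]⟩)
  rw [totalCharge_reflect] at this
  simp only [neg_neg] at this
  linarith

theorem continuousAt_indicator_le {z b : ℝ} {A : Set ℝ} {u : ℝ → ℝ} (h : ¬ (z ∈ A ∧ u z = b)) :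
    ContinuousAt (fun b' => indicator {y | y ∈ A ∧ u y ≤ b'} (1 : ℝ → ℝ) z) b := by
  by_cases hA : z ∈ A
  · have hne : u z ≠ b := fun e => h ⟨hA, e⟩
    apply ContinuousAt.congr (f := fun _ => indicator {y | y ∈ A ∧ u y ≤ b} (1 : ℝ → ℝ) z)
      continuousAt_const
    rcases lt_or_gt_of_ne hne with h1 | h1
    · filter_upwards [eventually_gt_nhds h1] with b' hb'
      simp [indicator, hA, h1.le, hb'.le]
    · filter_upwards [eventually_lt_nhds h1] with b' hb'
      simp [indicator, not_le.2 h1, not_le.2 hb']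
  · simp only [indicator, mem_ofPred_eq, hA, false_and, if_false]
    exact continuousAt_const

theorem continuousAt_indicator_ge {z b : ℝ} {A : Set ℝ} {u : ℝ → ℝ} (h : ¬ (z ∈ A ∧ u z = b)) :
    ContinuousAt (fun b' => indicator {y | y ∈ A ∧ b' ≤ u y} (1 : ℝ → ℝ) z) b := by
  by_cases hA : z ∈ A
  · have hne : u z ≠ b := fun e => h ⟨hA, e⟩
    apply ContinuousAt.congr (f := fun _ => indicator {y | y ∈ A ∧ b ≤ u y} (1 : ℝ → ℝ) z)
      continuousAt_const
    rcases lt_or_gt_of_ne hne with h1 | h1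
    · filter_upwards [eventually_gt_nhds h1] with b' hb'
      simp [indicator, not_le.2 h1, not_le.2 hb']
    · filter_upwards [eventually_lt_nhds h1] with b' hb'
      simp [indicator, hA, h1.le, hb'.le]
  · simp only [indicator, mem_ofPred_eq, hA, false_and, if_false]
    exact continuousAt_const

/-- The total charge is continuous in the level, since level sets have measure zero. -/
theorem continuous_totalCharge_level (hS : IsSpace S) (h : RegularData S f g) (x y : ℝ) :
    Continuous fun b => totalCharge S f g b x y := by
  rw [continuous_iff_continuousAt]
  intro b
  apply intervalIntegral.continuousAt_of_dominated_interval (bound := fun _ => 1)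
  · exact Eventually.of_forall fun b' => (measurable_charge hS h b').aestronglyMeasurable
  · exact Eventually.of_forall fun b' => ae_abs_charge_le_one.mono fun z hz _ => by simpa using hz
  · exact _root_.intervalIntegrable_const
  · filter_upwards [compl_mem_ae_iff.2 (volume_level_eq_zero h.f_left h.f_right b),
      compl_mem_ae_iff.2 (volume_level_eq_zero h.g_left h.g_right b)] with z h1 h2 _
    exact (((continuousAt_indicator_le h1).add continuousAt_const).sub
      (continuousAt_indicator_ge h2)).sub continuousAt_const

end totalCharge

end data

/-! ### The explicit formulas as survival of particles, and the semigroup property. -/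

section evolution

/-! ### The explicit solution, level by level -/

/-- The explicit formula gives `v x t ≤ b`. -/
def lowV (S : Set ℝ) (f g : ℝ → ℝ) (b x t : ℝ) : Prop :=
  x - t ∈ rightSet S f b ∧ ∀ y ∈ Icc (x - t) (x + t), 0 ≤ totalCharge S f g b (x - t) y

/-- The explicit formula gives `w x t ≥ b`. -/
def highW (S : Set ℝ) (f g : ℝ → ℝ) (b x t : ℝ) : Prop :=
  x + t ∈ leftSet S g b ∧ ∀ y ∈ Icc (x - t) (x + t), totalCharge S f g b y (x + t) ≤ 0

/-- The explicit formula gives `v x t = p`. -/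
def IsV (S : Set ℝ) (f g : ℝ → ℝ) (t x p : ℝ) : Prop := ∀ b, p ≤ b ↔ lowV S f g b x t

/-- The explicit formula gives `w x t = r`. -/
def IsW (S : Set ℝ) (f g : ℝ → ℝ) (t x r : ℝ) : Prop := ∀ b, b ≤ r ↔ highW S f g b x t

/-- The explicit formula gives `v x t = p` and `w x t = r`; at an endpoint only one of the two
formulas is used. -/
def EvolvesAt (S : Set ℝ) (f g : ℝ → ℝ) (t x p r : ℝ) : Prop :=
  (¬ IsLeast S x → IsV S f g t x p) ∧ (¬ IsGreatest S x → IsW S f g t x r) ∧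
    (IsLeast S x ∨ IsGreatest S x → p = r)

/-- The explicit formula turns the data `f, g` into `f', g'` in time `t`. -/
def Evolves (S : Set ℝ) (f g : ℝ → ℝ) (t : ℝ) (f' g' : ℝ → ℝ) : Prop :=
  ∀ x ∈ S, EvolvesAt S f g t x (f' x) (g' x)

variable {S : Set ℝ} {f g : ℝ → ℝ} {b b' x y z t p r : ℝ}

theorem lowV_reflect :
    lowV (reflectSet S) (reflectData g) (reflectData f) b x t ↔ highW S f g (-b) (-x) t := by
  refine and_congr ?_ ?_
  · rw [rightSet_reflect, neg_sub, sub_eq_add_neg, add_comm]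
  · constructor
    · intro h y hy
      have := h (-y) ⟨by linarith [hy.2], by linarith [hy.1]⟩
      rw [totalCharge_reflect, neg_neg] at this
      rw [show -x + t = -(x - t) by ring]
      linarith
    · intro h y hy
      have := h (-y) ⟨by linarith [hy.2], by linarith [hy.1]⟩
      rw [totalCharge_reflect]
      rw [show -x + t = -(x - t) by ring] at this
      linarith

theorem isV_reflect :
    IsV (reflectSet S) (reflectData g) (reflectData f) t x p ↔ IsW S f g t (-x) (-p) := by
  constructor
  · intro h b
    have := h (-b)
    rw [lowV_reflect, neg_neg] at this
    rw [← this, le_neg]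
  · intro h b
    have := h (-b)
    rw [lowV_reflect, ← this, neg_le_neg_iff]

theorem isW_reflect :
    IsW (reflectSet S) (reflectData g) (reflectData f) t x p ↔ IsV S f g t (-x) (-p) := by
  have := isV_reflect (S := reflectSet S) (f := reflectData g) (g := reflectData f)
    (x := -x) (t := t) (p := -p)
  simpa using this.symm

theorem evolvesAt_reflect :
    EvolvesAt (reflectSet S) (reflectData g) (reflectData f) t x p r
      ↔ EvolvesAt S f g t (-x) (-r) (-p) := by
  unfold EvolvesAt
  rw [isLeast_reflectSet, isGreatest_reflectSet, isV_reflect, isW_reflect, or_comm, neg_inj,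
    eq_comm]
  tauto

theorem Evolves.reflect {f' g' : ℝ → ℝ} (h : Evolves S f g t f' g') :
    Evolves (reflectSet S) (reflectData g) (reflectData f) t (reflectData g') (reflectData f') := by
  intro x hx
  rw [evolvesAt_reflect]
  simpa [reflectData] using h (-x) hx

theorem IsV.unique {p' : ℝ} (h : IsV S f g t x p) (h' : IsV S f g t x p') : p = p' :=
  le_antisymm ((h _).2 ((h' _).1 le_rfl)) ((h' _).2 ((h _).1 le_rfl))

theorem IsW.unique {p' : ℝ} (h : IsW S f g t x p) (h' : IsW S f g t x p') : p = p' :=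
  le_antisymm ((h' _).2 ((h _).1 le_rfl)) ((h _).2 ((h' _).1 le_rfl))

theorem EvolvesAt.unique (hS : IsSpace S) {p' r' : ℝ} (h : EvolvesAt S f g t x p r)
    (h' : EvolvesAt S f g t x p' r') : p = p' ∧ r = r' := by
  by_cases h1 : IsLeast S x
  · have h2 : ¬ IsGreatest S x := fun h2 => hS.not_isLeast_isGreatest h1 h2
    have e := (h.2.1 h2).unique (h'.2.1 h2)
    exact ⟨by rw [h.2.2 (Or.inl h1), h'.2.2 (Or.inl h1), e], e⟩
  · have e := (h.1 h1).unique (h'.1 h1)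
    by_cases h2 : IsGreatest S x
    · exact ⟨e, by rw [← h.2.2 (Or.inr h2), ← h'.2.2 (Or.inr h2), e]⟩
    · exact ⟨e, (h.2.1 h2).unique (h'.2.1 h2)⟩

/-! ### Membership in the particle sets -/

/-- To the left of a point of `S` one is either in `S` or in the reservoir of particles of speed 1,
so only the data have to be checked. -/
theorem mem_rightSet_of_lt (hS : IsSpace S) {e : ℝ} (he : e ∈ S) (hz : z < e)
    (h : z ∈ S → f z ≤ b) : z ∈ rightSet S f b := by
  by_cases hzS : z ∈ S
  · exact Or.inl ⟨hzS, h hzS⟩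
  · obtain ⟨a, ha, hza⟩ := hS.exists_isLeast hzS he hz
    exact Or.inr fun y hy => hza.le.trans (ha.2 hy)

theorem notMem_leftSet_of_lt {e : ℝ} (he : e ∈ S) (hz : z < e)
    (h : z ∈ S → g z < b) : z ∉ leftSet S g b := by
  rintro (h' | h')
  · exact absurd (h h'.1) (not_lt.2 h'.2)
  · exact absurd (h' he) (not_le.2 hz)

theorem mem_leftSet_of_gt (hS : IsSpace S) {e : ℝ} (he : e ∈ S) (hz : e < z)
    (h : z ∈ S → b ≤ g z) : z ∈ leftSet S g b := by
  by_cases hzS : z ∈ S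
  · exact Or.inl ⟨hzS, h hzS⟩
  · obtain ⟨a, ha, hza⟩ := hS.exists_isGreatest hzS he hz
    exact Or.inr fun y hy => (ha.2 hy).trans hza.le

theorem notMem_rightSet_of_gt {e : ℝ} (he : e ∈ S) (hz : e < z)
    (h : z ∈ S → b < f z) : z ∉ rightSet S f b := by
  rintro (h' | h')
  · exact absurd (h h'.1) (not_lt.2 h'.2)
  · exact absurd (h' he) (not_le.2 hz)

theorem rightSet_mono (h : b ≤ b') : rightSet S f b ⊆ rightSet S f b' :=
  union_subset_union_left _ fun _ hy => ⟨hy.1, hy.2.trans h⟩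

theorem IsSpace.lt_or_exists_isLeast (hS : IsSpace S) (hx : x ∈ S) (hy : y ≤ x) :
    (y ∈ S ∧ ∃ e ∈ S, e < y) ∨ ∃ a, IsLeast S a ∧ y ≤ a := by
  by_cases hyS : y ∈ S
  · by_cases hl : IsLeast S y
    · exact Or.inr ⟨y, hl, le_rfl⟩
    · exact Or.inl ⟨hyS, exists_lt_of_not_isLeast hyS hl⟩
  · obtain ⟨a, ha, h⟩ := hS.exists_isLeast hyS hx (lt_of_le_of_ne hy fun e => hyS (e ▸ hx))
    exact Or.inr ⟨a, ha, h.le⟩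

/-! ### Monotonicity and closedness in the level -/

theorem lowV.mono (hS : IsSpace S) (h : RegularData S f g) (hb : b ≤ b')
    (hl : lowV S f g b x t) : lowV S f g b' x t :=
  ⟨rightSet_mono hb hl.1, fun y hy => (hl.2 y hy).trans (totalCharge_mono hS h hb hy.1)⟩

/-- The total charge is continuous in the level, so the survival conditions pass to the limit from
above. Thus the least admissible level is attained, as the equivalence in `IsV` requires. -/
theorem lowV_of_forall_gt (hS : IsSpace S) (h : RegularData S f g)
    (hl : ∀ b, p < b → lowV S f g b x t) : lowV S f g p x t := by
  refine ⟨?_, fun y hy => ?_⟩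
  · by_cases hx : x - t ∈ lowerBounds S
    · exact Or.inr hx
    · have h1 : ∀ b, p < b → x - t ∈ S ∧ f (x - t) ≤ b := fun b hb =>
        (hl b hb).1.resolve_right hx
      exact Or.inl ⟨(h1 (p + 1) (by linarith)).1, le_of_forall_gt_imp_ge_of_dense
        fun b hb => (h1 b hb).2⟩
  · have hc := (continuous_totalCharge_level hS h (x - t) y).continuousWithinAt (s := Ioi p) (x := p)
    exact ge_of_tendsto hc (eventually_mem_nhdsWithin.mono fun b hb => (hl b hb).2 y hy)

theorem isV_of (hS : IsSpace S) (h : RegularData S f g) (h₁ : ∀ b, p < b → lowV S f g b x t)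
    (h₂ : ∀ b, b < p → ¬ lowV S f g b x t) : IsV S f g t x p := by
  intro b
  constructor
  · exact fun hb => (lowV_of_forall_gt hS h h₁).mono hS h hb
  · intro hl
    by_contra hb
    exact h₂ b (not_le.1 hb) hl

/-- No particle of speed -1 comes from the data. Those of the reservoir beyond the right endpoint a
start in [a, x + t], which is no longer than [x - t, a] because x ≤ a, and [x - t, a] is full of
particles of speed 1 when y lies beyond a. -/
theorem totalCharge_nonneg_of_lt (hS : IsSpace S) (h : RegularData S f g) (hx : x ∈ S)
    (hy : y ∈ Icc (x - t) (x + t)) (hb : ∀ z ∈ S, z ∈ Ioo (x - t) y → f z < b) :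
    0 ≤ totalCharge S f g b (x - t) y := by
  by_cases he : ∃ e ∈ S, y ≤ e
  · obtain ⟨e, he, hye⟩ := he
    exact totalCharge_nonneg hS h hy.1 fun z hz =>
      notMem_leftSet_of_lt he (hz.2.trans_le hye) fun hzS => (h.le z hzS).trans_lt (hb z hzS hz)
  · push Not at he
    obtain ⟨a, ha, hay⟩ := hS.exists_isGreatest (fun hy' => lt_irrefl _ (he y hy')) hx (he x hx)
    have hxa : x ≤ a := ha.2 hx
    have ht : x - t ≤ a := by linarith [hy.1, hy.2]
    have h1 : a - (x - t) ≤ totalCharge S f g b (x - t) a :=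
      sub_le_totalCharge hS h ht fun z hz => by
        have hz' : z ∈ S → f z < b := fun hzS => hb z hzS ⟨hz.1, hz.2.trans hay⟩
        exact ⟨mem_rightSet_of_lt hS ha.1 hz.2 fun hzS => (hz' hzS).le,
          notMem_leftSet_of_lt ha.1 hz.2 fun hzS => (h.le z hzS).trans_lt (hz' hzS)⟩
    have h2 := le_totalCharge (S := S) (f := f) (g := g) (b := b) hay.le
    rw [← totalCharge_add hS h b (x - t) a y]
    linarith [hy.2]

theorem lowV_of_lt (hS : IsSpace S) (h : RegularData S f g) (hx : x ∈ S)
    (ht : 0 ≤ t) (hb : ∀ z ∈ S, z ∈ Icc (x - t) (x + t) → f z < b) : lowV S f g b x t := by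
  refine ⟨?_, fun y hy => totalCharge_nonneg_of_lt hS h hx hy fun z hz hz' =>
    hb z hz ⟨hz'.1.le, hz'.2.le.trans hy.2⟩⟩
  rcases hS.lt_or_exists_isLeast hx (show x - t ≤ x by linarith) with h1 | ⟨a, ha, h1⟩
  · exact Or.inl ⟨h1.1, (hb _ h1.1 ⟨le_rfl, by linarith⟩).le⟩
  · exact Or.inr fun y hy => h1.trans (ha.2 hy)

/-- If the foot is at or beyond the left endpoint a, the block [x - t, a] of particles of speed 1 is
too short: [a, x + t] is full of particles of speed -1, and is longer because a < x. Otherwise the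
foot carries no particle of speed 1. -/
theorem not_lowV_of_lt (hS : IsSpace S) (h : RegularData S f g) (hx : x ∈ S) (hl : ¬ IsLeast S x)
    (ht : 0 ≤ t) (hb : ∀ z ∈ S, z ∈ Icc (x - t) (x + t) → b < g z) : ¬ lowV S f g b x t := by
  intro hlow
  rcases hS.lt_or_exists_isLeast hx (show x - t ≤ x by linarith) with ⟨h1, e, he, h2⟩ | ⟨a, ha, h1⟩
  · exact notMem_rightSet_of_gt he h2 (fun h3 =>
      (hb _ h1 ⟨le_rfl, by linarith⟩).trans_le (h.le _ h1)) hlow.1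
  · have hax : a < x := lt_of_le_of_ne (ha.2 hx) fun e => hl (e ▸ ha)
    have h2 := hlow.2 (x + t) ⟨by linarith, le_rfl⟩
    rw [← totalCharge_add hS h b (x - t) a (x + t)] at h2
    have h3 := totalCharge_le (S := S) (f := f) (g := g) (b := b) h1
    have h4 : totalCharge S f g b a (x + t) ≤ -(x + t - a) :=
      totalCharge_le_neg hS h (by linarith) fun z hz => by
        have hz' : z ∈ S → b < g z := fun hzS => hb z hzS ⟨by linarith [hz.1], hz.2.le⟩
        exact ⟨mem_leftSet_of_gt hS ha.1 hz.1 fun hzS => (hz' hzS).le,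
          notMem_rightSet_of_gt ha.1 hz.1 fun hzS => (hz' hzS).trans_le (h.le z hzS)⟩
    linarith

theorem exists_isV (hS : IsSpace S) (h : RegularData S f g) (hx : x ∈ S) (hl : ¬ IsLeast S x)
    (ht : 0 ≤ t) : ∃ p, IsV S f g t x p := by
  have hK : IsCompact (S ∩ Icc (x - t) (x + t)) := isCompact_Icc.inter_left hS.isClosed
  obtain ⟨B, hB⟩ := hK.bddAbove_image (h.cont_f.mono inter_subset_left)
  obtain ⟨B', hB'⟩ := hK.bddBelow_image (h.cont_g.mono inter_subset_left)
  have h1 : lowV S f g (B + 1) x t := lowV_of_lt hS h hx ht fun z hz hz' => by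
    linarith [hB ⟨z, ⟨hz, hz'⟩, rfl⟩]
  have h2 : ¬ lowV S f g (B' - 1) x t := not_lowV_of_lt hS h hx hl ht fun z hz hz' => by
    linarith [hB' ⟨z, ⟨hz, hz'⟩, rfl⟩]
  have hbdd : BddBelow {b | lowV S f g b x t} := ⟨B' - 1, fun b hb => by
    by_contra hlt
    exact h2 (lowV.mono hS h (not_le.1 hlt).le hb)⟩
  refine ⟨sInf {b | lowV S f g b x t}, isV_of hS h (fun b hb => ?_) fun b hb hlow => ?_⟩
  · obtain ⟨c, hc, hcb⟩ := exists_lt_of_csInf_lt (s := {b | lowV S f g b x t}) ⟨_, h1⟩ hb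
    exact lowV.mono hS h hcb.le hc
  · exact absurd (csInf_le hbdd hlow) (not_le.2 hb)

theorem exists_isW (hS : IsSpace S) (h : RegularData S f g) (hx : x ∈ S) (hl : ¬ IsGreatest S x)
    (ht : 0 ≤ t) : ∃ r, IsW S f g t x r := by
  obtain ⟨p, hp⟩ := exists_isV hS.reflect h.reflect (x := -x) (by simpa using hx)
    (by rwa [isLeast_reflectSet, neg_neg]) ht
  rw [isV_reflect, neg_neg] at hp
  exact ⟨_, hp⟩

theorem exists_evolvesAt (hS : IsSpace S) (h : RegularData S f g) (hx : x ∈ S) (ht : 0 ≤ t) :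
    ∃ q : ℝ × ℝ, EvolvesAt S f g t x q.1 q.2 := by
  by_cases h1 : IsLeast S x
  · have h2 : ¬ IsGreatest S x := fun h2 => hS.not_isLeast_isGreatest h1 h2
    obtain ⟨r, hr⟩ := exists_isW hS h hx h2 ht
    exact ⟨(r, r), fun h => absurd h1 h, fun _ => hr, fun _ => rfl⟩
  · obtain ⟨p, hp⟩ := exists_isV hS h hx h1 ht
    by_cases h2 : IsGreatest S x
    · exact ⟨(p, p), fun _ => hp, fun h => absurd h2 h, fun _ => rfl⟩
    · obtain ⟨r, hr⟩ := exists_isW hS h hx h2 ht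
      exact ⟨(p, r), fun _ => hp, fun _ => hr, fun h => absurd h (by tauto)⟩

/-! ### The explicit formulas -/

theorem mem_setAV_iff (hS : IsSpace S) (h : RegularData S f g) (hx : x ∈ S) (ht : 0 ≤ t) :
    x ∈ setAV S f g b t ↔ lowV S f g b x t := by
  constructor
  · rintro ⟨-, y, rfl, hy, ha⟩
    rw [lowV, add_sub_cancel_right]
    refine ⟨hy, ?_⟩
    have key : ∀ u ∈ Ico y (y + t + t), 0 ≤ totalCharge S f g b y u := by
      intro u hu
      by_contra hneg
      have := ha.trans (sInf_le ⟨u, ⟨hu.1, not_le.1 hneg⟩, rfl⟩)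
      rw [EReal.coe_le_coe_iff] at this
      linarith [hu.2]
    intro u hu
    -- The matching point controls only u < y + 2t; continuity adds the right end. For t = 0 the
    -- half-open interval is empty and its closure does not help.
    rcases eq_or_lt_of_le ht with h0 | h0
    · have : u = y := le_antisymm (by linarith [hu.2]) hu.1
      rw [this, totalCharge_self]
    · have hc : IsClosed {u | 0 ≤ totalCharge S f g b y u} :=
        isClosed_le continuous_const (continuous_totalCharge hS h b y)
      have := hc.closure_subset_iff.2 key
      rw [closure_Ico (by linarith)] at this
      exact this hu
  · rintro ⟨h1, h2⟩
    refine ⟨hx, x - t, by ring, h1, ?_⟩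
    apply le_sInf
    rintro _ ⟨y, ⟨hy1, hy2⟩, rfl⟩
    rw [EReal.coe_le_coe_iff]
    by_contra hlt
    exact absurd (h2 y ⟨hy1, by linarith⟩) (not_le.2 hy2)

theorem mem_setAW_iff (hS : IsSpace S) (h : RegularData S f g) (hx : x ∈ S) (ht : 0 ≤ t) :
    x ∈ setAW S f g b t ↔ highW S f g b x t := by
  constructor
  · rintro ⟨-, y, rfl, hy, ha⟩
    rw [highW, sub_add_cancel]
    refine ⟨hy, ?_⟩
    have key : ∀ u ∈ Ioc (y - t - t) y, totalCharge S f g b u y ≤ 0 := by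
      intro u hu
      by_contra hneg
      have := (le_sSup (mem_image_of_mem (fun y : ℝ => (y : EReal)) (show u ∈ {u | u ≤ y ∧
        0 < ∫ z in u..y, charge S f g b z} from ⟨hu.2, not_le.1 hneg⟩))).trans ha
      rw [EReal.coe_le_coe_iff] at this
      linarith [hu.1]
    intro u hu
    rcases eq_or_lt_of_le ht with h0 | h0
    · have : u = y := le_antisymm hu.2 (by linarith [hu.1])
      rw [this, totalCharge_self]
    · have hcont : Continuous fun u => totalCharge S f g b u y := by
        have : (fun u => totalCharge S f g b u y) = fun u => - totalCharge S f g b y u := by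
          funext u; exact intervalIntegral.integral_symm _ _
        rw [this]
        exact (continuous_totalCharge hS h b y).neg
      have hc : IsClosed {u | totalCharge S f g b u y ≤ 0} := isClosed_le hcont continuous_const
      have := hc.closure_subset_iff.2 key
      rw [closure_Ioc (by linarith)] at this
      exact this hu
  · rintro ⟨h1, h2⟩
    refine ⟨hx, x + t, by ring, h1, ?_⟩
    apply sSup_le
    rintro _ ⟨y, ⟨hy1, hy2⟩, rfl⟩
    rw [EReal.coe_le_coe_iff]
    by_contra hlt
    exact absurd (h2 y ⟨by linarith, hy1⟩) (not_le.2 hy2)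

theorem vStar_eq (hS : IsSpace S) (h : RegularData S f g) (hx : x ∈ S) (ht : 0 ≤ t)
    (hp : IsV S f g t x p) : vStar S f g x t = (p : EReal) := by
  refine IsLeast.csInf_eq ⟨⟨p, (mem_setAV_iff hS h hx ht).2 ((hp p).1 le_rfl), rfl⟩, ?_⟩
  rintro _ ⟨b, hb, rfl⟩
  exact EReal.coe_le_coe_iff.2 ((hp b).2 ((mem_setAV_iff hS h hx ht).1 hb))

theorem wStar_eq (hS : IsSpace S) (h : RegularData S f g) (hx : x ∈ S) (ht : 0 ≤ t)
    (hr : IsW S f g t x r) : wStar S f g x t = (r : EReal) := by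
  refine IsGreatest.csSup_eq ⟨⟨r, (mem_setAW_iff hS h hx ht).2 ((hr r).1 le_rfl), rfl⟩, ?_⟩
  rintro _ ⟨b, hb, rfl⟩
  exact EReal.coe_le_coe_iff.2 ((hr b).2 ((mem_setAW_iff hS h hx ht).1 hb))

/-! ### The semigroup property -/

/-- The left reservoir is never exhausted: for x ≤ a the block [x - t, a] is at least as long as [a,
x + t]. -/
theorem lowV_of_le_isLeast (hS : IsSpace S) (h : RegularData S f g) {a : ℝ} (ha : IsLeast S a)
    (hx : x ≤ a) (ht : 0 ≤ t) : lowV S f g b x t := by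
  refine ⟨Or.inr fun y hy => (show x - t ≤ a by linarith).trans (ha.2 hy), fun y hy => ?_⟩
  have key : ∀ u, x - t ≤ u → u ≤ a → u - (x - t) ≤ totalCharge S f g b (x - t) u := by
    intro u h1 h2
    refine sub_le_totalCharge hS h h1 fun z hz => ?_
    have hza : z < a := hz.2.trans_le h2
    have hzS : z ∉ S := fun hzS => absurd (ha.2 hzS) (not_le.2 hza)
    exact ⟨mem_rightSet_of_lt hS ha.1 hza fun h => absurd h hzS,
      notMem_leftSet_of_lt ha.1 hza fun h => absurd h hzS⟩
  rcases le_total y a with h1 | h1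
  · linarith [key y hy.1 h1, hy.1]
  · rw [← totalCharge_add hS h b (x - t) a y]
    linarith [key a (by linarith) le_rfl, hy.2,
      le_totalCharge (S := S) (f := f) (g := g) (b := b) h1]

theorem not_lowV_of_isGreatest_lt (hS : IsSpace S) (h : RegularData S f g) {a : ℝ}
    (ha : IsGreatest S a) (hx : a < x) : ¬ lowV S f g b x t := by
  rintro ⟨h1, h2⟩
  have hxa : x - t ≤ a := h1.elim (fun h => ha.2 h.1) (fun h => h ha.1)
  have h3 := h2 (x + t) ⟨by linarith, le_rfl⟩
  rw [← totalCharge_add hS h b (x - t) a (x + t)] at h3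
  have h4 := totalCharge_le (S := S) (f := f) (g := g) (b := b) hxa
  have h5 : totalCharge S f g b a (x + t) ≤ -(x + t - a) :=
    totalCharge_le_neg hS h (by linarith) fun z hz => by
      have hzS : z ∉ S := fun hzS => absurd (ha.2 hzS) (not_le.2 hz.1)
      exact ⟨mem_leftSet_of_gt hS ha.1 hz.1 fun h => absurd h hzS,
        notMem_rightSet_of_gt ha.1 hz.1 fun h => absurd h hzS⟩
  linarith

variable {s : ℝ} {f' g' : ℝ → ℝ}

/-- The survivors at time s are exactly the particles prescribed by the new data. This includes
positions outside `S`, since the left reservoir stays full and no particle of speed 1 survives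
beyond the right endpoint. So the system may be restarted at time s. -/
theorem Evolves.mem_rightSet (hS : IsSpace S) (h : RegularData S f g) (hs : 0 ≤ s)
    (he : Evolves S f g s f' g') : z ∈ rightSet S f' b ↔ lowV S f g b z s := by
  by_cases hz : z ∈ S
  · by_cases hl : IsLeast S z
    · exact iff_of_true (Or.inr hl.2) (lowV_of_le_isLeast hS h hl le_rfl hs)
    · rw [← (he z hz).1 hl b]
      exact ⟨fun h' => h'.elim (fun h' => h'.2) (fun h' => absurd ⟨hz, h'⟩ hl),
        fun h' => Or.inl ⟨hz, h'⟩⟩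
  · have hne : S.Nonempty := by
      rcases hS with rfl | ⟨c, d, hcd, rfl⟩
      exacts [univ_nonempty, nonempty_Icc.2 hcd.le]
    obtain ⟨e, heS⟩ := hne
    rcases lt_or_gt_of_ne (show z ≠ e from fun h => hz (h ▸ heS)) with h1 | h1
    · obtain ⟨a, ha, hza⟩ := hS.exists_isLeast hz heS h1
      exact iff_of_true (Or.inr fun y hy => hza.le.trans (ha.2 hy))
        (lowV_of_le_isLeast hS h ha hza.le hs)
    · obtain ⟨a, ha, hza⟩ := hS.exists_isGreatest hz heS h1
      exact iff_of_false (fun h' => h'.elim (fun h' => hz h'.1)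
        (fun h' => absurd (h' heS) (not_le.2 h1))) (not_lowV_of_isGreatest_lt hS h ha hza)

theorem Evolves.mem_leftSet (hS : IsSpace S) (h : RegularData S f g) (hs : 0 ≤ s)
    (he : Evolves S f g s f' g') : z ∈ leftSet S g' b ↔ highW S f g b z s := by
  have := he.reflect.mem_rightSet hS.reflect h.reflect hs (z := -z) (b := -b)
  rwa [rightSet_reflect, lowV_reflect, neg_neg, neg_neg] at this

theorem lowV_iff_mem_survR (hS : IsSpace S) (h : RegularData S f g) :
    lowV S f g b x t ↔
      x ∈ survR (fun y => ∫ z in (0 : ℝ)..y, charge S f g b z) (rightSet S f b) t := by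
  refine and_congr Iff.rfl (forall₂_congr fun y _ => ?_)
  rw [← sub_nonneg (a := ∫ z in (0 : ℝ)..y, charge S f g b z),
    intervalIntegral.integral_interval_sub_left (intervalIntegrable_charge hS h b _ _)
      (intervalIntegrable_charge hS h b _ _)]
  rfl

theorem highW_iff_mem_survL (hS : IsSpace S) (h : RegularData S f g) :
    highW S f g b x t ↔
      x ∈ survL (fun y => ∫ z in (0 : ℝ)..y, charge S f g b z) (leftSet S g b) t := by
  refine and_congr Iff.rfl (forall₂_congr fun y _ => ?_)
  rw [← sub_nonpos (b := ∫ z in (0 : ℝ)..y, charge S f g b z),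
    intervalIntegral.integral_interval_sub_left (intervalIntegrable_charge hS h b _ _)
      (intervalIntegrable_charge hS h b _ _)]
  rfl

/-- The charge of the new data is the derivative of the eroded primitive, by `integral_surviving`.
That lemma needs a positive time; at time zero erosion changes nothing and the two charges agree
almost everywhere. -/
theorem Evolves.totalCharge_eq (hS : IsSpace S) (h : RegularData S f g) (hs : 0 ≤ s)
    (he : Evolves S f g s f' g') (x y : ℝ) : totalCharge S f' g' b x y =
      erosion (fun y => ∫ z in (0 : ℝ)..y, charge S f g b z) s y
        - erosion (fun y => ∫ z in (0 : ℝ)..y, charge S f g b z) s x := by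
  rcases eq_or_lt_of_le hs with rfl | hs'
  · have e : ∀ u, erosion (fun y => ∫ z in (0 : ℝ)..y, charge S f g b z) 0 u
        = ∫ z in (0 : ℝ)..u, charge S f g b z := by
      intro u; simp [erosion]
    rw [e, e, intervalIntegral.integral_interval_sub_left (intervalIntegrable_charge hS h b _ _)
      (intervalIntegrable_charge hS h b _ _)]
    apply intervalIntegral.integral_congr_ae
    filter_upwards [ae_not_endpoint S] with z hz _
    rw [charge_eq_indicator hz, charge_eq_indicator hz]
    congr 1
    · apply indicator_one_congr
      rw [he.mem_rightSet hS h le_rfl, lowV]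
      simp
    · apply indicator_one_congr
      rw [he.mem_leftSet hS h le_rfl, highW]
      simp
  · refine integral_surviving (locallyIntegrable_charge hS h b) ae_abs_charge_le_one
      (R := rightSet S f b) (L := leftSet S g b) ?_ (ae_notMem_inter h hS b) hs' ?_ x y
    · filter_upwards [ae_not_endpoint S] with z hz
      exact charge_eq_indicator hz
    · filter_upwards [ae_not_endpoint S] with z hz
      rw [charge_eq_indicator hz]
      congr 1
      · exact indicator_one_congr ((he.mem_rightSet hS h hs).trans (lowV_iff_mem_survR hS h))
      · exact indicator_one_congr ((he.mem_leftSet hS h hs).trans (highW_iff_mem_survL hS h))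

/-- For a particle surviving at time s, the erosion equals `H` at its original foot. Survival for a
further time t therefore says that this value is minimal over the combined window, by
`erosion_erosion_le_iff`. -/
theorem Evolves.lowV_iff (hS : IsSpace S) (h : RegularData S f g) (hs : 0 ≤ s) (ht : 0 ≤ t)
    (he : Evolves S f g s f' g') : lowV S f' g' b x t ↔ lowV S f g b x (s + t) := by
  set H : ℝ → ℝ := fun y => ∫ z in (0 : ℝ)..y, charge S f g b z with hH
  have hc : Continuous H :=
    (lipschitz_primitive (locallyIntegrable_charge hS h b) ae_abs_charge_le_one).continuous
  have e1 : x - (s + t) = x - t - s := by ring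
  have h1 : lowV S f' g' b x t ↔ x - t ∈ survR H (rightSet S f b) s ∧
      ∀ y ∈ Icc (x - t) (x + t), erosion H s (x - t) ≤ erosion H s y := by
    refine and_congr ((he.mem_rightSet hS h hs).trans (lowV_iff_mem_survR hS h))
      (forall₂_congr fun y _ => ?_)
    rw [he.totalCharge_eq hS h hs, sub_nonneg]
  have h2 : ∀ u ∈ survR H (rightSet S f b) s, erosion H s u = H (u - s) := fun u hu =>
    le_antisymm (erosion_le hc ⟨le_rfl, by linarith⟩) ((erosion_le_iff hc hs).2 hu.2)
  rw [h1, lowV_iff_mem_survR hS h]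
  constructor
  · rintro ⟨h3, h4⟩
    refine ⟨e1 ▸ h3.1, ?_⟩
    rw [h2 _ h3] at h4
    rw [e1]
    have := (erosion_erosion_le_iff hc hs ht).1 h4
    rwa [e1] at this
  · rintro ⟨h3, h4⟩
    have h5 : x - t ∈ survR H (rightSet S f b) s := by
      refine ⟨e1 ▸ h3, fun y hy => ?_⟩
      rw [← e1]
      exact h4 y ⟨by linarith [hy.1], by linarith [hy.2]⟩
    refine ⟨h5, ?_⟩
    rw [h2 _ h5]
    refine (erosion_erosion_le_iff hc hs ht).2 ?_
    rw [← e1]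
    exact h4

theorem Evolves.highW_iff (hS : IsSpace S) (h : RegularData S f g) (hs : 0 ≤ s) (ht : 0 ≤ t)
    (he : Evolves S f g s f' g') : highW S f' g' b x t ↔ highW S f g b x (s + t) := by
  have := he.reflect.lowV_iff hS.reflect h.reflect hs ht (x := -x) (b := -b)
  rwa [lowV_reflect, lowV_reflect, neg_neg, neg_neg] at this

theorem Evolves.evolvesAt_iff (hS : IsSpace S) (h : RegularData S f g) (hs : 0 ≤ s) (ht : 0 ≤ t)
    (he : Evolves S f g s f' g') :
    EvolvesAt S f' g' t x p r ↔ EvolvesAt S f g (s + t) x p r := by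
  simp only [EvolvesAt, IsV, IsW, he.lowV_iff hS h hs ht, he.highW_iff hS h hs ht]

/-! ### Dependence on the data near the point -/

theorem totalCharge_congr {c d : ℝ} (hcd : c ≤ d) (hf : ∀ z ∈ S, z ∈ Icc c d → f z = f' z)
    (hg : ∀ z ∈ S, z ∈ Icc c d → g z = g' z) :
    totalCharge S f g b c d = totalCharge S f' g' b c d := by
  refine intervalIntegral.integral_congr fun z hz => ?_
  rw [uIcc_of_le hcd] at hz
  have e1 := indicator_one_congr (A := {y | y ∈ S ∧ f y ≤ b}) (B := {y | y ∈ S ∧ f' y ≤ b})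
    (z := z) (w := z) (and_congr_right fun hzS => by rw [hf z hzS hz])
  have e2 := indicator_one_congr (A := {y | y ∈ S ∧ b ≤ g y}) (B := {y | y ∈ S ∧ b ≤ g' y})
    (z := z) (w := z) (and_congr_right fun hzS => by rw [hg z hzS hz])
  simp only [charge, e1, e2]

theorem lowV_congr (ht : 0 ≤ t) (hf : ∀ z ∈ S, z ∈ Icc (x - t) (x + t) → f z = f' z)
    (hg : ∀ z ∈ S, z ∈ Icc (x - t) (x + t) → g z = g' z) :
    lowV S f g b x t ↔ lowV S f' g' b x t := by
  refine and_congr (or_congr (and_congr_right fun hz => ?_) Iff.rfl) (forall₂_congr fun y hy => ?_)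
  · rw [hf _ hz ⟨le_rfl, by linarith⟩]
  · rw [totalCharge_congr hy.1 (fun z hz hz' => hf z hz ⟨hz'.1, hz'.2.trans hy.2⟩)
      (fun z hz hz' => hg z hz ⟨hz'.1, hz'.2.trans hy.2⟩)]

theorem highW_congr (ht : 0 ≤ t) (hf : ∀ z ∈ S, z ∈ Icc (x - t) (x + t) → f z = f' z)
    (hg : ∀ z ∈ S, z ∈ Icc (x - t) (x + t) → g z = g' z) :
    highW S f g b x t ↔ highW S f' g' b x t := by
  refine and_congr (or_congr (and_congr_right fun hz => ?_) Iff.rfl) (forall₂_congr fun y hy => ?_)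
  · rw [hg _ hz ⟨by linarith, le_rfl⟩]
  · rw [totalCharge_congr hy.2 (fun z hz hz' => hf z hz ⟨hy.1.trans hz'.1, hz'.2⟩)
      (fun z hz hz' => hg z hz ⟨hy.1.trans hz'.1, hz'.2⟩)]

theorem evolvesAt_congr (ht : 0 ≤ t) (hf : ∀ z ∈ S, z ∈ Icc (x - t) (x + t) → f z = f' z)
    (hg : ∀ z ∈ S, z ∈ Icc (x - t) (x + t) → g z = g' z) :
    EvolvesAt S f g t x p r ↔ EvolvesAt S f' g' t x p r := by
  simp only [EvolvesAt, IsV, IsW, lowV_congr ht hf hg, highW_congr ht hf hg]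

end evolution

/-! ### Charge patterns that produce transport, freezing, thawing and reflection. -/

section criteria

/-! ### Evaluation of the explicit formulas -/

section pointwise

variable {S : Set ℝ} {f g : ℝ → ℝ} {b c e a x y z t s r m₁ m₂ m₃ : ℝ}

theorem exists_forall_lt (hf : ContinuousOn f S) (hy : y ∈ S) (hb : b < f y) :
    ∃ δ > 0, ∀ z ∈ S, |z - y| < δ → b < f z := by
  obtain ⟨δ, h0, h⟩ := Metric.continuousOn_iff.1 hf y hy (f y - b) (by linarith)
  refine ⟨δ, h0, fun z hz hzy => ?_⟩
  have := h z hz (by rwa [Real.dist_eq])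
  rw [Real.dist_eq] at this
  linarith [(abs_lt.1 this).1]

theorem exists_forall_gt (hf : ContinuousOn f S) (hy : y ∈ S) (hb : f y < b) :
    ∃ δ > 0, ∀ z ∈ S, |z - y| < δ → f z < b := by
  obtain ⟨δ, h0, h⟩ := exists_forall_lt hf.neg hy (neg_lt_neg hb)
  exact ⟨δ, h0, fun z hz hzy => neg_lt_neg_iff.1 (h z hz hzy)⟩

/-- Charge count in four blocks: at least 1 per unit length on [x, m₁], nonnegative on [m₁, m₂], at
least -1 on [m₂, m₃], which is no longer than the first block, and nonnegative beyond m₃. Transport,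
thawing and reflection all show this pattern. -/
theorem totalCharge_nonneg_of_blocks (hS : IsSpace S) (h : RegularData S f g)
    (h01 : x ≤ m₁) (h12 : m₁ ≤ m₂) (h23 : m₂ ≤ m₃) (hm : m₃ - m₂ ≤ m₁ - x) (hxy : x ≤ y)
    (b1 : ∀ z ∈ Ioo x m₁, z ∈ rightSet S f b ∧ z ∉ leftSet S g b)
    (b2 : ∀ z ∈ Ioo m₁ m₂, z ∉ leftSet S g b)
    (b3 : ∀ z ∈ Ioo m₃ y, z ∉ leftSet S g b) : 0 ≤ totalCharge S f g b x y := by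
  rcases le_total y m₁ with h1 | h1
  · exact totalCharge_nonneg hS h hxy fun z hz => (b1 z ⟨hz.1, hz.2.trans_le h1⟩).2
  have e1 := sub_le_totalCharge hS h h01 b1
  rcases le_total y m₂ with h2 | h2
  · have e2 := totalCharge_nonneg hS h h1 fun z hz => b2 z ⟨hz.1, hz.2.trans_le h2⟩
    rw [← totalCharge_add hS h b x m₁ y]; linarith
  have e2 := totalCharge_nonneg hS h h12 b2
  rw [← totalCharge_add hS h b x m₁ y, ← totalCharge_add hS h b m₁ m₂ y]
  rcases le_total y m₃ with h3 | h3
  · linarith [le_totalCharge (S := S) (f := f) (g := g) (b := b) h2]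
  · have e3 := totalCharge_nonneg hS h h3 b3
    rw [← totalCharge_add hS h b m₂ m₃ y]
    linarith [le_totalCharge (S := S) (f := f) (g := g) (b := b) h23]

/-- The value at the foot of the characteristic is transported. -/
theorem isV_transport (hS : IsSpace S) (h : RegularData S f g)
    (hx : x - t ∈ S) (hm₁ : m₁ ∈ S) (hm₂ : m₂ ∈ S) (h01 : x - t ≤ m₁) (h12 : m₁ ≤ m₂)
    (h23 : m₂ ≤ x + t) (hm : x + t - m₂ ≤ m₁ - (x - t)) (he : ∃ e ∈ S, e < x - t)
    (A : ∀ z ∈ S, z ∈ Icc (x - t) m₁ → f z ≤ f (x - t))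
    (B : ∀ z ∈ S, z ∈ Icc m₁ m₂ → g z ≤ f (x - t)) : IsV S f g t x (f (x - t)) := by
  refine isV_of hS h (fun b hb => ⟨Or.inl ⟨hx, hb.le⟩, fun y hy => ?_⟩) fun b hb hlow => ?_
  -- Here m₃ = x + t, so the last block is empty.
  · refine totalCharge_nonneg_of_blocks hS h h01 h12 h23 hm hy.1 (fun z hz => ?_) (fun z hz => ?_)
      (fun z hz => absurd (hz.1.trans hz.2) (not_lt.2 hy.2))
    · have hz' : z ∈ S → f z < b := fun hzS => (A z hzS ⟨hz.1.le, hz.2.le⟩).trans_lt hb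
      exact ⟨mem_rightSet_of_lt hS hm₁ hz.2 fun hzS => (hz' hzS).le,
        notMem_leftSet_of_lt hm₁ hz.2 fun hzS => (h.le z hzS).trans_lt (hz' hzS)⟩
    · exact notMem_leftSet_of_lt hm₂ hz.2 fun hzS => (B z hzS ⟨hz.1.le, hz.2.le⟩).trans_lt hb
  · obtain ⟨e, heS, he⟩ := he
    exact notMem_rightSet_of_gt heS he (fun _ => hb) hlow.1

theorem isW_transport (hS : IsSpace S) (h : RegularData S f g)
    (hx : x + t ∈ S) (hm₁ : m₁ ∈ S) (hm₂ : m₂ ∈ S) (h01 : m₁ ≤ x + t) (h12 : m₂ ≤ m₁)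
    (h23 : x - t ≤ m₂) (hm : m₂ - (x - t) ≤ x + t - m₁) (he : ∃ e ∈ S, x + t < e)
    (A : ∀ z ∈ S, z ∈ Icc m₁ (x + t) → g (x + t) ≤ g z)
    (B : ∀ z ∈ S, z ∈ Icc m₂ m₁ → g (x + t) ≤ f z) : IsW S f g t x (g (x + t)) := by
  have e0 : -x - t = -(x + t) := by ring
  have := isV_transport hS.reflect h.reflect (x := -x) (t := t) (m₁ := -m₁) (m₂ := -m₂)
    (by rw [e0, neg_mem_reflectSet]; exact hx) (by simpa using hm₁) (by simpa using hm₂) (by linarith) (by linarith)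
    (by linarith) (by linarith)
    (by
      obtain ⟨e, heS, he⟩ := he
      exact ⟨-e, by simpa using heS, by linarith⟩)
    (fun z hz hz' => by
      simp only [reflectData, e0, neg_neg]
      exact neg_le_neg (A _ hz ⟨by linarith [hz'.2], by linarith [hz'.1]⟩))
    (fun z hz hz' => by
      simp only [reflectData, e0, neg_neg]
      exact neg_le_neg (B _ hz ⟨by linarith [hz'.2], by linarith [hz'.1]⟩))
  rw [isV_reflect] at this
  simpa [reflectData, e0] using this

/-- The value at a point which is frozen from time `s` to time `t`, and then moves with speed `1`
for a time `r`. -/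
theorem isV_thaw (hS : IsSpace S) (h : RegularData S f g) (hs : 0 ≤ s) (hst : s ≤ t) (hr : 0 ≤ r)
    (hxs : x - s ∈ S) (hxs' : x + s ∈ S) (he : ∃ e ∈ S, e < x - s)
    (A : ∀ z ∈ S, z ∈ Icc (x - t) (x - s) → f z ≤ c)
    (B : ∀ z ∈ S, z ∈ Icc (x - s) (x + s) → g z ≤ c)
    (C : ∀ z ∈ S, z ∈ Icc (x - s) (x + s) → c ≤ f z)
    (D : ∀ z ∈ S, z ∈ Icc (x + s) (x + t) → c ≤ g z)
    (E : ∀ z ∈ Ioo (x + t) (x + t + 2 * r), (z ∈ S → g z ≤ c) ∧ ∃ e ∈ S, z < e) :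
    IsV S f g (t + r) (x + r) c := by
  have e0 : x + r - (t + r) = x - t := by ring
  have e1 : x + r + (t + r) = x + t + 2 * r := by ring
  obtain ⟨e, heS, he⟩ := he
  refine isV_of hS h (fun b hb => ?_) fun b hb hlow => ?_
  · rw [lowV, e0, e1]
    refine ⟨?_, fun y hy => ?_⟩
    · rcases hS.lt_or_exists_isLeast hxs (show x - t ≤ x - s by linarith) with h1 | ⟨a, ha, h1⟩
      · exact Or.inl ⟨h1.1, (A _ h1.1 ⟨le_rfl, by linarith⟩).trans hb.le⟩
      · exact Or.inr fun y hy => h1.trans (ha.2 hy)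
    -- The particles from [x - t, x - s] balance whatever comes from the equally long [x + s, x +
    -- t]; between and beyond these blocks no particle of speed -1 is met.
    · refine totalCharge_nonneg_of_blocks hS h (m₁ := x - s) (m₂ := x + s) (m₃ := x + t)
        (by linarith) (by linarith) (by linarith) (by linarith) hy.1 (fun z hz => ?_)
        (fun z hz => ?_) (fun z hz => ?_)
      · have hz' : z ∈ S → f z < b := fun hzS => (A z hzS ⟨hz.1.le, hz.2.le⟩).trans_lt hb
        exact ⟨mem_rightSet_of_lt hS hxs hz.2 fun hzS => (hz' hzS).le,
          notMem_leftSet_of_lt hxs hz.2 fun hzS => (h.le z hzS).trans_lt (hz' hzS)⟩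
      · exact notMem_leftSet_of_lt hxs' hz.2 fun hzS => (B z hzS ⟨hz.1.le, hz.2.le⟩).trans_lt hb
      · obtain ⟨h1, e', he', h2⟩ := E z ⟨hz.1, hz.2.trans_le hy.2⟩
        exact notMem_leftSet_of_lt he' h2 fun hzS => (h1 hzS).trans_lt hb
  · rw [lowV, e0, e1] at hlow
    have hbx : b < f (x - s) := hb.trans_le (C _ hxs ⟨le_rfl, by linarith⟩)
    rcases eq_or_lt_of_le hst with rfl | hst
    · exact notMem_rightSet_of_gt heS he (fun _ => hbx) hlow.1
    obtain ⟨δ, h0, hδ⟩ := exists_forall_lt h.cont_f hxs hbx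
    set n := max e (max (x - t) (x - s - δ)) with hn
    have hn1 : n < x - s := max_lt he (max_lt (by linarith) (by linarith))
    have hn2 : e ≤ n := le_max_left _ _
    have hn3 : x - t ≤ n := (le_max_left _ _).trans (le_max_right _ _)
    have hn4 : x - s - δ ≤ n := (le_max_right _ _).trans (le_max_right _ _)
    have h1 := hlow.2 (x + t) ⟨by linarith, by linarith⟩
    rw [← totalCharge_add hS h b (x - t) n, ← totalCharge_add hS h b n (x + s)] at h1
    have h2 := totalCharge_le (S := S) (f := f) (g := g) (b := b) hn3
    have h3 : totalCharge S f g b n (x + s) ≤ 0 :=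
      totalCharge_nonpos hS h (by linarith) fun z hz =>
        notMem_rightSet_of_gt heS (hn2.trans_lt hz.1) fun hzS => by
          rcases lt_or_ge z (x - s) with h4 | h4
          · exact hδ z hzS (by rw [abs_lt]; constructor <;> linarith [hz.1])
          · exact hb.trans_le (C z hzS ⟨h4, hz.2.le⟩)
    have h4 : totalCharge S f g b (x + s) (x + t) ≤ -(x + t - (x + s)) :=
      totalCharge_le_neg hS h (by linarith) fun z hz => by
        have hz' : z ∈ S → b < g z := fun hzS => hb.trans_le (D z hzS ⟨hz.1.le, hz.2.le⟩)
        exact ⟨mem_leftSet_of_gt hS hxs' hz.1 fun hzS => (hz' hzS).le,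
          notMem_rightSet_of_gt hxs' hz.1 fun hzS => (hz' hzS).trans_le (h.le z hzS)⟩
    linarith

/-- A point frozen from time `s` to time `t`. -/
theorem evolvesAt_freeze (hS : IsSpace S) (h : RegularData S f g) (hs : 0 ≤ s) (hst : s ≤ t)
    (hxs : x - s ∈ S) (hxs' : x + s ∈ S)
    (he : ¬ IsLeast S x → ∃ e ∈ S, e < x - s) (he' : ∃ e ∈ S, x + s < e)
    (A : ∀ z ∈ S, z ∈ Icc (x - t) (x - s) → f z ≤ c)
    (B : ∀ z ∈ S, z ∈ Icc (x - s) (x + s) → g z ≤ c)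
    (C : ∀ z ∈ S, z ∈ Icc (x - s) (x + s) → c ≤ f z)
    (D : ∀ z ∈ S, z ∈ Icc (x + s) (x + t) → c ≤ g z) : EvolvesAt S f g t x c c := by
  refine ⟨fun hl => ?_, fun hl => ?_, fun _ => rfl⟩
  · have := isV_thaw hS h hs hst le_rfl hxs hxs' (he hl) A B C D
      (fun z hz => absurd (hz.1.trans hz.2) (by simp))
    simpa using this
  · have := isV_thaw hS.reflect h.reflect hs hst le_rfl (x := -x) (c := -c)
      (by simpa [mem_reflectSet, add_comm] using hxs')
      (by simpa [mem_reflectSet, add_comm, sub_eq_add_neg] using hxs)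
      (by
        obtain ⟨e, heS, he⟩ := he'
        exact ⟨-e, by simpa using heS, by linarith⟩)
      (fun z hz hz' => neg_le_neg (D _ hz ⟨by linarith [hz'.2], by linarith [hz'.1]⟩))
      (fun z hz hz' => neg_le_neg (C _ hz ⟨by linarith [hz'.2], by linarith [hz'.1]⟩))
      (fun z hz hz' => neg_le_neg (B _ hz ⟨by linarith [hz'.2], by linarith [hz'.1]⟩))
      (fun z hz hz' => neg_le_neg (A _ hz ⟨by linarith [hz'.2], by linarith [hz'.1]⟩))
      (fun z hz => absurd (hz.1.trans hz.2) (by simp))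
    rw [isV_reflect] at this
    simpa using this

/-- Reflection at the left endpoint. -/
theorem isV_reflection (hS : IsSpace S) (h : RegularData S f g) (ha : IsLeast S a)
    (hxt : x - t ≤ a) (hax : a < x) (he : e ∈ S) (hxe : x + t ≤ e)
    (hg : StrictAntiOn g (Icc a (x + t))) : IsV S f g t x (g (2 * a - (x - t))) := by
  have hsub : ∀ z ∈ Icc a (x + t), z ∈ S := fun z hz =>
    hS.Icc_subset ha.1 he ⟨hz.1, hz.2.trans hxe⟩
  have hm1 : a ≤ 2 * a - (x - t) := by linarith
  have hm2 : 2 * a - (x - t) < x + t := by linarith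
  refine isV_of hS h (fun b hb => ⟨Or.inr fun y hy => hxt.trans (ha.2 hy), fun y hy => ?_⟩)
    fun b hb hlow => ?_
  -- The reservoir block [x - t, a] compensates at most its own length, that is, up to the mirror
  -- image 2a - (x - t) of the foot. Beyond that point `g` is below the level.
  · refine totalCharge_nonneg_of_blocks hS h (m₁ := a) (m₂ := a) (m₃ := 2 * a - (x - t))
      hxt le_rfl hm1 (by linarith) hy.1 (fun z hz => ?_) (fun z hz => ?_) (fun z hz => ?_)
    · have hzS : z ∉ S := fun hzS => absurd (ha.2 hzS) (not_le.2 hz.2)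
      exact ⟨mem_rightSet_of_lt hS ha.1 hz.2 fun h => absurd h hzS,
        notMem_leftSet_of_lt ha.1 hz.2 fun h => absurd h hzS⟩
    · exact absurd (hz.1.trans hz.2) (by simp)
    · exact notMem_leftSet_of_lt he (by linarith [hz.2, hy.2]) fun _ =>
        (hg ⟨hm1, hm2.le⟩ ⟨by linarith [hz.1], by linarith [hz.2, hy.2]⟩ hz.1).trans hb
  · obtain ⟨δ, h0, hδ⟩ := exists_forall_lt h.cont_g (hsub _ ⟨hm1, hm2.le⟩) hb
    -- For a level below the value of `g` at the mirror image, particles of speed -1 fill a slightly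
    -- longer interval [a, n], and the charge up to n is negative.
    set n := min (2 * a - (x - t) + δ) (x + t) with hn
    have hn1 : 2 * a - (x - t) < n := lt_min (by linarith) hm2
    have hn2 : n ≤ 2 * a - (x - t) + δ := min_le_left _ _
    have hn3 : n ≤ x + t := min_le_right _ _
    have h1 := hlow.2 n ⟨by linarith, hn3⟩
    rw [← totalCharge_add hS h b (x - t) a] at h1
    have h2 := totalCharge_le (S := S) (f := f) (g := g) (b := b) hxt
    have h3 : totalCharge S f g b a n ≤ -(n - a) :=
      totalCharge_le_neg hS h (by linarith) fun z hz => by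
        have hz' : b < g z := by
          rcases le_or_gt z (2 * a - (x - t)) with h4 | h4
          · exact hb.trans_le (hg.antitoneOn ⟨hz.1.le, by linarith⟩ ⟨hm1, hm2.le⟩ h4)
          · exact hδ z (hsub z ⟨hz.1.le, by linarith [hz.2]⟩)
              (by rw [abs_lt]; constructor <;> linarith [hz.2])
        have hzS := hsub z ⟨hz.1.le, by linarith [hz.2]⟩
        exact ⟨mem_leftSet_of_gt hS ha.1 hz.1 fun _ => hz'.le,
          notMem_rightSet_of_gt ha.1 hz.1 fun _ => hz'.trans_le (h.le z hzS)⟩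
    linarith

/-- Liquid evolution. -/
theorem evolvesAt_liquid (hS : IsSpace S) (h : RegularData S f g) (ht : 0 ≤ t)
    (he : ∃ e ∈ S, e < x - t) (he' : ∃ e ∈ S, x + t < e)
    (A : ∀ z ∈ Icc (x - t) (x + t), g z ≤ f (x - t))
    (B : ∀ z ∈ Icc (x - t) (x + t), g (x + t) ≤ f z) :
    EvolvesAt S f g t x (f (x - t)) (g (x + t)) := by
  obtain ⟨e, heS, he⟩ := he
  obtain ⟨e', heS', he'⟩ := he'
  have h1 : x - t ∈ S := hS.Icc_subset heS heS' ⟨he.le, by linarith⟩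
  have h2 : x + t ∈ S := hS.Icc_subset heS heS' ⟨by linarith, he'.le⟩
  refine ⟨fun _ => ?_, fun _ => ?_, ?_⟩
  · exact isV_transport hS h h1 h1 h2 le_rfl (by linarith) le_rfl (by linarith) ⟨e, heS, he⟩
      (fun z _ hz => by rw [le_antisymm hz.2 hz.1]) (fun z _ hz => A z hz)
  · exact isW_transport hS h h2 h2 h1 le_rfl (by linarith) le_rfl (by linarith) ⟨e', heS', he'⟩
      (fun z _ hz => by rw [le_antisymm hz.2 hz.1]) (fun z _ hz => B z hz)
  · rintro (h3 | h3)
    · linarith [h3.2 heS]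
    · linarith [h3.2 heS']

end pointwise

end criteria

/-! ### Liquid evolution, freezing and reflection as values of the explicit formulas. -/

section freezing

/-! ### The local construction and the explicit formulas -/

/-- `V` and `W` are given by the explicit formulas in `D`. -/
def EvolvesOn (S : Set ℝ) (f g : ℝ → ℝ) (D : Set (ℝ × ℝ)) (V W : ℝ → ℝ → ℝ) : Prop :=
  ∀ p ∈ D, EvolvesAt S f g p.2 p.1 (V p.1 p.2) (W p.1 p.2)

variable {S : Set ℝ} {f g : ℝ → ℝ} {V W : ℝ → ℝ → ℝ} {x y z ε t s r u : ℝ}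

section reflection

theorem mem_window_reflect {p : ℝ × ℝ} :
    p ∈ window (reflectSet S) (-z) ε ↔ (-p.1, p.2) ∈ window S z ε := by
  simp only [window, mem_ofPred_eq, mem_reflectSet]
  constructor <;> rintro ⟨h1, h2, h3, h4⟩ <;> exact ⟨h1, h2, by linarith, by linarith⟩

theorem evolvesOn_window_reflect :
    EvolvesOn (reflectSet S) (reflectData g) (reflectData f) (window (reflectSet S) (-z) ε)
      (reflectSol W) (reflectSol V) ↔ EvolvesOn S f g (window S z ε) V W := by
  constructor
  · intro h p hp
    have := h (-p.1, p.2) (mem_window_reflect.2 (by simpa using hp))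
    rw [evolvesAt_reflect] at this
    simpa [reflectSol] using this
  · intro h p hp
    rw [evolvesAt_reflect]
    simpa [reflectSol] using h _ (mem_window_reflect.1 hp)

theorem continuousOn_window_reflect (h : ContinuousOn (fun p : ℝ × ℝ => V p.1 p.2) (window S z ε)) :
    ContinuousOn (fun p : ℝ × ℝ => reflectSol V p.1 p.2) (window (reflectSet S) (-z) ε) := by
  have hc : Continuous fun p : ℝ × ℝ => (-p.1, p.2) := by fun_prop
  exact (h.comp hc.continuousOn fun p hp => mem_window_reflect.1 hp).neg

theorem IsWindow.reflect (h : IsWindow S f g z ε) :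
    IsWindow (reflectSet S) (reflectData g) (reflectData f) (-z) ε := by
  have e1 : Icc (-z - ε) (-z) ∩ reflectSet S = reflectSet (Icc z (z + ε) ∩ S) := by
    rw [reflectSet_inter, reflectSet_Icc]; congr 2; ring
  have e2 : Icc (-z) (-z + ε) ∩ reflectSet S = reflectSet (Icc (z - ε) z ∩ S) := by
    rw [reflectSet_inter, reflectSet_Icc]; congr 2; ring
  refine ⟨h.pos, ?_, ?_, ?_, ?_, ?_, ?_⟩
  · rcases h.subset with h1 | ⟨h1, h2⟩ | ⟨h1, h2⟩
    · left
      intro u hu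
      exact h1 ⟨by linarith [hu.2], by linarith [hu.1]⟩
    · right; right
      exact ⟨isGreatest_reflectSet.2 (by simpa using h1), by
        rw [mem_reflectSet]; convert h2 using 1; ring⟩
    · right; left
      exact ⟨isLeast_reflectSet.2 (by simpa using h1), by
        rw [mem_reflectSet]; convert h2 using 1; ring⟩
  · rw [e1, strictMonotoneOn_reflectData]; exact h.g_right
  · rw [e2, strictMonotoneOn_reflectData]; exact h.g_left
  · rw [e1, strictMonotoneOn_reflectData]; exact h.f_right
  · rw [e2, strictMonotoneOn_reflectData]; exact h.f_left
  · rcases h.sep with h1 | h1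
    · left
      intro a ha b hb
      exact neg_le_neg (h1 _ ⟨⟨by linarith [hb.1.2], by linarith [hb.1.1]⟩, hb.2⟩ _
        ⟨⟨by linarith [ha.1.2], by linarith [ha.1.1]⟩, ha.2⟩)
    · right
      simp [reflectData, h1]

end reflection

/-! ### The liquid case -/

/-- All liquid cases share the condition that `f` at a point is at least `g` at every point to its
right. As the explicit values are unique, evaluating them once gives both directions; the other
equivalences use the same principle. -/
theorem liquidFormula_iff (hS : IsSpace S) (h : RegularData S f g) (hε : 0 < ε)
    (hsub : Icc (z - ε) (z + ε) ⊆ S)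
    (H : ∀ a ∈ Icc (z - ε) (z + ε), ∀ b ∈ Icc (z - ε) (z + ε), a ≤ b → g b ≤ f a) :
    LiquidFormula (window S z ε) f g V W ↔ EvolvesOn S f g (window S z ε) V W := by
  refine forall₂_congr fun p hp => ?_
  obtain ⟨h1, h2, h3, h4⟩ := hp
  have key : EvolvesAt S f g p.2 p.1 (f (p.1 - p.2)) (g (p.1 + p.2)) := by
    refine evolvesAt_liquid hS h h1 ⟨z - ε, hsub ⟨le_rfl, by linarith⟩, by linarith⟩
      ⟨z + ε, hsub ⟨by linarith, le_rfl⟩, by linarith⟩ (fun y hy => ?_) (fun y hy => ?_)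
    · exact H _ ⟨by linarith, by linarith⟩ _ ⟨by linarith [hy.1], by linarith [hy.2]⟩ hy.1
    · exact H _ ⟨by linarith [hy.1], by linarith [hy.2]⟩ _ ⟨by linarith, by linarith⟩ hy.2
  constructor
  · rintro ⟨e1, e2⟩
    rw [e1, e2]; exact key
  · intro h'
    exact h'.unique hS key

/-! ### The freezing formula -/

theorem exists_cross (hS : IsSpace S) (h : RegularData S f g) (hu : 0 ≤ u) (hx : x - u ∈ S)
    (hx' : x + u ∈ S) (hfg : f (x - u) ≤ g (x + u)) :
    ∃ s ∈ Icc 0 u, f (x - s) = g (x + s) := by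
  have hsub : ∀ s ∈ Icc 0 u, x - s ∈ S ∧ x + s ∈ S := fun s hs =>
    ⟨hS.Icc_subset hx hx' ⟨by linarith [hs.2], by linarith [hs.1]⟩,
      hS.Icc_subset hx hx' ⟨by linarith [hs.1], by linarith [hs.2]⟩⟩
  have hc : ContinuousOn (fun s => f (x - s) - g (x + s)) (Icc 0 u) :=
    (h.cont_f.comp (by fun_prop) fun s hs => (hsub s hs).1).sub
      (h.cont_g.comp (by fun_prop) fun s hs => (hsub s hs).2)
  have h0 : 0 ≤ f (x - 0) - g (x + 0) := by
    have := h.le x (by simpa using (hsub 0 ⟨le_rfl, hu⟩).1)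
    simpa using this
  obtain ⟨s, hs, e⟩ := intermediate_value_Icc' hu hc ⟨sub_nonpos.2 hfg, h0⟩
  exact ⟨s, hs, sub_eq_zero.1 e⟩

/-- Let c be the common value at the crossing. Monotonicity gives f ≤ c before x - s, g ≤ c ≤ f
between x - s and x + s, and g ≥ c after x + s, which is the pattern of `evolvesAt_freeze`. -/
theorem evolvesAt_of_cross (hS : IsSpace S) (h : RegularData S f g) (hx : x ∈ S)
    (hf : StrictMonoOn f (S ∩ Icc (x - t) (x + t))) (hg : StrictMonoOn g (S ∩ Icc (x - t) (x + t)))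
    (he : ∃ e ∈ S, x + t < e) (hs : s ∈ Icc 0 t) (hxs : x - s ∈ S) (hc : f (x - s) = g (x + s)) :
    EvolvesAt S f g t x (f (x - s)) (f (x - s)) := by
  obtain ⟨e, heS, he⟩ := he
  obtain ⟨hs0, hst⟩ := hs
  have hxs' : x + s ∈ S := hS.Icc_subset hx heS ⟨by linarith, by linarith⟩
  have m1 : x - s ∈ S ∩ Icc (x - t) (x + t) := ⟨hxs, by linarith, by linarith⟩
  have m2 : x + s ∈ S ∩ Icc (x - t) (x + t) := ⟨hxs', by linarith, by linarith⟩
  refine evolvesAt_freeze hS h hs0 hst hxs hxs' (fun hl => ?_) ⟨e, heS, by linarith⟩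
    (fun y hy hy' => ?_) (fun y hy hy' => ?_) (fun y hy hy' => ?_) (fun y hy hy' => ?_)
  -- If the foot x - s were the left endpoint, `f` and `g` would agree there, so `g` would take the
  -- same value at x - s and x + s. Then s = 0 and x is the endpoint.
  · refine exists_lt_of_not_isLeast hxs fun hl' => hl ?_
    have : x - s = x + s := hg.injOn m1 m2 (by rw [← hc, h.eq_left _ hl'])
    have h0 : s = 0 := by linarith
    rwa [h0, sub_zero] at hl'
  · exact hf.monotoneOn ⟨hy, hy'.1, by linarith [hy'.2]⟩ m1 hy'.2
  · rw [hc]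
    exact hg.monotoneOn ⟨hy, by linarith [hy'.1], by linarith [hy'.2]⟩ m2 hy'.2
  · exact hf.monotoneOn m1 ⟨hy, by linarith [hy'.1], by linarith [hy'.2]⟩ hy'.1
  · rw [hc]
    exact hg.monotoneOn m2 ⟨hy, by linarith [hy'.1], by linarith [hy'.2]⟩ hy'.1

/-- Without a crossing, g(x + u) ≤ f(x - u) persists by continuity. The characteristic cannot reach
a left endpoint a: there f(a) = g(a) ≤ g(2x - a), so the two values would agree at u = x - a. What
remains is liquid. -/
theorem evolvesAt_of_not_cross (hS : IsSpace S) (h : RegularData S f g) (hx : x ∈ S) (ht : 0 ≤ t)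
    (hf : StrictMonoOn f (S ∩ Icc (x - t) (x + t))) (hg : StrictMonoOn g (S ∩ Icc (x - t) (x + t)))
    (he : ∃ e ∈ S, x + t < e) (hc : ∀ s ∈ Icc 0 t, x - s ∈ S → f (x - s) ≠ g (x + s)) :
    EvolvesAt S f g t x (f (x - t)) (g (x + t)) := by
  obtain ⟨e, heS, he⟩ := he
  have key : ∀ u ∈ Icc 0 t, x - u ∈ S → g (x + u) ≤ f (x - u) := by
    intro u hu hxu
    by_contra hlt
    have hxu' : x + u ∈ S := hS.Icc_subset hx heS ⟨by linarith [hu.1], by linarith [hu.2]⟩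
    obtain ⟨s, hs, hs'⟩ := exists_cross hS h hu.1 hxu hxu' (not_le.1 hlt).le
    exact hc s ⟨hs.1, hs.2.trans hu.2⟩
      (hS.Icc_subset hxu hxu' ⟨by linarith [hs.2], by linarith [hs.1, hu.1]⟩) hs'
  rcases hS.lt_or_exists_isLeast hx (show x - t ≤ x by linarith) with ⟨h1, he'⟩ | ⟨a, ha, h1⟩
  · have hsub : ∀ y ∈ Icc (x - t) (x + t), y ∈ S := fun y hy =>
      hS.Icc_subset h1 heS ⟨hy.1, hy.2.trans he.le⟩
    have m1 : x - t ∈ S ∩ Icc (x - t) (x + t) := ⟨h1, le_rfl, by linarith⟩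
    have m2 : x + t ∈ S ∩ Icc (x - t) (x + t) :=
      ⟨hsub _ ⟨by linarith, le_rfl⟩, by linarith, le_rfl⟩
    have hk := key t ⟨ht, le_rfl⟩ h1
    refine evolvesAt_liquid hS h ht he' ⟨e, heS, he⟩ (fun y hy => ?_) (fun y hy => ?_)
    · exact (hg.monotoneOn ⟨hsub y hy, hy⟩ m2 hy.2).trans hk
    · exact hk.trans (hf.monotoneOn m1 ⟨hsub y hy, hy⟩ hy.1)
  · have hax := ha.2 hx
    have hm : x - a ∈ Icc 0 t := ⟨by linarith, by linarith⟩
    have e1 : x - (x - a) = a := by ring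
    have h2 := key (x - a) hm (by rw [e1]; exact ha.1)
    have h3 := hc (x - a) hm (by rw [e1]; exact ha.1)
    rw [e1] at h2 h3
    have h4 : g a ≤ g (x + (x - a)) := hg.monotoneOn ⟨ha.1, by linarith, by linarith⟩
      ⟨hS.Icc_subset hx heS ⟨by linarith, by linarith⟩, by linarith, by linarith⟩ (by linarith)
    rw [← h.eq_left a ha] at h4
    exact absurd (le_antisymm h4 h2) h3

theorem freezingFormula_iff (hS : IsSpace S) (h : RegularData S f g) {D : Set (ℝ × ℝ)}
    (hD : ∀ p ∈ D, p.1 ∈ S ∧ 0 ≤ p.2 ∧ StrictMonoOn f (S ∩ Icc (p.1 - p.2) (p.1 + p.2)) ∧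
      StrictMonoOn g (S ∩ Icc (p.1 - p.2) (p.1 + p.2)) ∧ ∃ e ∈ S, p.1 + p.2 < e) :
    FreezingFormula S D f g V W ↔ EvolvesOn S f g D V W := by
  refine forall₂_congr fun p hp => ?_
  obtain ⟨h1, h2, h3, h4, h5⟩ := hD p hp
  constructor
  · rintro ⟨h6, h7⟩
    by_cases hc : ∀ s ∈ Icc 0 p.2, p.1 - s ∈ S → f (p.1 - s) ≠ g (p.1 + s)
    · rw [(h6 hc).1, (h6 hc).2]
      exact evolvesAt_of_not_cross hS h h1 h2 h3 h4 h5 hc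
    · push Not at hc
      obtain ⟨s, hs, hs1, hs2⟩ := hc
      rw [(h7 s hs hs1 hs2).1, (h7 s hs hs1 hs2).2]
      exact evolvesAt_of_cross hS h h1 h3 h4 h5 hs hs1 hs2
  · intro h6
    exact ⟨fun hc => h6.unique hS (evolvesAt_of_not_cross hS h h1 h2 h3 h4 h5 hc),
      fun s hs hs1 hs2 => h6.unique hS (evolvesAt_of_cross hS h h1 h3 h4 h5 hs hs1 hs2)⟩

/-! ### The reflection case -/

theorem evolvesAt_reflection_of_ge (hS : IsSpace S) (h : RegularData S f g) (hz : IsLeast S z)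
    (hzε : z + ε ∈ S) (hg : StrictAntiOn g (Icc z (z + ε))) (ht : 0 ≤ t)
    (h2 : x < z + ε - t) (hx : z + t ≤ x) : EvolvesAt S f g t x (f (x - t)) (g (x + t)) := by
  have hsub : ∀ y ∈ Icc z (z + ε), y ∈ S := fun y hy => hS.Icc_subset hz.1 hzε hy
  have m1 : x - t ∈ Icc z (z + ε) := ⟨by linarith, by linarith⟩
  have m2 : x + t ∈ Icc z (z + ε) := ⟨by linarith, by linarith⟩
  refine ⟨fun hl => ?_, fun _ => ?_, ?_⟩
  -- `isV_transport` needs a point of `S` to the left of the foot, so a foot at the endpoint itself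
  -- is treated as a reflection, where f z = g z.
  · rcases eq_or_lt_of_le m1.1 with h3 | h3
    · have hzx : z < x := lt_of_le_of_ne (by linarith) fun e => hl (e ▸ hz)
      have := isV_reflection hS h hz h3.ge hzx hzε m2.2
        (hg.mono (Icc_subset_Icc le_rfl m2.2))
      rwa [← h3, show 2 * z - z = z by ring, ← h.eq_left z hz, h3] at this
    · refine isV_transport hS h (hsub _ m1) (hsub _ m1) (hsub _ m2) le_rfl (by linarith) le_rfl
        (by linarith) ⟨z, hz.1, h3⟩ (fun y _ hy => by rw [le_antisymm hy.2 hy.1])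
        fun y hy hy' => ?_
      exact (hg.antitoneOn m1 ⟨m1.1.trans hy'.1, hy'.2.trans m2.2⟩ hy'.1).trans (h.le _ (hsub _ m1))
  · refine isW_transport hS h (hsub _ m2) (hsub _ m1) (hsub _ m1) (by linarith) le_rfl le_rfl
      (by linarith) ⟨z + ε, hzε, by linarith⟩ (fun y hy hy' => ?_) fun y hy hy' => ?_
    · exact hg.antitoneOn ⟨m1.1.trans hy'.1, hy'.2.trans m2.2⟩ m2 hy'.2
    · rw [le_antisymm hy'.2 hy'.1]
      exact (hg.antitoneOn m1 m2 (by linarith)).trans (h.le _ (hsub _ m1))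
  · rintro (h3 | h3)
    · have := h3.unique hz
      have h0 : t = 0 := by linarith
      rw [this, h0, sub_zero, add_zero, h.eq_left z hz]
    · linarith [h3.2 hzε]

theorem evolvesAt_reflection_of_lt (hS : IsSpace S) (h : RegularData S f g) (hz : IsLeast S z)
    (hzε : z + ε ∈ S) (hg : StrictAntiOn g (Icc z (z + ε))) (hxS : x ∈ S)
    (h2 : x < z + ε - t) (hx : x < z + t) :
    EvolvesAt S f g t x (g (z + t - (x - z))) (g (x + t)) := by
  have hsub : ∀ y ∈ Icc z (z + ε), y ∈ S := fun y hy => hS.Icc_subset hz.1 hzε hy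
  have hzx := hz.2 hxS
  have m2 : x + t ∈ Icc z (z + ε) := ⟨by linarith, by linarith⟩
  refine ⟨fun hl => ?_, fun _ => ?_, ?_⟩
  · have hzx : z < x := lt_of_le_of_ne (by linarith) fun e => hl (e ▸ hz)
    have := isV_reflection hS h hz (t := t) (by linarith) hzx hzε m2.2
      (hg.mono (Icc_subset_Icc le_rfl m2.2))
    rwa [show 2 * z - (x - t) = z + t - (x - z) by ring] at this
  · refine isW_transport hS h (hsub _ m2) hz.1 hz.1 m2.1 le_rfl (by linarith)
      (by linarith) ⟨z + ε, hzε, by linarith⟩ (fun y hy hy' => ?_) fun y hy hy' => ?_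
    · exact hg.antitoneOn ⟨hy'.1, hy'.2.trans m2.2⟩ m2 hy'.2
    · rw [le_antisymm hy'.2 hy'.1, h.eq_left z hz]
      exact hg.antitoneOn ⟨le_rfl, by linarith [m2.1, m2.2]⟩ m2 m2.1
  · rintro (h3 | h3)
    · rw [h3.unique hz]; congr 1; ring
    · linarith [h3.2 hzε]

theorem reflectionCase_iff (hS : IsSpace S) (h : RegularData S f g) (hz : IsLeast S z)
    (hzε : z + ε ∈ S) (hg : StrictAntiOn g (Icc z (z + ε))) :
    ReflectionCase S f g z ε V W ↔ EvolvesOn S f g (window S z ε) V W := by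
  constructor
  · rintro ⟨-, -, -, hW, hV1, hV2⟩ p hp
    obtain ⟨h1, h2, h3, h4⟩ := id hp
    rw [hW p hp]
    rcases le_or_gt (z + p.2) p.1 with h5 | h5
    · rw [hV1 p hp h5]
      exact evolvesAt_reflection_of_ge hS h hz hzε hg h1 h4 h5
    · rw [hV2 p hp h5]
      exact evolvesAt_reflection_of_lt hS h hz hzε hg h2 h4 h5
  · intro H
    have A : ∀ p ∈ window S z ε, z + p.2 ≤ p.1 →
        V p.1 p.2 = f (p.1 - p.2) ∧ W p.1 p.2 = g (p.1 + p.2) := fun p hp h5 =>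
      (H p hp).unique hS (evolvesAt_reflection_of_ge hS h hz hzε hg hp.1 hp.2.2.2 h5)
    have B : ∀ p ∈ window S z ε, p.1 < z + p.2 →
        V p.1 p.2 = g (z + p.2 - (p.1 - z)) ∧ W p.1 p.2 = g (p.1 + p.2) := fun p hp h5 =>
      (H p hp).unique hS (evolvesAt_reflection_of_lt hS h hz hzε hg hp.2.1 hp.2.2.2 h5)
    refine ⟨hz, h.eq_left z hz, hg, fun p hp => ?_, fun p hp h5 => (A p hp h5).1,
      fun p hp h5 => (B p hp h5).1⟩
    rcases le_or_gt (z + p.2) p.1 with h5 | h5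
    exacts [(A p hp h5).2, (B p hp h5).2]

theorem endpointFreezingCase_iff (hS : IsSpace S) (h : RegularData S f g) (hz : IsLeast S z)
    (hzε : z + ε ∈ S) (hf : StrictMonoOn f (Icc z (z + ε)))
    (hg : StrictMonoOn g (Icc z (z + ε))) :
    EndpointFreezingCase S f g z ε V W ↔ EvolvesOn S f g (window S z ε) V W := by
  have hD : ∀ p ∈ window S z ε, p.1 ∈ S ∧ 0 ≤ p.2 ∧
      StrictMonoOn f (S ∩ Icc (p.1 - p.2) (p.1 + p.2)) ∧
      StrictMonoOn g (S ∩ Icc (p.1 - p.2) (p.1 + p.2)) ∧ ∃ e ∈ S, p.1 + p.2 < e := by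
    rintro p ⟨h1, h2, h3, h4⟩
    have hsub : S ∩ Icc (p.1 - p.2) (p.1 + p.2) ⊆ Icc z (z + ε) := fun y hy =>
      ⟨hz.2 hy.1, by linarith [hy.2.2]⟩
    exact ⟨h2, h1, hf.mono hsub, hg.mono hsub, z + ε, hzε, by linarith⟩
  rw [← freezingFormula_iff hS h hD]
  exact ⟨fun H => H.freezing, fun H => ⟨hz, h.eq_left z hz, hf, hg, H⟩⟩

end freezing

/-! ### Thawing, and the equivalence of the local construction with the explicit formulas. -/

section construction

/-! ### The thawing case -/

/-- Both data increase to the left of `z`, where they meet, and `g` decreases to the right. -/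
structure ThawData (S : Set ℝ) (f g : ℝ → ℝ) (z ε : ℝ) : Prop where
  pos : 0 < ε
  subset : Icc (z - ε) (z + ε) ⊆ S
  meet : f z = g z
  f_left : StrictMonoOn f (Icc (z - ε) z)
  g_left : StrictMonoOn g (Icc (z - ε) z)
  g_right : StrictAntiOn g (Icc z (z + ε))

variable {S : Set ℝ} {f g : ℝ → ℝ} {V W : ℝ → ℝ → ℝ} {x y z ε t s r u : ℝ}

namespace ThawData

/-- By monotonicity f(2x - z) ≤ f(z) = g(z), so every x ≤ z close enough to z is frozen no later
than on the line x + t = z. -/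
theorem exists_cross (d : ThawData S f g z ε) (hS : IsSpace S) (h : RegularData S f g)
    (hx : x ≤ z) (hx' : z - ε < x - (z - x)) : ∃ s ∈ Icc 0 (z - x), f (x - s) = g (x + s) := by
  have hε := d.pos
  refine _root_.exists_cross hS h (by linarith) (d.subset ⟨hx'.le, by linarith⟩)
    (d.subset ⟨by linarith, by linarith⟩) ?_
  rw [show x + (z - x) = z by ring, ← d.meet]
  exact d.f_left.monotoneOn ⟨hx'.le, by linarith⟩ ⟨by linarith, le_rfl⟩ (by linarith)

/-- The frozen value increases with the space coordinate. -/
theorem cross_mono (d : ThawData S f g z ε) {x₁ s₁ : ℝ} (hx : x ≤ x₁) (hx₁ : x₁ ≤ z)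
    (hx' : z - ε < x - (z - x)) (hs : s ∈ Icc 0 (z - x)) (hs₁ : s₁ ∈ Icc 0 (z - x₁))
    (e : f (x - s) = g (x + s)) (e₁ : f (x₁ - s₁) = g (x₁ + s₁)) : f (x - s) ≤ f (x₁ - s₁) := by
  obtain ⟨a1, a2⟩ := hs
  obtain ⟨b1, b2⟩ := hs₁
  rcases le_total (x - s) (x₁ - s₁) with h1 | h1
  · exact d.f_left.monotoneOn ⟨by linarith, by linarith⟩ ⟨by linarith, by linarith⟩ h1
  · rw [e, e₁]
    exact d.g_left.monotoneOn ⟨by linarith, by linarith⟩ ⟨by linarith, by linarith⟩ (by linarith)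

/-- `g` increases up to z and then decreases, so if g(x + t) has not fallen below the frozen value,
`g` is at least that value on all of [x + s, x + t], and the point is still frozen. -/
theorem evolvesAt_below (d : ThawData S f g z ε) (hS : IsSpace S) (h : RegularData S f g)
    (hp : (x, t) ∈ window S z ε) (hxz : x ≤ z) (hs : s ∈ Icc 0 (z - x)) (hzt : z ≤ x + t)
    (e : f (x - s) = g (x + s)) (hge : f (x - s) ≤ g (x + t)) :
    EvolvesAt S f g t x (f (x - s)) (f (x - s)) := by
  obtain ⟨h1, h2, h3, h4⟩ := hp
  obtain ⟨a1, a2⟩ := hs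
  simp only at h1 h2 h3 h4
  have hε := d.pos
  refine evolvesAt_freeze hS h a1 (by linarith) (d.subset ⟨by linarith, by linarith⟩)
    (d.subset ⟨by linarith, by linarith⟩)
    (fun _ => ⟨z - ε, d.subset ⟨le_rfl, by linarith⟩, by linarith⟩)
    ⟨z + ε, d.subset ⟨by linarith, le_rfl⟩, by linarith⟩
    (fun y _ hy => ?_) (fun y _ hy => ?_) (fun y _ hy => ?_) (fun y hyS hy => ?_)
  · exact d.f_left.monotoneOn ⟨by linarith [hy.1], by linarith [hy.2]⟩
      ⟨by linarith, by linarith⟩ hy.2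
  · rw [e]
    exact d.g_left.monotoneOn ⟨by linarith [hy.1], by linarith [hy.2]⟩
      ⟨by linarith, by linarith⟩ hy.2
  · exact d.f_left.monotoneOn ⟨by linarith, by linarith⟩
      ⟨by linarith [hy.1], by linarith [hy.2]⟩ hy.1
  · rcases le_total y z with h5 | h5
    · rw [e]
      exact d.g_left.monotoneOn ⟨by linarith, by linarith⟩ ⟨by linarith [hy.1], h5⟩ hy.1
    · exact hge.trans (d.g_right.antitoneOn ⟨h5, by linarith [hy.2]⟩ ⟨hzt, by linarith⟩ hy.2)

/-- On the thawing curve the incoming value g(x + t) equals the frozen value. Afterwards `g`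
decreases: no level above the frozen value meets a new particle of speed -1, so V moves as in
`isV_thaw`, and the smaller value carried by W passes through. -/
theorem evolvesAt_above (d : ThawData S f g z ε) (hS : IsSpace S) (h : RegularData S f g)
    (ht : 0 ≤ t) (hr : 0 ≤ r)
    (hp : (x + r, t + r) ∈ window S z ε) (hxz : x ≤ z) (hs : s ∈ Icc 0 (z - x)) (hzt : z ≤ x + t)
    (e : f (x - s) = g (x + s)) (hge : f (x - s) = g (x + t)) :
    EvolvesAt S f g (t + r) (x + r) (f (x - s)) (g (x + t + 2 * r)) := by
  obtain ⟨h1, h2, h3, h4⟩ := hp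
  obtain ⟨a1, a2⟩ := hs
  simp only at h1 h2 h3 h4
  have hε := d.pos
  have D : ∀ y ∈ Icc (x + s) (x + t), f (x - s) ≤ g y := by
    intro y hy
    rcases le_total y z with h5 | h5
    · rw [e]
      exact d.g_left.monotoneOn ⟨by linarith, by linarith⟩ ⟨by linarith [hy.1], h5⟩ hy.1
    · rw [hge]
      exact d.g_right.antitoneOn ⟨h5, by linarith [hy.2]⟩ ⟨hzt, by linarith⟩ hy.2
  have C : ∀ y ∈ Icc (x - s) (x + s), f (x - s) ≤ f y := fun y hy =>
    d.f_left.monotoneOn ⟨by linarith, by linarith⟩ ⟨by linarith [hy.1], by linarith [hy.2]⟩ hy.1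
  refine ⟨fun _ => ?_, fun _ => ?_, ?_⟩
  · refine isV_thaw hS h a1 (by linarith) hr (d.subset ⟨by linarith, by linarith⟩)
      (d.subset ⟨by linarith, by linarith⟩) ⟨z - ε, d.subset ⟨le_rfl, by linarith⟩, by linarith⟩
      (fun y _ hy => ?_) (fun y _ hy => ?_) (fun y _ hy => C y hy) (fun y _ hy => D y hy)
      (fun y hy => ⟨fun _ => ?_, z + ε, d.subset ⟨by linarith, le_rfl⟩, by linarith [hy.2]⟩)
    · exact d.f_left.monotoneOn ⟨by linarith [hy.1], by linarith [hy.2]⟩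
        ⟨by linarith, by linarith⟩ hy.2
    · rw [e]
      exact d.g_left.monotoneOn ⟨by linarith [hy.1], by linarith [hy.2]⟩
        ⟨by linarith, by linarith⟩ hy.2
    · rw [hge]
      exact d.g_right.antitoneOn ⟨hzt, by linarith⟩ ⟨by linarith [hy.1], by linarith [hy.2]⟩ hy.1.le
  · have e1 : x + t + 2 * r = x + r + (t + r) := by ring
    have hle : g (x + t + 2 * r) ≤ f (x - s) := by
      rw [hge]
      exact d.g_right.antitoneOn ⟨hzt, by linarith⟩ ⟨by linarith, by linarith⟩ (by linarith)
    rw [e1] at hle ⊢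
    refine isW_transport hS h (m₁ := x + s) (m₂ := x - s) (d.subset ⟨by linarith, by linarith⟩)
      (d.subset ⟨by linarith, by linarith⟩) (d.subset ⟨by linarith, by linarith⟩) (by linarith)
      (by linarith) (by linarith) (by linarith)
      ⟨z + ε, d.subset ⟨by linarith, le_rfl⟩, by linarith⟩ (fun y _ hy => ?_)
      (fun y _ hy => hle.trans (C y hy))
    rcases le_total y (x + t) with h5 | h5
    · exact hle.trans (D y ⟨hy.1, h5⟩)
    · exact d.g_right.antitoneOn ⟨hzt.trans h5, by linarith [hy.2]⟩ ⟨by linarith, by linarith⟩ hy.2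
  · rintro (h5 | h5)
    · linarith [h5.2 (d.subset (a := z - ε) ⟨le_rfl, by linarith⟩)]
    · linarith [h5.2 (d.subset (a := z + ε) ⟨by linarith, le_rfl⟩)]

theorem evolvesAt_base (d : ThawData S f g z ε) (hS : IsSpace S) (h : RegularData S f g)
    (hs : 0 ≤ s) (hx : z ≤ x) (hp : (x + s, s) ∈ window S z ε) :
    EvolvesAt S f g s (x + s) (f x) (g (x + 2 * s)) := by
  obtain ⟨h1, h2, h3, h4⟩ := hp
  simp only at h1 h2 h3 h4
  have hε := d.pos
  have e0 : x + s - s = x := by ring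
  have e1 : x + s + s = x + 2 * s := by ring
  have := evolvesAt_liquid hS h hs (x := x + s)
    ⟨z - ε, d.subset ⟨le_rfl, by linarith⟩, by linarith⟩
    ⟨z + ε, d.subset ⟨by linarith, le_rfl⟩, by linarith⟩
  rw [e0, e1] at this
  refine this (fun y hy => ?_) (fun y hy => ?_)
  · exact (d.g_right.antitoneOn ⟨hx, by linarith⟩ ⟨hx.trans hy.1, by linarith [hy.2]⟩ hy.1).trans
      (h.le x (d.subset ⟨by linarith, by linarith⟩))
  · exact (d.g_right.antitoneOn ⟨hx.trans hy.1, by linarith [hy.2]⟩ ⟨by linarith, by linarith⟩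
      hy.2).trans (h.le y (d.subset ⟨by linarith [hy.1], by linarith [hy.2]⟩))

theorem freezingFormula_iff (d : ThawData S f g z ε) (hS : IsSpace S) (h : RegularData S f g) :
    FreezingFormula S {p | p ∈ window S z ε ∧ p.1 + p.2 ≤ z} f g V W ↔
      EvolvesOn S f g {p | p ∈ window S z ε ∧ p.1 + p.2 ≤ z} V W := by
  refine _root_.freezingFormula_iff hS h ?_
  rintro p ⟨⟨h1, h2, h3, h4⟩, h5⟩
  have hε := d.pos
  have hsub : S ∩ Icc (p.1 - p.2) (p.1 + p.2) ⊆ Icc (z - ε) z := fun y hy =>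
    ⟨by linarith [hy.2.1], by linarith [hy.2.2]⟩
  exact ⟨h2, h1, d.f_left.mono hsub, d.g_left.mono hsub, z + ε,
    d.subset ⟨by linarith, le_rfl⟩, by linarith⟩

/-- The value on the line `x + t = z`. -/
theorem evolvesAt_line (d : ThawData S f g z ε) (hS : IsSpace S) (h : RegularData S f g)
    (hx : x ≤ z) (hx' : z - ε < x - (z - x)) (hs : s ∈ Icc 0 (z - x)) (e : f (x - s) = g (x + s)) :
    EvolvesAt S f g (z - x) x (f (x - s)) (f (x - s)) := by
  have hε := d.pos
  refine d.evolvesAt_below hS h ⟨by simpa using hx, d.subset ⟨by linarith, by linarith⟩,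
    by simp only; linarith, by simp only; linarith⟩ hx hs (by linarith) e ?_
  rw [show x + (z - x) = z by ring, ← d.meet]
  exact d.f_left.monotoneOn ⟨by linarith [hs.2], by linarith [hs.1]⟩ ⟨by linarith, le_rfl⟩
    (by linarith [hs.1])

theorem mem_window_line (d : ThawData S f g z ε) (hx : x ≤ z) (hx' : z - ε < x - (z - x)) :
    (x, z - x) ∈ window S z ε := by
  have hε := d.pos
  exact ⟨by simpa using hx, d.subset ⟨by linarith, by linarith⟩,
    by simp only; linarith, by simp only; linarith⟩

end ThawData

theorem EvolvesOn.thawingCase (hS : IsSpace S) (h : RegularData S f g) (d : ThawData S f g z ε)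
    (H : EvolvesOn S f g (window S z ε) V W) : ThawingCase S f g z ε V W := by
  have hε := d.pos
  have line : ∀ x s, x ≤ z → z - ε < x - (z - x) → s ∈ Icc 0 (z - x) → f (x - s) = g (x + s) →
      V x (z - x) = f (x - s) := fun x s h1 h2 h3 h4 =>
    ((H _ (d.mem_window_line h1 h2)).unique hS (d.evolvesAt_line hS h h1 h2 h3 h4)).1
  refine ⟨d.meet, d.f_left, d.g_left, d.g_right,
    (d.freezingFormula_iff hS h).2 fun p hp => H p hp.1, ?_, ?_, ?_⟩
  · rintro ⟨x, t⟩ hp hxz hzt hno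
    obtain ⟨h1, h2, h3, h4⟩ := id hp
    simp only at *
    have hx' : z - ε < x - (z - x) := by linarith
    obtain ⟨s, hs, e⟩ := d.exists_cross hS h hxz hx'
    have hl := line x s hxz hx' hs e
    -- Otherwise `g`, starting from g z ≥ f (x - s), has equalled the frozen value earlier, which
    -- gives an excluded point of the thawing curve.
    have hge : f (x - s) ≤ g (x + t) := by
      by_contra hlt
      have hfz : f (x - s) ≤ g z := by
        rw [← d.meet]
        exact d.f_left.monotoneOn ⟨by linarith [hs.2], by linarith [hs.1]⟩ ⟨by linarith, le_rfl⟩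
          (by linarith [hs.1])
      obtain ⟨u, hu, hgu⟩ := intermediate_value_Icc' hzt (h.cont_g.mono fun y hy =>
        d.subset ⟨by linarith [hy.1], by linarith [hy.2]⟩) ⟨(not_le.1 hlt).le, hfz⟩
      have hut : u < x + t := lt_of_le_of_ne hu.2 fun e' => hlt (by rw [← hgu, e'])
      refine hno (u - x) (by linarith) ⟨⟨by linarith [hu.1], h2, by simp only; linarith,
        by simp only; linarith⟩, hxz, by simp only; linarith [hu.1], ?_⟩
      simp only
      rw [hl, ← hgu]; congr 1; ring
    rw [hl]
    exact (H _ hp).unique hS (d.evolvesAt_below hS h hp hxz hs hzt e hge)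
  · rintro ⟨x, t⟩ ⟨hp, hxz, hzt, hT⟩ r hr hp'
    obtain ⟨h1, h2, h3, h4⟩ := id hp
    simp only at *
    have hx' : z - ε < x - (z - x) := by linarith
    obtain ⟨s, hs, e⟩ := d.exists_cross hS h hxz hx'
    have hl := line x s hxz hx' hs e
    have hge : f (x - s) = g (x + t) := hl.symm.trans hT
    rw [((H _ hp).unique hS (d.evolvesAt_below hS h hp hxz hs hzt e hge.le)).1]
    exact (H _ hp').unique hS (d.evolvesAt_above hS h h1 hr hp' hxz hs hzt e hge)
  · intro x s hx hs hp
    exact (H _ hp).unique hS (d.evolvesAt_base hS h hs hx hp)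

/-- The thawing curve is defined through V itself. The task is to show that each characteristic with
foot left of z meets it, which uses the continuity of V, and to decide on which side of the curve a
point lies. -/
theorem ThawingCase.evolvesOn (hS : IsSpace S) (h : RegularData S f g) (hε : 0 < ε)
    (hsub : Icc (z - ε) (z + ε) ⊆ S)
    (hV : ContinuousOn (fun p : ℝ × ℝ => V p.1 p.2) (window S z ε))
    (T : ThawingCase S f g z ε V W) : EvolvesOn S f g (window S z ε) V W := by
  have d : ThawData S f g z ε := ⟨hε, hsub, T.meet, T.f_left, T.g_left, T.g_right⟩
  have F := (d.freezingFormula_iff hS h).1 T.freezing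
  have line : ∀ x s, x ≤ z → z - ε < x - (z - x) → s ∈ Icc 0 (z - x) → f (x - s) = g (x + s) →
      V x (z - x) = f (x - s) := fun x s h1 h2 h3 h4 =>
    ((F (x, z - x) ⟨d.mem_window_line h1 h2, by simp⟩).unique hS
      (d.evolvesAt_line hS h h1 h2 h3 h4)).1
  rintro ⟨x, t⟩ hp
  obtain ⟨h1, h2, h3, h4⟩ := id hp
  simp only at *
  rcases le_or_gt (x + t) z with hxt | hxt
  · exact F (x, t) ⟨hp, hxt⟩
  rcases le_or_gt z (x - t) with hk | hk
  · have hp' : (x - t + t, t) ∈ window S z ε := by simpa using hp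
    have e1 := T.above_base (x - t) t hk h1 hp'
    have e2 := d.evolvesAt_base hS h h1 hk hp'
    rw [← e1.1, ← e1.2] at e2
    simpa using e2
  set k := x - t with hkdef
  -- the characteristic through `(x, t)` meets the thawing curve
  obtain ⟨τ, ⟨hτ1, hτ2⟩, hτ⟩ : ∃ τ ∈ Icc ((z - k) / 2) (z - k),
      g (k + 2 * τ) - V (k + τ) (z - (k + τ)) = 0 := by
    have hc : ContinuousOn (fun τ => g (k + 2 * τ) - V (k + τ) (z - (k + τ)))
        (Icc ((z - k) / 2) (z - k)) := by
      refine (h.cont_g.comp (by fun_prop) fun τ hτ =>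
        hsub ⟨by linarith [hτ.1], by linarith [hτ.2]⟩).sub ?_
      have hcont : Continuous fun τ : ℝ => (k + τ, z - (k + τ)) := by fun_prop
      exact hV.comp hcont.continuousOn fun τ hτ =>
        d.mem_window_line (by linarith [hτ.2]) (by linarith [hτ.1])
    -- At τ = z - k the characteristic is at x = z, where the frozen value is g z and `g` has fallen
    -- to at most that. At τ = (z - k) / 2 it is on x + t = z, where `g` is still at least the
    -- frozen value.
    refine intermediate_value_Icc' (by linarith) hc ⟨?_, ?_⟩
    · have e1 : V z (z - z) = f (z - 0) :=
        line z 0 le_rfl (by linarith) ⟨le_rfl, by simp⟩ (by simpa using d.meet)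
      rw [show k + (z - k) = z by ring, e1, sub_zero, d.meet, sub_nonpos]
      exact d.g_right.antitoneOn ⟨le_rfl, by linarith⟩ ⟨by linarith, by linarith⟩ (by linarith)
    · have hx' : z - ε < k + (z - k) / 2 - (z - (k + (z - k) / 2)) := by linarith
      obtain ⟨s, hs, e⟩ := d.exists_cross hS h (x := k + (z - k) / 2) (by linarith) hx'
      rw [line _ s (by linarith) hx' hs e, show k + 2 * ((z - k) / 2) = z by ring, ← d.meet,
        sub_nonneg]
      exact d.f_left.monotoneOn ⟨by linarith [hs.2], by linarith [hs.1]⟩ ⟨by linarith, le_rfl⟩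
        (by linarith [hs.1])
  set x₁ := k + τ with hx₁
  have hx₁z : x₁ ≤ z := by linarith
  have hx₁' : z - ε < x₁ - (z - x₁) := by linarith
  obtain ⟨s₁, hs₁, e₁⟩ := d.exists_cross hS h hx₁z hx₁'
  have l₁ := line x₁ s₁ hx₁z hx₁' hs₁ e₁
  have hge₁ : f (x₁ - s₁) = g (x₁ + τ) := by
    rw [← l₁, show x₁ + τ = k + 2 * τ by rw [hx₁]; ring]; linarith
  rcases le_or_gt τ t with hτt | hτt
  · have hpT : (x₁, τ) ∈ window S z ε :=
      ⟨by simp only; linarith, hsub ⟨by linarith, by linarith⟩, by simp only; linarith,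
        by simp only; linarith⟩
    have hT : (x₁, τ) ∈ thawingCurve S g z ε V :=
      ⟨hpT, hx₁z, by simp only; linarith, by simp only; rw [l₁, hge₁]⟩
    -- No earlier point over x₁ lies on the curve, because `g` is injective to the right of z.
    have e2 := T.below (x₁, τ) hpT hx₁z (by simp only; linarith) fun s hs hmem => by
      obtain ⟨⟨-, -, -, m4⟩, -, m1, m2⟩ := hmem
      simp only at m1 m2 m4 hs
      have := d.g_right.injOn ⟨m1, by linarith⟩ ⟨by linarith, by linarith⟩
        (m2.symm.trans (l₁.trans hge₁))
      linarith
    have ex : x₁ + (t - τ) = x := by rw [hx₁, hkdef]; ring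
    have et : τ + (t - τ) = t := by ring
    have hp' : (x₁ + (t - τ), τ + (t - τ)) ∈ window S z ε := by rwa [ex, et]
    have e3 := T.above_curve (x₁, τ) hT (t - τ) (by linarith) hp'
    have e4 := d.evolvesAt_above hS h (by linarith) (by linarith) hp' hx₁z hs₁ (by linarith)
      e₁ hge₁
    simp only at e2 e3
    rw [ex, et] at e3 e4
    rw [e3.1, e3.2, e2.1, l₁]
    exact e4
  · have hxz : x ≤ z := by linarith
    have hx' : z - ε < x - (z - x) := by linarith
    obtain ⟨s, hs, e⟩ := d.exists_cross hS h hxz hx'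
    have l := line x s hxz hx' hs e
    -- Since x < x₁, the frozen value at x is at most that at x₁, while `g` has not yet come down to
    -- the latter. So (x, t) is below the curve.
    have hcc := d.cross_mono (x := x) (x₁ := x₁) (by linarith) hx₁z hx' hs hs₁ e e₁
    have hlt : ∀ y, z ≤ y → y < x₁ + τ → f (x - s) < g y := fun y hy hy' =>
      (hcc.trans hge₁.le).trans_lt (d.g_right ⟨hy, by linarith⟩ ⟨by linarith, by linarith⟩ hy')
    have e2 := T.below (x, t) hp hxz hxt.le fun s' hs' hmem => by
      obtain ⟨-, -, m1, m2⟩ := hmem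
      simp only at m1 m2 hs'
      have := hlt (x + s') m1 (by linarith)
      rw [← l, m2] at this
      exact lt_irrefl _ this
    simp only at e2
    rw [e2.1, e2.2, l]
    exact d.evolvesAt_below hS h hp hxz hs hxt.le e (hlt _ hxt.le (by linarith)).le

/-! ### The two directions -/

theorem IsWindow.add_mem (hw : IsWindow S f g z ε) (hS : IsSpace S) (hz : IsLeast S z) :
    z + ε ∈ S := by
  have hε := hw.pos
  rcases hw.subset with h1 | h1 | h1
  · linarith [hz.2 (h1 (a := z - ε) ⟨le_rfl, by linarith⟩)]
  · exact h1.2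
  · exact (hS.not_isLeast_isGreatest hz h1.1).elim

/-- The local construction agrees with the explicit formulas. -/
theorem LocalConstruction.evolvesOn (hS : IsSpace S) (h : RegularData S f g)
    (hw : IsWindow S f g z ε)
    (hV : ContinuousOn (fun p : ℝ × ℝ => V p.1 p.2) (window S z ε))
    (hW : ContinuousOn (fun p : ℝ × ℝ => W p.1 p.2) (window S z ε))
    (L : LocalConstruction S f g z ε V W) : EvolvesOn S f g (window S z ε) V W := by
  have hε := hw.pos
  cases L with
  | separated hsub H hVW =>
    exact (liquidFormula_iff hS h hε hsub fun a ha b hb _ => H a ha b hb).1 hVW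
  | decreasing_v hsub _ hf hVW =>
    exact (liquidFormula_iff hS h hε hsub fun a ha b hb hab =>
      (h.le b (hsub hb)).trans (hf.antitoneOn ha hb hab)).1 hVW
  | decreasing_w hsub _ hg hVW =>
    exact (liquidFormula_iff hS h hε hsub fun a ha b hb hab =>
      (hg.antitoneOn ha hb hab).trans (h.le a (hsub ha))).1 hVW
  | valley_peak hsub meet hf₁ hf₂ hg₁ hg₂ hVW =>
    refine (liquidFormula_iff hS h hε hsub fun a ha b hb _ => ?_).1 hVW
    have h1 : f z ≤ f a := by
      rcases le_total a z with h1 | h1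
      · exact hf₁.antitoneOn ⟨ha.1, h1⟩ ⟨by linarith, le_rfl⟩ h1
      · exact hf₂.monotoneOn ⟨le_rfl, by linarith⟩ ⟨h1, ha.2⟩ h1
    have h2 : g b ≤ g z := by
      rcases le_total b z with h1 | h1
      · exact hg₁.monotoneOn ⟨hb.1, h1⟩ ⟨by linarith, le_rfl⟩ h1
      · exact hg₂.antitoneOn ⟨le_rfl, by linarith⟩ ⟨h1, hb.2⟩ h1
    linarith
  | increasing hsub _ hf hg hVW =>
    refine (freezingFormula_iff hS h ?_).1 hVW
    rintro p ⟨h1, h2, h3, h4⟩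
    have hs : S ∩ Icc (p.1 - p.2) (p.1 + p.2) ⊆ Icc (z - ε) (z + ε) := fun y hy =>
      ⟨by linarith [hy.2.1], by linarith [hy.2.2]⟩
    exact ⟨h2, h1, hf.mono hs, hg.mono hs, z + ε, hsub ⟨by linarith, le_rfl⟩, by linarith⟩
  | thaw_right hsub H => exact H.evolvesOn hS h hε hsub hV
  | thaw_left hsub H =>
    refine evolvesOn_window_reflect.1 (H.evolvesOn hS.reflect h.reflect hε ?_
      (continuousOn_window_reflect hW))
    exact fun u hu => hsub ⟨by linarith [hu.2], by linarith [hu.1]⟩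
  | left_liquid H =>
    exact (reflectionCase_iff hS h H.least (hw.add_mem hS H.least) H.g_right).1 H
  | left_freezing H =>
    exact (endpointFreezingCase_iff hS h H.least (hw.add_mem hS H.least) H.f_right H.g_right).1 H
  | right_liquid H =>
    exact evolvesOn_window_reflect.1 ((reflectionCase_iff hS.reflect h.reflect H.least
      (hw.reflect.add_mem hS.reflect H.least) H.g_right).1 H)
  | right_freezing H =>
    exact evolvesOn_window_reflect.1 ((endpointFreezingCase_iff hS.reflect h.reflect H.least
      (hw.reflect.add_mem hS.reflect H.least) H.f_right H.g_right).1 H)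

theorem EvolvesOn.left_cases (hS : IsSpace S) (h : RegularData S f g) (hw : IsWindow S f g z ε)
    (hz : IsLeast S z) (H : EvolvesOn S f g (window S z ε) V W) :
    ReflectionCase S f g z ε V W ∨ EndpointFreezingCase S f g z ε V W := by
  have hε := hw.pos
  have hzε := hw.add_mem hS hz
  have e : Icc z (z + ε) ∩ S = Icc z (z + ε) := inter_eq_left.2 (hS.Icc_subset hz.1 hzε)
  have m1 : z ∈ Icc z (z + ε) := ⟨le_rfl, by linarith⟩
  have m2 : z + ε ∈ Icc z (z + ε) := ⟨by linarith, le_rfl⟩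
  have hf := hw.f_right
  have hg := hw.g_right
  rw [e] at hf hg
  rcases hg with hg | hg
  · rcases hf with hf | hf
    · exact Or.inr ((endpointFreezingCase_iff hS h hz hzε hf hg).2 H)
    · have h1 := hf m1 m2 (by linarith)
      have h2 := hg m1 m2 (by linarith)
      linarith [h.le _ hzε, h.eq_left z hz]
  · exact Or.inl ((reflectionCase_iff hS h hz hzε hg).2 H)

theorem StrictMonoOn.Icc_union {F : ℝ → ℝ} {a b c : ℝ} (hab : a ≤ b) (hbc : b ≤ c)
    (h₁ : StrictMonoOn F (Icc a b)) (h₂ : StrictMonoOn F (Icc b c)) :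
    StrictMonoOn F (Icc a c) := by
  have := h₁.union h₂ (isGreatest_Icc hab) (isLeast_Icc hbc)
  rwa [Icc_union_Icc_eq_Icc hab hbc] at this

theorem StrictAntiOn.Icc_union {F : ℝ → ℝ} {a b c : ℝ} (hab : a ≤ b) (hbc : b ≤ c)
    (h₁ : StrictAntiOn F (Icc a b)) (h₂ : StrictAntiOn F (Icc b c)) :
    StrictAntiOn F (Icc a c) := by
  have := h₁.union h₂ (isGreatest_Icc hab) (isLeast_Icc hbc)
  rwa [Icc_union_Icc_eq_Icc hab hbc] at this

/-- The explicit formulas agree with the local construction. -/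
theorem EvolvesOn.localConstruction (hS : IsSpace S) (h : RegularData S f g)
    (hw : IsWindow S f g z ε) (H : EvolvesOn S f g (window S z ε) V W) :
    LocalConstruction S f g z ε V W := by
  have hε := hw.pos
  rcases hw.subset with hsub | ⟨hz, -⟩ | ⟨hz, -⟩
  · have hl : Icc (z - ε) z ∩ S = Icc (z - ε) z :=
      inter_eq_left.2 fun y hy => hsub ⟨hy.1, by linarith [hy.2]⟩
    have hr : Icc z (z + ε) ∩ S = Icc z (z + ε) :=
      inter_eq_left.2 fun y hy => hsub ⟨by linarith [hy.1], hy.2⟩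
    have hlr : Icc (z - ε) (z + ε) ∩ S = Icc (z - ε) (z + ε) := inter_eq_left.2 hsub
    have hfl := hw.f_left
    have hfr := hw.f_right
    have hgl := hw.g_left
    have hgr := hw.g_right
    have hsep := hw.sep
    rw [hl] at hfl hgl
    rw [hr] at hfr hgr
    rw [hlr] at hsep
    have l1 : z - ε ∈ Icc (z - ε) z := ⟨le_rfl, by linarith⟩
    have l2 : z ∈ Icc (z - ε) z := ⟨by linarith, le_rfl⟩
    have r1 : z ∈ Icc z (z + ε) := ⟨le_rfl, by linarith⟩
    have r2 : z + ε ∈ Icc z (z + ε) := ⟨by linarith, le_rfl⟩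
    have hlo := h.le _ (hsub ⟨le_rfl, by linarith⟩)
    have hhi := h.le _ (hsub ⟨by linarith, le_rfl⟩)
    rcases hsep with hsep | meet
    · exact .separated hsub hsep
        ((liquidFormula_iff hS h hε hsub fun a ha b hb _ => hsep a ha b hb).2 H)
    -- Each monotonicity pattern is a case of the construction, except that `f` decreasing with `g`
    -- increasing on the right, or `f` increasing with `g` decreasing on the left, contradicts g ≤
    -- f.
    rcases hfr with hfr | hfr
    · rcases hgr with hgr | hgr
      · rcases hfl with hfl | hfl
        · rcases hgl with hgl | hgl
          · have hf := hfl.Icc_union (by linarith) (by linarith) hfr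
            have hg := hgl.Icc_union (by linarith) (by linarith) hgr
            refine .increasing hsub meet hf hg ((freezingFormula_iff hS h ?_).2 H)
            rintro p ⟨h1, h2, h3, h4⟩
            have hs : S ∩ Icc (p.1 - p.2) (p.1 + p.2) ⊆ Icc (z - ε) (z + ε) := fun y hy =>
              ⟨by linarith [hy.2.1], by linarith [hy.2.2]⟩
            exact ⟨h2, h1, hf.mono hs, hg.mono hs, z + ε, hsub ⟨by linarith, le_rfl⟩, by linarith⟩
          · linarith [hfl l1 l2 (by linarith), hgl l1 l2 (by linarith)]
        · have d : ThawData (reflectSet S) (reflectData g) (reflectData f) (-z) ε := by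
            have e1 : Icc (-z - ε) (-z) = reflectSet (Icc z (z + ε)) := by
              rw [reflectSet_Icc]; congr 1; ring
            have e2 : Icc (-z) (-z + ε) = reflectSet (Icc (z - ε) z) := by
              rw [reflectSet_Icc]; congr 1; ring
            refine ⟨hε, fun u hu => hsub ⟨by linarith [hu.2], by linarith [hu.1]⟩,
              by simp [reflectData, meet], ?_, ?_, ?_⟩
            · rw [e1, strictMonoOn_reflectData]; exact hgr
            · rw [e1, strictMonoOn_reflectData]; exact hfr
            · rw [e2, strictAntiOn_reflectData]; exact hfl
          exact .thaw_left hsub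
            (EvolvesOn.thawingCase hS.reflect h.reflect d (evolvesOn_window_reflect.2 H))
      · rcases hgl with hgl | hgl
        · rcases hfl with hfl | hfl
          · exact .thaw_right hsub (H.thawingCase hS h ⟨hε, hsub, meet, hfl, hgl, hgr⟩)
          · refine .valley_peak hsub meet hfl hfr hgl hgr
              ((liquidFormula_iff hS h hε hsub fun a ha b hb _ => ?_).2 H)
            have h1 : f z ≤ f a := by
              rcases le_total a z with h1 | h1
              · exact hfl.antitoneOn ⟨ha.1, h1⟩ l2 h1
              · exact hfr.monotoneOn r1 ⟨h1, ha.2⟩ h1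
            have h2 : g b ≤ g z := by
              rcases le_total b z with h1 | h1
              · exact hgl.monotoneOn ⟨hb.1, h1⟩ l2 h1
              · exact hgr.antitoneOn r1 ⟨h1, hb.2⟩ h1
            linarith
        · have hg := hgl.Icc_union (by linarith) (by linarith) hgr
          exact .decreasing_w hsub meet hg ((liquidFormula_iff hS h hε hsub fun a ha b hb hab =>
            (hg.antitoneOn ha hb hab).trans (h.le a (hsub ha))).2 H)
    · rcases hgr with hgr | hgr
      · linarith [hfr r1 r2 (by linarith), hgr r1 r2 (by linarith)]
      · rcases hfl with hfl | hfl
        · rcases hgl with hgl | hgl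
          · exact .thaw_right hsub (H.thawingCase hS h ⟨hε, hsub, meet, hfl, hgl, hgr⟩)
          · linarith [hfl l1 l2 (by linarith), hgl l1 l2 (by linarith)]
        · have hf := hfl.Icc_union (by linarith) (by linarith) hfr
          exact .decreasing_v hsub meet hf ((liquidFormula_iff hS h hε hsub fun a ha b hb hab =>
            (h.le b (hsub hb)).trans (hf.antitoneOn ha hb hab)).2 H)
  · exact (H.left_cases hS h hw hz).elim .left_liquid .left_freezing
  · exact (EvolvesOn.left_cases hS.reflect h.reflect hw.reflect
      (isLeast_reflectSet.2 (by simpa using hz)) (evolvesOn_window_reflect.2 H)).elim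
      .right_liquid .right_freezing

/-- Every point has a window. -/
theorem RegularData.exists_isWindow (hS : IsSpace S) (h : RegularData S f g) (hz : z ∈ S) :
    ∃ ε, IsWindow S f g z ε := by
  obtain ⟨ε₁, p₁, h₁⟩ := h.f_left z hz
  obtain ⟨ε₂, p₂, h₂⟩ := h.f_right z hz
  obtain ⟨ε₃, p₃, h₃⟩ := h.g_left z hz
  obtain ⟨ε₄, p₄, h₄⟩ := h.g_right z hz
  obtain ⟨ε₅, p₅, h₅⟩ : ∃ ε > 0, ∀ δ, 0 < δ → δ ≤ ε → Icc (z - δ) (z + δ) ⊆ S ∨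
      (IsLeast S z ∧ z + δ ∈ S) ∨ (IsGreatest S z ∧ z - δ ∈ S) := by
    by_cases hl : IsLeast S z
    · obtain ⟨a, ha, hza⟩ := exists_gt_of_not_isGreatest hz
        fun hg => hS.not_isLeast_isGreatest hl hg
      exact ⟨a - z, by linarith, fun δ h0 hδ => Or.inr (Or.inl
        ⟨hl, hS.Icc_subset hz ha ⟨by linarith, by linarith⟩⟩)⟩
    · obtain ⟨a, ha, hza⟩ := exists_lt_of_not_isLeast hz hl
      by_cases hg : IsGreatest S z
      · exact ⟨z - a, by linarith, fun δ h0 hδ => Or.inr (Or.inr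
          ⟨hg, hS.Icc_subset ha hz ⟨by linarith, by linarith⟩⟩)⟩
      · obtain ⟨a', ha', hza'⟩ := exists_gt_of_not_isGreatest hz hg
        refine ⟨min (z - a) (a' - z), lt_min (by linarith) (by linarith), fun δ h0 hδ => Or.inl ?_⟩
        have := hδ.trans (min_le_left _ _)
        have := hδ.trans (min_le_right _ _)
        exact fun y hy => hS.Icc_subset ha ha' ⟨by linarith [hy.1], by linarith [hy.2]⟩
  obtain ⟨ε₆, p₆, h₆⟩ : ∃ ε > 0, (∀ x ∈ S, |x - z| < ε → ∀ y ∈ S, |y - z| < ε → g y ≤ f x) ∨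
      f z = g z := by
    rcases eq_or_lt_of_le (h.le z hz) with e | e
    · exact ⟨1, one_pos, Or.inr e.symm⟩
    · obtain ⟨δ, hδ, h7⟩ := exists_forall_lt h.cont_f hz (b := (f z + g z) / 2) (by linarith)
      obtain ⟨δ', hδ', h8⟩ := exists_forall_gt h.cont_g hz (b := (f z + g z) / 2) (by linarith)
      refine ⟨min δ δ', lt_min hδ hδ', Or.inl fun x hx hxz y hy hyz => ?_⟩
      exact ((h8 y hy (hyz.trans_le (min_le_right _ _))).trans
        (h7 x hx (hxz.trans_le (min_le_left _ _)))).le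
  obtain ⟨ε, h0, hε⟩ : ∃ ε > 0, ε ≤ ε₁ ∧ ε ≤ ε₂ ∧ ε ≤ ε₃ ∧ ε ≤ ε₄ ∧ ε ≤ ε₅ ∧ ε < ε₆ := by
    have h0 : 0 < min (min (min ε₁ ε₂) (min ε₃ ε₄)) (min ε₅ (ε₆ / 2)) := by
      have := half_pos p₆
      simp only [lt_min_iff]; tauto
    refine ⟨_, h0, ?_⟩
    set ε := min (min (min ε₁ ε₂) (min ε₃ ε₄)) (min ε₅ (ε₆ / 2)) with hε
    have := le_of_eq hε
    simp only [le_min_iff] at this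
    obtain ⟨⟨⟨a, b⟩, c, d⟩, e, i⟩ := this
    exact ⟨a, b, c, d, e, by linarith⟩
  obtain ⟨i1, i2, i3, i4, i5, i6⟩ := hε
  refine ⟨ε, h0, h₅ ε h0 i5, h₁.mono ?_, h₂.mono ?_, h₃.mono ?_, h₄.mono ?_, ?_⟩
  · exact inter_subset_inter_left _ (Icc_subset_Icc (by linarith) le_rfl)
  · exact inter_subset_inter_left _ (Icc_subset_Icc le_rfl (by linarith))
  · exact inter_subset_inter_left _ (Icc_subset_Icc (by linarith) le_rfl)
  · exact inter_subset_inter_left _ (Icc_subset_Icc le_rfl (by linarith))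
  · refine h₆.imp_left fun h7 x hx y hy => h7 x hx.2 ?_ y hy.2 ?_
    · rw [abs_lt]; constructor <;> linarith [hx.1.1, hx.1.2]
    · rw [abs_lt]; constructor <;> linarith [hy.1.1, hy.1.2]

end construction

/-! ### Order and joint continuity of the explicit solution. -/

section continuity

variable {S : Set ℝ} {f g : ℝ → ℝ} {V W : ℝ → ℝ → ℝ} {a b b' c x y z t s : ℝ}

/-! ### Levels between which no charge is gained -/

theorem totalCharge_gain (hS : IsSpace S) (h : RegularData S f g) {p q : ℝ} (hb : b ≤ b')
    (hcp : c ≤ p) (hpq : p ≤ q) (hqy : q ≤ y)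
    (H : ∀ z ∈ Ioo p q, charge S f g b z + 1 ≤ charge S f g b' z) :
    totalCharge S f g b c y + (q - p) ≤ totalCharge S f g b' c y := by
  have h1 : totalCharge S f g b p q + (q - p) ≤ totalCharge S f g b' p q := by
    have := intervalIntegral.integral_mono_on_of_le_Ioo hpq
      ((intervalIntegrable_charge hS h b p q).add (_root_.intervalIntegrable_const (c := (1 : ℝ))))
      (intervalIntegrable_charge hS h b' p q) H
    rw [intervalIntegral.integral_add (intervalIntegrable_charge hS h b p q)
      _root_.intervalIntegrable_const] at this
    simpa [totalCharge] using this
  rw [← totalCharge_add hS h b c p y, ← totalCharge_add hS h b p q y,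
    ← totalCharge_add hS h b' c p y, ← totalCharge_add hS h b' p q y]
  linarith [totalCharge_mono hS h hb hcp, totalCharge_mono hS h hb hqy]

/-- A continuous `u` passing from values ≤ b to values > b stays strictly between b and b' on an
interval of positive length. There the charge grows by one between the two levels, so the total
charge would grow too. -/
theorem no_passage (hS : IsSpace S) (h : RegularData S f g) {u : ℝ → ℝ} (hu : ContinuousOn u S)
    (hb : b < b') (hT : totalCharge S f g b' c y ≤ totalCharge S f g b c y)
    (H : ∀ z ∈ S, b < u z → u z < b' → charge S f g b z + 1 ≤ charge S f g b' z)
    {z₀ z₁ : ℝ} (h₀ : z₀ ∈ S ∩ Icc c y) (h₁ : z₁ ∈ S ∩ Icc c y) (e₀ : u z₀ ≤ b) : u z₁ ≤ b := by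
  by_contra! e₁
  have hsub : uIcc z₀ z₁ ⊆ S ∩ Icc c y :=
    (hS.ordConnected.inter ordConnected_Icc).uIcc_subset h₀ h₁
  -- A value strictly between b and b' that `u` must take between `z₀` and `z₁`.
  set m := (b + min b' (u z₁)) / 2 with hm
  have hm1 : b < min b' (u z₁) := lt_min hb e₁
  have hm2 := min_le_left b' (u z₁)
  have hm3 := min_le_right b' (u z₁)
  obtain ⟨w, hw, huw⟩ := intermediate_value_uIcc (hu.mono fun z hz => (hsub hz).1)
    (show m ∈ uIcc (u z₀) (u z₁) from Icc_subset_uIcc ⟨by linarith, by linarith⟩)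
  obtain ⟨hwS, hwc⟩ := hsub hw
  obtain ⟨δ, p0, hδ⟩ := exists_forall_lt hu hwS (b := b) (by rw [huw]; linarith)
  obtain ⟨δ', p0', hδ'⟩ := exists_forall_gt hu hwS (b := b') (by rw [huw]; linarith)
  have key : ∀ p q, c ≤ p → p < q → q ≤ y → Icc p q ⊆ S → w - min δ δ' ≤ p → q ≤ w + min δ δ' →
      False := by
    intro p q h1 h2 h3 h4 h5 h6
    have hδ1 := min_le_left δ δ'
    have hδ2 := min_le_right δ δ'
    have := totalCharge_gain hS h hb.le h1 h2.le h3 fun z hz => by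
      have hzS := h4 ⟨hz.1.le, hz.2.le⟩
      exact H z hzS (hδ z hzS (by rw [abs_lt]; constructor <;> linarith [hz.1, hz.2]))
        (hδ' z hzS (by rw [abs_lt]; constructor <;> linarith [hz.1, hz.2]))
    linarith
  have hmin : 0 < min δ δ' := lt_min p0 p0'
  rcases lt_trichotomy w z₁ with h1 | h1 | h1
  · refine key w (min z₁ (w + min δ δ')) hwc.1 (lt_min h1 (by linarith))
      ((min_le_left _ _).trans h₁.2.2) (fun z hz => ?_) (by linarith) (min_le_right _ _)
    exact hS.Icc_subset hwS h₁.1 ⟨hz.1, hz.2.trans (min_le_left _ _)⟩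
  · rw [h1] at huw
    linarith
  · refine key (max z₁ (w - min δ δ')) w (h₁.2.1.trans (le_max_left _ _)) (max_lt h1 (by linarith))
      hwc.2 (fun z hz => ?_) (le_max_right _ _) (by linarith)
    exact hS.Icc_subset h₁.1 hwS ⟨(le_max_left _ _).trans hz.1, hz.2⟩

/-- If the total charge up to `y` is not positive at some level above `b`, then `f` stays below
`b` up to `y`. -/
theorem lowV.le_of_totalCharge_nonpos (hS : IsSpace S) (h : RegularData S f g) (hx : x ∈ S)
    (hl : ¬ IsLeast S x) (hlow : lowV S f g b x t) (hb : b < b') (hy : y ∈ Icc (x - t) (x + t))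
    (hq : totalCharge S f g b' (x - t) y ≤ 0) : ∀ z ∈ S, z ∈ Icc (x - t) y → f z ≤ b := by
  intro z₁ hz₁ hz₁'
  by_contra! hf₁
  have h0 := hlow.2 y hy
  -- Survival at level b makes the charge nonnegative there, so nothing is gained between the two
  -- levels and `no_passage` applies.
  have hT : totalCharge S f g b' (x - t) y ≤ totalCharge S f g b (x - t) y := by linarith
  have passf : ∀ z ∈ S, z ∈ Icc (x - t) y → b < f z := by
    intro z hz hz'
    by_contra! hfz
    exact absurd (no_passage hS h h.cont_f hb hT (fun z hz h1 h2 =>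
      charge_add_one_le hb.le hz (Or.inl ⟨h1, h2.le⟩)) ⟨hz, hz'⟩ ⟨hz₁, hz₁'⟩ hfz) (not_le.2 hf₁)
  have hxt : x - t ≤ x := by linarith [hy.1, hy.2]
  rcases hS.lt_or_exists_isLeast hx hxt with ⟨h1, e, he, he'⟩ | ⟨a, ha, hca⟩
  · exact notMem_rightSet_of_gt he he' (fun h2 => passf _ h2 ⟨le_rfl, hy.1⟩) hlow.1
  have hay : a ≤ y := (ha.2 hz₁).trans hz₁'.2
  have hax : a < x := lt_of_le_of_ne (ha.2 hx) fun e => hl (e ▸ ha)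
  -- At the endpoint the data agree, which transfers the bound from `f` to `g`; `no_passage` then
  -- spreads it over the part of the window in `S`.
  have hga : b < g a := by rw [← h.eq_left a ha]; exact passf a ha.1 ⟨hca, hay⟩
  have passg : ∀ z ∈ S, z ∈ Icc (x - t) y → b < g z := by
    intro z hz hz'
    by_contra! hgz
    exact absurd (no_passage hS h h.cont_g hb hT (fun z hz h1 h2 =>
      charge_add_one_le hb.le hz (Or.inr ⟨h1.le, h2⟩)) ⟨hz, hz'⟩ ⟨ha.1, hca, hay⟩ hgz)
      (not_le.2 hga)
  have neg : ∀ p q, a ≤ p → p ≤ q → (∀ z ∈ S, z ∈ Ioo p q → b < g z) →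
      totalCharge S f g b p q ≤ -(q - p) := fun p q h1 h2 h3 =>
    totalCharge_le_neg hS h h2 fun z hz => by
      have haz : a < z := h1.trans_lt hz.1
      exact ⟨mem_leftSet_of_gt hS ha.1 haz fun hzS => (h3 z hzS hz).le,
        notMem_rightSet_of_gt ha.1 haz fun hzS => (h3 z hzS hz).trans_le (h.le z hzS)⟩
  have h1 := neg a y le_rfl hay fun z hz hz' => passg z hz ⟨hca.trans hz'.1.le, hz'.2.le⟩
  have h2 := totalCharge_le (S := S) (f := f) (g := g) (b := b) hca
  have h3 := totalCharge_add hS h b (x - t) a y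
  -- The charge up to y is exactly 0. As a < x, the window extends beyond y, and just beyond y there
  -- are only particles of speed -1, so the charge becomes negative.
  obtain ⟨δ, hδ0, hδ⟩ : ∃ δ > 0, ∀ z ∈ S, y < z → z < y + δ → b < g z := by
    by_cases hyS : y ∈ S
    · obtain ⟨δ, p0, hδ⟩ := exists_forall_lt h.cont_g hyS (passg y hyS ⟨hy.1, le_rfl⟩)
      exact ⟨δ, p0, fun z hz h4 h5 => hδ z hz (by rw [abs_lt]; constructor <;> linarith)⟩
    · exact ⟨1, one_pos, fun z hz h4 _ => absurd (hS.Icc_subset ha.1 hz ⟨hay, h4.le⟩) hyS⟩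
  have hyx : y < x + t := by linarith
  set y₂ := min (y + δ) (x + t) with hy₂
  have hy1 : y < y₂ := lt_min (by linarith) hyx
  have h4 := neg y y₂ hay hy1.le fun z hz hz' =>
    hδ z hz hz'.1 (hz'.2.trans_le (min_le_left _ _))
  have h5 := hlow.2 y₂ ⟨hy.1.trans hy1.le, min_le_right _ _⟩
  rw [← totalCharge_add hS h b (x - t) y y₂] at h5
  have h6 := totalCharge_mono hS h hb.le hy.1
  linarith

theorem highW.le_of_totalCharge_nonneg (hS : IsSpace S) (h : RegularData S f g) (hx : x ∈ S)
    (hl : ¬ IsGreatest S x) (hhigh : highW S f g b x t) (hb : b' < b)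
    (hy : y ∈ Icc (x - t) (x + t)) (hq : 0 ≤ totalCharge S f g b' y (x + t)) :
    ∀ z ∈ S, z ∈ Icc y (x + t) → b ≤ g z := by
  intro z hz hz'
  have h1 : lowV (reflectSet S) (reflectData g) (reflectData f) (-b) (-x) t := by
    rw [lowV_reflect]; simpa using hhigh
  have h2 := h1.le_of_totalCharge_nonpos hS.reflect h.reflect (by simpa using hx)
    (by rw [isLeast_reflectSet]; simpa using hl) (neg_lt_neg hb) (y := -y)
    ⟨by linarith [hy.2], by linarith [hy.1]⟩ (by
      rw [totalCharge_reflect, show -(-x - t) = x + t by ring]; simpa using hq)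
    (-z) (by simpa using hz) ⟨by linarith [hz'.2], by linarith [hz'.1]⟩
  simp only [reflectData, neg_neg] at h2
  linarith

/-- If f' x < g' x, each of the two surviving particles supplies the sign of the window's charge
that the other needs. Then f ≤ f' x and g ≥ g' x on the whole window, against g ≤ f at x. -/
theorem Evolves.le (hS : IsSpace S) (h : RegularData S f g) (ht : 0 ≤ t) {f' g' : ℝ → ℝ}
    (he : Evolves S f g t f' g') : ∀ x ∈ S, g' x ≤ f' x := by
  intro x hx
  obtain ⟨h1, h2, h3⟩ := he x hx
  by_cases hl : IsLeast S x
  · exact (h3 (Or.inl hl)).ge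
  by_cases hg : IsGreatest S x
  · exact (h3 (Or.inr hg)).ge
  by_contra! hlt
  have hlow := (h1 hl _).1 le_rfl
  have hhigh := (h2 hg _).1 le_rfl
  have e1 := hlow.le_of_totalCharge_nonpos hS h hx hl hlt ⟨by linarith, le_rfl⟩
    (hhigh.2 _ ⟨le_rfl, by linarith⟩) x hx ⟨by linarith, by linarith⟩
  have e2 := hhigh.le_of_totalCharge_nonneg hS h hx hg hlt ⟨le_rfl, by linarith⟩
    (hlow.2 _ ⟨by linarith, le_rfl⟩) x hx ⟨by linarith, by linarith⟩
  linarith [h.le x hx]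

/-! ### Continuity -/

/-- Writing the points of the window as x + ρt lets ρ range over a compact set independent of (x,
t). -/
theorem lowV_iff_ratio (ht : 0 ≤ t) : lowV S f g b x t ↔ x - t ∈ rightSet S f b ∧
    ∀ ρ ∈ Icc (-1 : ℝ) 1, 0 ≤ totalCharge S f g b (x - t) (x + ρ * t) := by
  refine and_congr Iff.rfl ⟨fun h ρ hρ => ?_, fun h y hy => ?_⟩
  · exact h _ ⟨by nlinarith [hρ.1], by nlinarith [hρ.2]⟩
  · rcases eq_or_lt_of_le ht with h0 | h0
    · subst h0
      have := h 0 ⟨by norm_num, by norm_num⟩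
      rwa [show x + 0 * 0 = y by linarith [hy.1, hy.2]] at this
    · have := h ((y - x) / t) ⟨by rw [le_div_iff₀ h0]; linarith [hy.1],
        by rw [div_le_iff₀ h0]; linarith [hy.2]⟩
      rwa [div_mul_cancel₀ _ h0.ne', show x + (y - x) = y by ring] at this

theorem totalCharge_eq_sub (hS : IsSpace S) (h : RegularData S f g) (b x y : ℝ) :
    totalCharge S f g b x y = totalCharge S f g b 0 y - totalCharge S f g b 0 x := by
  rw [← totalCharge_add hS h b 0 x y]; ring

/-- This is the lower semicontinuity of the first component. -/
theorem isClosed_lowV (hS : IsSpace S) (h : RegularData S f g) (b : ℝ) :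
    IsClosed {p : ℝ × ℝ | 0 ≤ p.2 ∧ lowV S f g b p.1 p.2} := by
  have e : {p : ℝ × ℝ | 0 ≤ p.2 ∧ lowV S f g b p.1 p.2} =
      {p : ℝ × ℝ | 0 ≤ p.2} ∩ ((fun p : ℝ × ℝ => p.1 - p.2) ⁻¹' rightSet S f b ∩
        ⋂ ρ ∈ Icc (-1 : ℝ) 1, {p : ℝ × ℝ | totalCharge S f g b 0 (p.1 - p.2) ≤
          totalCharge S f g b 0 (p.1 + ρ * p.2)}) := by
    ext p
    simp only [mem_ofPred_eq, mem_inter_iff, mem_preimage, mem_iInter]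
    refine and_congr_right fun hp => ?_
    rw [lowV_iff_ratio hp]
    refine and_congr Iff.rfl (forall₂_congr fun ρ _ => ?_)
    rw [totalCharge_eq_sub hS h, sub_nonneg]
  have hH := continuous_totalCharge hS h b 0
  rw [e]
  refine (isClosed_le continuous_const continuous_snd).inter
    (((isClosed_rightSet hS h.cont_f b).preimage (by fun_prop)).inter
      (isClosed_biInter fun ρ _ => isClosed_le ?_ ?_))
  · exact hH.comp (by fun_prop)
  · exact hH.comp (by fun_prop)

theorem mem_rightSet_of_le (hS : IsSpace S) {e : ℝ} (he : e ∈ S) (hz : z ≤ e)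
    (h : z ∈ S → f z ≤ b) : z ∈ rightSet S f b := by
  rcases eq_or_lt_of_le hz with rfl | hz
  · exact Or.inl ⟨he, h he⟩
  · exact mem_rightSet_of_lt hS he hz h

/-- A criterion for `lowV` to hold near a point. -/
theorem eventually_lowV (hS : IsSpace S) (h : RegularData S f g)
    (h₀ : x - t ∈ S → f (x - t) < b)
    (H : ∀ ρ ∈ Icc (-1 : ℝ) 1, totalCharge S f g b (x - t) (x + ρ * t) ≤ 0 →
      ∀ z ∈ S, z ∈ Icc (x - t) (x + ρ * t) → f z < b) :
    ∀ᶠ p : ℝ × ℝ in 𝓝 (x, t), p.1 ∈ S → 0 ≤ p.2 → lowV S f g b p.1 p.2 := by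
  set C : Set ℝ := {z | z ∈ S ∧ b ≤ f z} with hC
  have hCc : IsClosed C := h.cont_f.preimage_isClosed_of_isClosed hS.isClosed isClosed_Ici
  have hCn : ∀ z, z ∉ C ↔ (z ∈ S → f z < b) := fun z =>
    ⟨fun h hs => not_le.1 fun h' => h ⟨hs, h'⟩, fun h h' => absurd (h h'.1) (not_lt.2 h'.2)⟩
  have hH := continuous_totalCharge hS h b 0
  have h1 : ∀ᶠ p : ℝ × ℝ in 𝓝 (x, t), p.1 - p.2 ∉ C := by
    have hc : ContinuousAt (fun p : ℝ × ℝ => p.1 - p.2) (x, t) := by fun_prop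
    exact hc.eventually (hCc.isOpen_compl.mem_nhds ((hCn _).2 h₀))
  have h2 : ∀ᶠ p : ℝ × ℝ in 𝓝 (x, t), ∀ ρ ∈ Icc (-1 : ℝ) 1, p.1 ∈ S → 0 ≤ p.2 →
      ρ ∈ Icc (-1 : ℝ) 1 → 0 ≤ totalCharge S f g b (p.1 - p.2) (p.1 + ρ * p.2) := by
    refine isCompact_Icc.eventually_forall_of_forall_eventually fun ρ hρ => ?_
    have hc₁ : ContinuousAt (fun q : (ℝ × ℝ) × ℝ => q.1.1 - q.1.2) ((x, t), ρ) := by fun_prop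
    have hc₂ : ContinuousAt (fun q : (ℝ × ℝ) × ℝ => q.1.1 + q.2 * q.1.2) ((x, t), ρ) := by
      fun_prop
    -- Positive charge stays positive nearby. If the charge is not positive, then by `H` the data
    -- are below b on the segment, hence on a slightly larger one, and `totalCharge_nonneg_of_lt`
    -- applies.
    rcases lt_or_ge 0 (totalCharge S f g b (x - t) (x + ρ * t)) with h3 | h3
    · have hc : ContinuousAt (fun q : (ℝ × ℝ) × ℝ =>
          totalCharge S f g b (q.1.1 - q.1.2) (q.1.1 + q.2 * q.1.2)) ((x, t), ρ) := by
        refine ContinuousAt.congr ?_ (Eventually.of_forall fun q =>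
          (totalCharge_eq_sub hS h b (q.1.1 - q.1.2) (q.1.1 + q.2 * q.1.2)).symm)
        exact (ContinuousAt.comp (f := fun q : (ℝ × ℝ) × ℝ => q.1.1 + q.2 * q.1.2)
          hH.continuousAt hc₂).sub (ContinuousAt.comp
            (f := fun q : (ℝ × ℝ) × ℝ => q.1.1 - q.1.2) hH.continuousAt hc₁)
      filter_upwards [hc.eventually (eventually_gt_nhds h3)] with q hq _ _ _
      exact hq.le
    · have hlt := H ρ hρ h3
      by_cases hle : x - t ≤ x + ρ * t
      · have n1 : x - t ∉ C := (hCn _).2 fun hs => hlt _ hs ⟨le_rfl, hle⟩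
        have n2 : x + ρ * t ∉ C := (hCn _).2 fun hs => hlt _ hs ⟨hle, le_rfl⟩
        obtain ⟨δ₁, p₁, hδ₁⟩ := Metric.isOpen_iff.1 hCc.isOpen_compl _ n1
        obtain ⟨δ₂, p₂, hδ₂⟩ := Metric.isOpen_iff.1 hCc.isOpen_compl _ n2
        filter_upwards [hc₁.eventually (eventually_gt_nhds (show x - t - δ₁ < x - t from sub_lt_self _ p₁)),
          hc₂.eventually (eventually_lt_nhds (show x + ρ * t < x + ρ * t + δ₂ from lt_add_of_pos_right _ p₂))]
          with q hq1 hq2 hqS hq0 hqρ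
        refine totalCharge_nonneg_of_lt hS h hqS
          ⟨by nlinarith [hqρ.1], by nlinarith [hqρ.2]⟩ fun z hz hz' => ?_
        rcases lt_or_ge z (x - t) with h5 | h5
        · refine (hCn z).1 (hδ₁ ?_) hz
          rw [Metric.mem_ball, Real.dist_eq, abs_lt]
          constructor <;> linarith [hz'.1]
        rcases le_or_gt z (x + ρ * t) with h6 | h6
        · exact hlt z hz ⟨h5, h6⟩
        · refine (hCn z).1 (hδ₂ ?_) hz
          rw [Metric.mem_ball, Real.dist_eq, abs_lt]
          constructor <;> linarith [hz'.2]
      -- As ρ ≥ -1, this order of the two points is incompatible with nonnegative times.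
      · have hlt' : x + ρ * t < x - t := not_le.1 hle
        have : ∀ᶠ q : (ℝ × ℝ) × ℝ in 𝓝 ((x, t), ρ), q.1.1 + q.2 * q.1.2 < q.1.1 - q.1.2 :=
          hc₂.eventually_lt hc₁ hlt'
        filter_upwards [this] with q hq _ hq0 hqρ
        nlinarith [hqρ.1]
  filter_upwards [h1, h2] with p hp1 hp2 hpS hp0
  rw [lowV_iff_ratio hp0]
  exact ⟨mem_rightSet_of_le hS hpS (by linarith) fun hs => ((hCn _).1 hp1 hs).le,
    fun ρ hρ => hp2 ρ hρ hpS hp0 hρ⟩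

/-- This is the upper semicontinuity: `lowV.le_of_totalCharge_nonpos` supplies exactly the
hypothesis of `eventually_lowV`. -/
theorem lowV.eventually (hS : IsSpace S) (h : RegularData S f g) (hx : x ∈ S)
    (hl : ¬ IsLeast S x) (ht : 0 ≤ t) (hlow : lowV S f g b x t) (hb : b < b') :
    ∀ᶠ p : ℝ × ℝ in 𝓝 (x, t), p.1 ∈ S → 0 ≤ p.2 → lowV S f g b' p.1 p.2 := by
  refine eventually_lowV hS h (fun hs => ?_) fun ρ hρ hq z hz hz' => ?_
  · exact (hlow.le_of_totalCharge_nonpos hS h hx hl hb ⟨le_rfl, by linarith⟩ (by simp) _ hs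
      ⟨le_rfl, le_rfl⟩).trans_lt hb
  · exact (hlow.le_of_totalCharge_nonpos hS h hx hl hb ⟨by nlinarith [hρ.1], by nlinarith [hρ.2]⟩
      hq z hz hz').trans_lt hb

/-- At the left endpoint a the value of v is defined through w, so continuity there needs v bounded
near a by w at a. For t > 0, a nonpositive charge up to some y ≥ a must cancel the whole block [a -
t, a]. This forces y = a + t and g ≥ b' on (a, a + t], so the particle of speed -1 would survive at
level b. -/
theorem eventually_lowV_of_not_highW (hS : IsSpace S) (h : RegularData S f g) (ha : IsLeast S a)
    (ht : 0 ≤ t) (hhigh : ¬ highW S f g b a t) (hb : b < b') :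
    ∀ᶠ p : ℝ × ℝ in 𝓝 (a, t), p.1 ∈ S → 0 ≤ p.2 → lowV S f g b' p.1 p.2 := by
  have h0 : t = 0 → f a < b' := by
    rintro rfl
    by_contra! hfa
    refine hhigh ⟨Or.inl ⟨by simpa using ha.1, ?_⟩, fun y hy => ?_⟩
    · rw [add_zero, ← h.eq_left a ha]; linarith
    · rw [show y = a + 0 by linarith [hy.1, hy.2]]; simp
  refine eventually_lowV hS h (fun hs => ?_) fun ρ hρ hq z hz hz' => ?_
  · have ht0 : t = 0 := by linarith [ha.2 hs]
    rw [ht0, sub_zero]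
    exact h0 ht0
  · set y := a + ρ * t with hy
    have haz := ha.2 hz
    rcases eq_or_lt_of_le ht with h1 | h1
    · have hyz : z = a := le_antisymm (by rw [← h1, mul_zero, add_zero] at hy; linarith [hz'.2]) haz
      rw [hyz]; exact h0 h1.symm
    exfalso
    have hay : a ≤ y := haz.trans hz'.2
    have h2 : a - (a - t) ≤ totalCharge S f g b' (a - t) a :=
      sub_le_totalCharge hS h (by linarith) fun u hu => by
        have huS : u ∉ S := fun huS => absurd (ha.2 huS) (not_le.2 hu.2)
        exact ⟨mem_rightSet_of_lt hS ha.1 hu.2 fun h => absurd h huS,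
          notMem_leftSet_of_lt ha.1 hu.2 fun h => absurd h huS⟩
    rw [← totalCharge_add hS h b' (a - t) a y] at hq
    have h3 := le_totalCharge (S := S) (f := f) (g := g) (b := b') hay
    have hyt : y = a + t := le_antisymm (by nlinarith [hρ.2]) (by linarith)
    rw [hyt] at hq h3
    have hneg : totalCharge S f g b' a (a + t) ≤ -t := by linarith
    -- A point with g < b' would open a gap of positive length among the particles of speed -1, and
    -- the charge of [a, a + t] would exceed -t.
    have hg : ∀ u ∈ S, u ∈ Ioc a (a + t) → b' ≤ g u := by
      intro u hu hu'
      by_contra! hlt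
      obtain ⟨δ, p0, hδ⟩ := exists_forall_gt h.cont_g hu hlt
      set p := max a (u - δ) with hp
      have hp1 : p < u := max_lt hu'.1 (by linarith)
      have hp2 : a ≤ p := le_max_left _ _
      have hp3 : u - δ ≤ p := le_max_right _ _
      rw [← totalCharge_add hS h b' a p, ← totalCharge_add hS h b' p u] at hneg
      have e1 := le_totalCharge (S := S) (f := f) (g := g) (b := b') hp2
      have e2 := le_totalCharge (S := S) (f := f) (g := g) (b := b') hu'.2
      have e3 : 0 ≤ totalCharge S f g b' p u := totalCharge_nonneg hS h hp1.le fun v hv =>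
        notMem_leftSet_of_lt hu hv.2 fun hvS => hδ v hvS (by
          rw [abs_lt]; constructor <;> linarith [hv.1, hv.2])
      linarith
    refine hhigh ⟨mem_leftSet_of_gt hS ha.1 (by linarith) fun hs =>
      hb.le.trans (hg _ hs ⟨by linarith, le_rfl⟩), fun u hu => ?_⟩
    have hnp : ∀ p, a ≤ p → p ≤ a + t → totalCharge S f g b p (a + t) ≤ 0 := fun p h4 h5 =>
      totalCharge_nonpos hS h h5 fun v hv =>
        notMem_rightSet_of_gt ha.1 (h4.trans_lt hv.1) fun hvS =>
          (hb.trans_le (hg v hvS ⟨h4.trans_lt hv.1, hv.2.le⟩)).trans_le (h.le v hvS)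
    rcases le_total a u with h4 | h4
    · exact hnp u h4 hu.2
    · rw [← totalCharge_add hS h b u a (a + t)]
      linarith [totalCharge_le (S := S) (f := f) (g := g) (b := b) h4,
        totalCharge_mono hS h hb.le (show a ≤ a + t by linarith), hu.1]

/-- `V` and `W` are given by the explicit formulas at all nonnegative times. -/
def IsExplicit (S : Set ℝ) (f g : ℝ → ℝ) (V W : ℝ → ℝ → ℝ) : Prop :=
  ∀ t, 0 ≤ t → Evolves S f g t (fun x => V x t) (fun x => W x t)

theorem IsExplicit.reflect (hE : IsExplicit S f g V W) :
    IsExplicit (reflectSet S) (reflectData g) (reflectData f) (reflectSol W) (reflectSol V) :=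
  fun t ht => (hE t ht).reflect

theorem eventually_not_isLeast (hx : ¬ IsLeast S x) (hxS : x ∈ S) :
    ∀ᶠ p : ℝ × ℝ in 𝓝 (x, t), ¬ IsLeast S p.1 := by
  obtain ⟨e, he, hex⟩ := exists_lt_of_not_isLeast hxS hx
  have hc : ContinuousAt (fun p : ℝ × ℝ => p.1) (x, t) := by fun_prop
  filter_upwards [hc.eventually (eventually_gt_nhds hex)] with p hp hl
  exact absurd (hl.2 he) (not_le.2 hp)

theorem IsExplicit.continuousWithinAt_v (hS : IsSpace S) (h : RegularData S f g)
    (hE : IsExplicit S f g V W) (hx : x ∈ S) (hl : ¬ IsLeast S x) (ht : 0 ≤ t) :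
    ContinuousWithinAt (fun p : ℝ × ℝ => V p.1 p.2) (S ×ˢ Ici 0) (x, t) := by
  have hV := (hE t ht x hx).1 hl
  refine tendsto_order.2 ⟨fun c hc => ?_, fun c hc => ?_⟩
  · have h1 : (x, t) ∉ {p : ℝ × ℝ | 0 ≤ p.2 ∧ lowV S f g c p.1 p.2} := fun h' =>
      absurd ((hV c).2 h'.2) (not_le.2 hc)
    rw [eventually_nhdsWithin_iff]
    filter_upwards [(isClosed_lowV hS h c).isOpen_compl.mem_nhds h1, eventually_not_isLeast hl hx]
      with p hp hpl hpS
    by_contra! hle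
    exact hp ⟨hpS.2, ((hE p.2 hpS.2 p.1 hpS.1).1 hpl c).1 hle⟩
  · obtain ⟨c', h1, h2⟩ := exists_between hc
    rw [eventually_nhdsWithin_iff]
    filter_upwards [((hV _).1 le_rfl).eventually hS h hx hl ht h1, eventually_not_isLeast hl hx]
      with p hp hpl hpS
    exact (((hE p.2 hpS.2 p.1 hpS.1).1 hpl c').2 (hp hpS.1 hpS.2)).trans_lt h2

theorem reflectSol_reflectSol : reflectSol (reflectSol V) = V := by
  funext x t; simp [reflectSol]

theorem continuousWithinAt_reflectSol
    (hc : ContinuousWithinAt (fun p : ℝ × ℝ => V p.1 p.2) (S ×ˢ Ici 0) (x, t)) :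
    ContinuousWithinAt (fun p : ℝ × ℝ => reflectSol V p.1 p.2) (reflectSet S ×ˢ Ici 0) (-x, t) := by
  have hm : ContinuousWithinAt (fun p : ℝ × ℝ => (-p.1, p.2)) (reflectSet S ×ˢ Ici 0) (-x, t) :=
    Continuous.continuousWithinAt (by fun_prop)
  have := ContinuousWithinAt.comp (x := ((-x, t) : ℝ × ℝ)) (t := S ×ˢ Ici 0)
    (f := fun p : ℝ × ℝ => (-p.1, p.2)) (g := fun p : ℝ × ℝ => V p.1 p.2)
    (by simpa using hc) hm fun p hp => ⟨hp.1, hp.2⟩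
  exact this.neg

theorem IsExplicit.continuousWithinAt_w (hS : IsSpace S) (h : RegularData S f g)
    (hE : IsExplicit S f g V W) (hx : x ∈ S) (hl : ¬ IsGreatest S x) (ht : 0 ≤ t) :
    ContinuousWithinAt (fun p : ℝ × ℝ => W p.1 p.2) (S ×ˢ Ici 0) (x, t) := by
  have := continuousWithinAt_reflectSol (hE.reflect.continuousWithinAt_v hS.reflect h.reflect
    (x := -x) (by simpa using hx) (by rw [isLeast_reflectSet]; simpa using hl) ht)
  simpa [reflectSol_reflectSol] using this

theorem IsExplicit.continuousOn_v (hS : IsSpace S) (h : RegularData S f g)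
    (hE : IsExplicit S f g V W) :
    ContinuousOn (fun p : ℝ × ℝ => V p.1 p.2) (S ×ˢ Ici 0) := by
  rintro ⟨x, t⟩ ⟨hx, ht⟩
  simp only [mem_Ici] at hx ht
  by_cases hl : IsLeast S x
  swap
  · exact hE.continuousWithinAt_v hS h hx hl ht
  have hg : ¬ IsGreatest S x := fun hg => hS.not_isLeast_isGreatest hl hg
  have hW := tendsto_order.1 (hE.continuousWithinAt_w hS h hx hg ht)
  have hVW : V x t = W x t := (hE t ht x hx).2.2 (Or.inl hl)
  refine tendsto_order.2 ⟨fun c hc => ?_, fun c hc => ?_⟩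
  · simp only [hVW] at hc
    filter_upwards [hW.1 c hc, self_mem_nhdsWithin] with p hp hpS
    exact hp.trans_le ((hE p.2 hpS.2).le hS h hpS.2 p.1 hpS.1)
  · simp only [hVW] at hc
    obtain ⟨c₁, h1, h2⟩ := exists_between hc
    obtain ⟨c₂, h3, h4⟩ := exists_between h2
    have hn : ¬ highW S f g c₁ x t := fun h' =>
      absurd (((hE t ht x hx).2.1 hg c₁).2 h') (not_le.2 h1)
    have hev := eventually_nhdsWithin_of_eventually_nhds (s := S ×ˢ Ici 0)
      (eventually_lowV_of_not_highW hS h hl ht hn h3)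
    filter_upwards [hW.2 c hc, self_mem_nhdsWithin, hev] with p hp hpS hpl
    by_cases hlp : IsLeast S p.1
    · have : V p.1 p.2 = W p.1 p.2 := (hE p.2 hpS.2 p.1 hpS.1).2.2 (Or.inl hlp)
      rwa [this]
    · exact (((hE p.2 hpS.2 p.1 hpS.1).1 hlp c₂).2 (hpl hpS.1 hpS.2)).trans_lt h4

theorem IsExplicit.continuousOn_w (hS : IsSpace S) (h : RegularData S f g)
    (hE : IsExplicit S f g V W) :
    ContinuousOn (fun p : ℝ × ℝ => W p.1 p.2) (S ×ˢ Ici 0) := by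
  rintro ⟨x, t⟩ ⟨hx, ht⟩
  have := continuousWithinAt_reflectSol (hE.reflect.continuousOn_v hS.reflect h.reflect
    (-x, t) ⟨by simpa using hx, ht⟩)
  simpa [reflectSol_reflectSol] using this

end continuity

/-! ### The evolution preserves strict monotonicity on each side of a point. -/

section regularity

variable {S : Set ℝ} {f g : ℝ → ℝ} {V W : ℝ → ℝ → ℝ} {a b b' c d x y z t s : ℝ}

/-! ### Quasiconvex functions -/

/-- A quasiconvex function decreases before a minimum point and increases after it. If the minimum
over [z, u] is at z, the function increases there; otherwise it decreases up to the minimum point.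
Strictness comes from the absence of intervals of constancy. -/
theorem exists_strictMonotoneOn_right {F : ℝ → ℝ} {z w : ℝ} (hzw : z < w)
    (hF : ContinuousOn F (Icc z w))
    (hq : ∀ x y m, z < x → x < m → m < y → y < w → F m ≤ max (F x) (F y))
    (hn : ∀ c d, z < c → c < d → d < w → ∃ x ∈ Icc c d, F x ≠ F c) :
    ∃ ε > 0, z + ε ≤ w ∧ StrictMonotoneOn F (Icc z (z + ε)) := by
  obtain ⟨u, hzu, huw⟩ := exists_between hzw
  have hq' : ∀ x y m, z ≤ x → x ≤ m → m ≤ y → y ≤ u → F m ≤ max (F x) (F y) := by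
    intro x y m h1 h2 h3 h4
    rcases eq_or_lt_of_le h2 with rfl | h2
    · exact le_max_left _ _
    rcases eq_or_lt_of_le h3 with rfl | h3
    · exact le_max_right _ _
    rcases eq_or_lt_of_le h1 with rfl | h1
    · have hc : ContinuousWithinAt (fun x => max (F x) (F y)) (Ioo z m) z :=
        ((hF z ⟨le_rfl, hzw.le⟩).mono fun x hx => ⟨hx.1.le, by linarith [hx.2]⟩).max
          continuousWithinAt_const
      have : (𝓝[Ioo z m] z).NeBot := left_nhdsWithin_Ioo_neBot h2
      refine ge_of_tendsto hc ?_
      filter_upwards [self_mem_nhdsWithin] with x hx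
      exact hq x y m hx.1 hx.2 h3 (by linarith)
    · exact hq x y m h1 h2 h3 (by linarith)
  have hconst : ∀ x y, z ≤ x → x < y → y ≤ u → ¬ ∀ m ∈ Icc x y, F m = F x := by
    intro x y h1 h2 h3 hc
    obtain ⟨m, hm, hne⟩ := hn ((2 * x + y) / 3) ((x + 2 * y) / 3) (by linarith) (by linarith)
      (by linarith)
    apply hne
    rw [hc m ⟨by linarith [hm.1], by linarith [hm.2]⟩,
      hc ((2 * x + y) / 3) ⟨by linarith, by linarith⟩]
  obtain ⟨μ, hμ, hmin⟩ := isCompact_Icc.exists_isMinOn (nonempty_Icc.2 hzu.le)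
    (hF.mono (Icc_subset_Icc_right huw.le))
  rcases eq_or_lt_of_le hμ.1 with rfl | hzμ
  · refine ⟨u - z, by linarith, by linarith, Or.inl ?_⟩
    rw [add_sub_cancel]
    have hmono : ∀ x y, z ≤ x → x ≤ y → y ≤ u → F x ≤ F y := fun x y h1 h2 h3 => by
      have := hq' z y x le_rfl h1 h2 h3
      rwa [max_eq_right (hmin ⟨h1.trans h2, h3⟩)] at this
    intro x hx y hy hxy
    refine lt_of_le_of_ne (hmono x y hx.1 hxy.le hy.2) fun e => hconst x y hx.1 hxy hy.2 ?_
    intro m hm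
    exact le_antisymm (e ▸ hmono m y (hx.1.trans hm.1) hm.2 hy.2)
      (hmono x m hx.1 hm.1 (hm.2.trans hy.2))
  · refine ⟨μ - z, by linarith, by linarith [hμ.2], Or.inr ?_⟩
    rw [add_sub_cancel]
    have hanti : ∀ x y, z ≤ x → x ≤ y → y ≤ μ → F y ≤ F x := fun x y h1 h2 h3 => by
      have := hq' x μ y h1 h2 h3 hμ.2
      rwa [max_eq_left (hmin ⟨h1, (h2.trans h3).trans hμ.2⟩)] at this
    intro x hx y hy hxy
    refine lt_of_le_of_ne (hanti x y hx.1 hxy.le hy.2) fun e =>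
      hconst x y hx.1 hxy (hy.2.trans hμ.2) ?_
    intro m hm
    exact le_antisymm (hanti x m hx.1 hm.1 (hm.2.trans hy.2))
      (e ▸ hanti m y (hx.1.trans hm.1) hm.2 hy.2)

theorem exists_strictMonotoneOn_left {F : ℝ → ℝ} {z w : ℝ} (hwz : w < z)
    (hF : ContinuousOn F (Icc w z))
    (hq : ∀ x y m, w < x → x < m → m < y → y < z → F m ≤ max (F x) (F y))
    (hn : ∀ c d, w < c → c < d → d < z → ∃ x ∈ Icc c d, F x ≠ F c) :
    ∃ ε > 0, w ≤ z - ε ∧ StrictMonotoneOn F (Icc (z - ε) z) := by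
  obtain ⟨ε, h0, h1, h2⟩ := exists_strictMonotoneOn_right (F := fun x => F (-x)) (neg_lt_neg hwz)
    (hF.comp continuous_neg.continuousOn fun x hx => ⟨by linarith [hx.2], by linarith [hx.1]⟩)
    (fun x y m h1 h2 h3 h4 => by
      rw [max_comm]
      exact hq (-y) (-x) (-m) (by linarith) (by linarith) (by linarith) (by linarith))
    (fun c d h1 h2 h3 => by
      by_contra! hc
      obtain ⟨x, hx, hne⟩ := hn (-d) (-c) (by linarith) (by linarith) (by linarith)
      have e1 := hc (-x) ⟨by linarith [hx.2], by linarith [hx.1]⟩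
      have e2 := hc d ⟨h2.le, le_rfl⟩
      rw [neg_neg] at e1
      exact hne (e1.trans e2.symm))
  refine ⟨ε, h0, by linarith, h2.symm.imp (fun h x hx y hy hxy => ?_) fun h x hx y hy hxy => ?_⟩
  all_goals
    have := h (a := -y) ⟨by linarith [hy.2], by linarith [hy.1]⟩ (b := -x)
      ⟨by linarith [hx.2], by linarith [hx.1]⟩ (by linarith)
    simpa using this

/-! ### The evolution preserves regularity -/

/-- At a level above both outer values, `f` is below the level between the outer feet, so no charge
is lost from the middle foot to the right one. From there on the surviving right particle keeps the
charge nonnegative. -/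
theorem IsV.le_max (hS : IsSpace S) (h : RegularData S f g) (hs : 0 ≤ s) {x₁ x₂ m p₁ p₂ p : ℝ}
    (hx₁ : x₁ ∈ S) (hx₂ : x₂ ∈ S) (h1 : x₁ < m) (h2 : m < x₂) (e₁ : IsV S f g s x₁ p₁)
    (e₂ : IsV S f g s x₂ p₂) (e : IsV S f g s m p)
    (hq : ∀ b, x₁ - s ∈ rightSet S f b → x₂ - s ∈ rightSet S f b →
      ∀ z ∈ S, z ∈ Icc (x₁ - s) (x₂ - s) → f z ≤ b) : p ≤ max p₁ p₂ := by
  refine le_of_forall_gt_imp_ge_of_dense fun b hb => (e b).2 ?_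
  have l₁ := (e₁ b).1 ((le_max_left _ _).trans hb.le)
  have l₂ := (e₂ b).1 ((le_max_right _ _).trans hb.le)
  have hf : ∀ z ∈ S, z ∈ Icc (x₁ - s) (x₂ - s) → f z < b := fun z hz hz' =>
    (hq _ ((e₁ _).1 (le_max_left _ _)).1 ((e₂ _).1 (le_max_right _ _)).1 z hz hz').trans_lt hb
  have hm : m ∈ S := hS.Icc_subset hx₁ hx₂ ⟨h1.le, h2.le⟩
  refine ⟨mem_rightSet_of_le hS hm (by linarith) fun hz =>
    (hf _ hz ⟨by linarith, by linarith⟩).le, fun y hy => ?_⟩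
  have key : ∀ y, m - s ≤ y → y ≤ x₂ - s → 0 ≤ totalCharge S f g b (m - s) y := fun y h3 h4 =>
    totalCharge_nonneg hS h h3 fun z hz => notMem_leftSet_of_lt hx₂ (by linarith [hz.2])
      fun hzS => (h.le z hzS).trans_lt (hf z hzS ⟨by linarith [hz.1], by linarith [hz.2]⟩)
  rcases le_total y (x₂ - s) with h3 | h3
  · exact key y hy.1 h3
  · rw [← totalCharge_add hS h b (m - s) (x₂ - s) y]
    exact add_nonneg (key _ (by linarith) le_rfl) (l₂.2 y ⟨h3, by linarith [hy.2]⟩)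

/-- For b' slightly below b, the particle at the left foot dies at level b': its charge turns
negative at some y. At level b the charge up to y is at least x₂ - x₁, because the right particle
survives. A jump of that size between levels b' and b contradicts continuity in the level as b'
tends to b. -/
theorem not_isV_const_of_lt (hS : IsSpace S) (h : RegularData S f g) (hs : 0 ≤ s) {x₁ x₂ : ℝ}
    (hx₂ : x₂ ∈ S) (h1 : x₁ < x₂) (e₁ : IsV S f g s x₁ b)
    (e₂ : IsV S f g s x₂ b) (hf : ∀ z ∈ S, z ∈ Icc (x₁ - s) (x₂ - s) → f z < b) : False := by
  obtain ⟨b₀, hb₀, hf₀⟩ : ∃ b₀ < b, ∀ z ∈ S, z ∈ Icc (x₁ - s) (x₂ - s) → f z ≤ b₀ := by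
    rcases (S ∩ Icc (x₁ - s) (x₂ - s)).eq_empty_or_nonempty with he | hne
    · refine ⟨b - 1, by linarith, fun z hz hz' => ?_⟩
      have : z ∈ S ∩ Icc (x₁ - s) (x₂ - s) := ⟨hz, hz'⟩
      rw [he] at this
      exact this.elim
    · obtain ⟨m, hm, hmax⟩ := (isCompact_Icc.inter_left hS.isClosed).exists_isMaxOn hne
        (h.cont_f.mono inter_subset_left)
      exact ⟨f m, hf m hm.1 hm.2, fun z hz hz' => hmax ⟨hz, hz'⟩⟩
  have key : ∀ b' ∈ Ioo b₀ b, x₂ - x₁ ≤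
      totalCharge S f g b (x₁ - s) (x₁ + s) - totalCharge S f g b' (x₁ - s) (x₁ + s) := by
    intro b' hb'
    have hlow : ¬ lowV S f g b' x₁ s := fun hl => absurd ((e₁ b').2 hl) (not_le.2 hb'.2)
    have hL : ∀ z, z < x₂ - s → x₁ - s ≤ z → z ∉ leftSet S g b' := fun z hz hz' =>
      notMem_leftSet_of_lt hx₂ (by linarith) fun hzS =>
        (h.le z hzS).trans_lt ((hf₀ z hzS ⟨hz', hz.le⟩).trans_lt hb'.1)
    have hR : ∀ z, z < x₂ - s → x₁ - s ≤ z → z ∈ rightSet S f b' := fun z hz hz' =>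
      mem_rightSet_of_le hS hx₂ (by linarith) fun hzS => (hf₀ z hzS ⟨hz', hz.le⟩).trans hb'.1.le
    obtain ⟨y, hy, hneg⟩ : ∃ y ∈ Icc (x₁ - s) (x₁ + s), totalCharge S f g b' (x₁ - s) y < 0 := by
      by_contra! hc
      exact hlow ⟨hR _ (by linarith) le_rfl, hc⟩
    have hy2 : x₂ - s < y := by
      by_contra! hc
      exact absurd (totalCharge_nonneg hS h hy.1 fun z hz =>
        hL z (hz.2.trans_le hc) hz.1.le) (not_le.2 hneg)
    have h3 : x₂ - s - (x₁ - s) ≤ totalCharge S f g b' (x₁ - s) (x₂ - s) :=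
      sub_le_totalCharge hS h (by linarith) fun z hz => ⟨hR z hz.2 hz.1.le, hL z hz.2 hz.1.le⟩
    have h4 := totalCharge_mono hS h hb'.2.le (show x₁ - s ≤ x₂ - s by linarith)
    have h5 := ((e₂ b).1 le_rfl).2 y ⟨hy2.le, by linarith [hy.2]⟩
    have h6 := totalCharge_mono hS h hb'.2.le hy.2
    have h7 := totalCharge_add hS h b (x₁ - s) (x₂ - s) y
    have h8 := totalCharge_add hS h b (x₁ - s) y (x₁ + s)
    have h9 := totalCharge_add hS h b' (x₁ - s) y (x₁ + s)
    linarith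
  have hc : ContinuousWithinAt (fun b' => totalCharge S f g b (x₁ - s) (x₁ + s) -
      totalCharge S f g b' (x₁ - s) (x₁ + s)) (Ioo b₀ b) b :=
    (continuous_const.sub (continuous_totalCharge_level hS h _ _)).continuousWithinAt
  have : (𝓝[Ioo b₀ b] b).NeBot := right_nhdsWithin_Ioo_neBot hb₀
  have := ge_of_tendsto hc (eventually_mem_nhdsWithin.mono key)
  linarith

/-- Constancy on [c, d] bounds `f` by b at the feet, and local strict monotonicity makes it smaller
than b near some foot. If the feet start outside `S`, some of them stay outside and the bound is
vacuous. -/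
theorem not_isV_const (hS : IsSpace S) (h : RegularData S f g) (hs : 0 ≤ s) (hcd : c < d)
    (hc : c ∈ S) (hd : d ∈ S) (e : ∀ x ∈ Icc c d, IsV S f g s x b) : False := by
  by_cases hcs : c - s ∈ S
  · obtain ⟨ε, hε, hmon⟩ := h.f_right _ hcs
    have hmem : ∀ x ∈ Icc c d, x - s ∈ S := fun x hx =>
      hS.Icc_subset hcs hd ⟨by linarith [hx.1], by linarith [hx.2]⟩
    have hle : ∀ x ∈ Ioc c d, f (x - s) ≤ b := fun x hx => by
      rcases ((e x ⟨hx.1.le, hx.2⟩ b).1 le_rfl).1 with h1 | h1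
      · exact h1.2
      · linarith [h1 hcs, hx.1]
    obtain ⟨x, hx, hlt⟩ : ∃ x ∈ Ioo c d, f (x - s) < b := by
      obtain ⟨u, hu1, hu2⟩ := exists_between (show c < min d (c + ε) by
        rw [lt_min_iff]; constructor <;> linarith)
      obtain ⟨w, hw1, hw2⟩ := exists_between hu1
      rw [lt_min_iff] at hu2
      rcases lt_or_eq_of_le (hle u ⟨hu1, hu2.1.le⟩) with h1 | h1
      · exact ⟨u, ⟨hu1, hu2.1⟩, h1⟩
      refine ⟨w, ⟨hw1, by linarith⟩, lt_of_le_of_ne (hle w ⟨hw1, by linarith⟩) fun h2 => ?_⟩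
      have := hmon.injOn (x₁ := u - s) ⟨⟨by linarith, by linarith⟩, hmem u ⟨hu1.le, hu2.1.le⟩⟩
        (x₂ := w - s) ⟨⟨by linarith, by linarith⟩, hmem w ⟨hw1.le, by linarith⟩⟩ (h1.trans h2.symm)
      linarith
    obtain ⟨δ, hδ, hlt'⟩ := exists_forall_gt h.cont_f (hmem x ⟨hx.1.le, hx.2.le⟩) hlt
    obtain ⟨x₂, hx₂, hx₂'⟩ := exists_between (show x < min d (x + δ) by
      rw [lt_min_iff]; constructor <;> linarith [hx.2])
    rw [lt_min_iff] at hx₂'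
    refine not_isV_const_of_lt hS h hs (hS.Icc_subset hc hd ⟨by linarith [hx.1], hx₂'.1.le⟩) hx₂ (e x ⟨hx.1.le, hx.2.le⟩)
      (e x₂ ⟨by linarith [hx.1], hx₂'.1.le⟩) fun z hz hz' => hlt' z hz ?_
    rw [abs_lt]
    constructor <;> linarith [hz'.1, hz'.2, hx₂'.2]
  · obtain ⟨a, ha, hca⟩ := hS.exists_isLeast hcs hc (lt_of_le_of_ne (by linarith)
      fun he => hcs (by rwa [he]))
    obtain ⟨x₂, hx₂, hx₂'⟩ := exists_between (show c < min d (a + s) by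
      rw [lt_min_iff]; constructor <;> linarith)
    rw [lt_min_iff] at hx₂'
    exact not_isV_const_of_lt hS h hs (hS.Icc_subset hc hd ⟨hx₂.le, hx₂'.1.le⟩) hx₂
      (e c ⟨le_rfl, hcd.le⟩) (e x₂ ⟨hx₂.le, hx₂'.1.le⟩) fun z hz hz' => by
        linarith [ha.2 hz, hz'.2]

section preserved

variable {f' g' : ℝ → ℝ}

theorem Evolves.isV (he : Evolves S f g s f' g') (hy : y ∈ S) (hx : x ∈ S) (hyx : y < x) :
    IsV S f g s x (f' x) := (he x hx).1 fun hl => absurd (hl.2 hy) (not_le.2 hyx)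

theorem Evolves.not_const (hS : IsSpace S) (h : RegularData S f g) (hs : 0 ≤ s)
    (he : Evolves S f g s f' g') (hy : y ∈ S) (hyc : y < c) (hcd : c < d) (hd : d ∈ S) :
    ∃ x ∈ Icc c d, f' x ≠ f' c := by
  by_contra! hc
  have hmem : ∀ x ∈ Icc c d, x ∈ S := fun x hx =>
    hS.Icc_subset hy hd ⟨by linarith [hx.1], hx.2⟩
  refine not_isV_const hS h hs hcd (hmem c ⟨le_rfl, hcd.le⟩) hd (b := f' c) fun x hx => ?_
  rw [← hc x hx]
  exact he.isV hy (hmem x hx) (hyc.trans_le hx.1)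

theorem Evolves.v_right (hS : IsSpace S) (h : RegularData S f g) (hs : 0 ≤ s)
    (he : Evolves S f g s f' g') (hf' : ContinuousOn f' S) (hz : z ∈ S) :
    ∃ ε > 0, StrictMonotoneOn f' (Icc z (z + ε) ∩ S) := by
  by_cases hg : IsGreatest S z
  · refine ⟨1, one_pos, Or.inl fun x hx y hy hxy => ?_⟩
    linarith [hx.1.1, hg.2 hy.2]
  obtain ⟨w, hw, hzw⟩ := exists_gt_of_not_isGreatest hz hg
  -- On a short interval the feet either run through one monotone piece of `f` or lie left of `S`.
  -- So `f` between two feet is bounded by its values there, as `IsV.le_max` requires.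
  obtain ⟨w₁, hzw₁, hw₁, hq⟩ : ∃ w₁, z < w₁ ∧ w₁ ≤ w ∧ ∀ x₁ x₂, z < x₁ → x₁ < x₂ → x₂ < w₁ →
      ∀ b, x₁ - s ∈ rightSet S f b → x₂ - s ∈ rightSet S f b →
        ∀ y ∈ S, y ∈ Icc (x₁ - s) (x₂ - s) → f y ≤ b := by
    by_cases hzs : z - s ∈ S
    · obtain ⟨ε, hε, hmon⟩ := h.f_right _ hzs
      refine ⟨min w (z + ε), lt_min hzw (by linarith), min_le_left _ _, ?_⟩
      intro x₁ x₂ h1 h2 h3 b r₁ r₂ y hy hy'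
      rw [lt_min_iff] at h3
      have m₁ : x₁ - s ∈ Icc (z - s) (z - s + ε) ∩ S := ⟨⟨by linarith, by linarith⟩,
        hS.Icc_subset hzs hw ⟨by linarith, by linarith⟩⟩
      have m₂ : x₂ - s ∈ Icc (z - s) (z - s + ε) ∩ S := ⟨⟨by linarith, by linarith⟩,
        hS.Icc_subset hzs hw ⟨by linarith, by linarith⟩⟩
      have m : y ∈ Icc (z - s) (z - s + ε) ∩ S :=
        ⟨⟨by linarith [hy'.1], by linarith [hy'.2]⟩, hy⟩
      have l₁ : f (x₁ - s) ≤ b := r₁.elim (fun h => h.2) fun h => by linarith [h hzs]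
      have l₂ : f (x₂ - s) ≤ b := r₂.elim (fun h => h.2) fun h => by linarith [h hzs]
      rcases hmon with hm | hm
      · exact (hm.monotoneOn m m₂ hy'.2).trans l₂
      · exact (hm.antitoneOn m₁ m hy'.1).trans l₁
    · obtain ⟨a, ha, hza⟩ := hS.exists_isLeast hzs hz (lt_of_le_of_ne (by linarith)
        fun he => hzs (by rwa [he]))
      refine ⟨min w (a + s), lt_min hzw (by linarith), min_le_left _ _, ?_⟩
      intro x₁ x₂ h1 h2 h3 b r₁ r₂ y hy hy'
      rw [lt_min_iff] at h3
      linarith [ha.2 hy, hy'.2]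
  have hsub : Icc z w₁ ⊆ S := fun x hx => hS.Icc_subset hz hw ⟨hx.1, hx.2.trans hw₁⟩
  obtain ⟨ε, hε, hle, hmon⟩ := exists_strictMonotoneOn_right hzw₁ (hf'.mono hsub)
    (fun x y m h1 h2 h3 h4 => IsV.le_max hS h hs (hsub ⟨h1.le, by linarith⟩)
      (hsub ⟨by linarith, h4.le⟩) h2 h3 (he.isV hz (hsub ⟨h1.le, by linarith⟩) h1)
      (he.isV hz (hsub ⟨by linarith, h4.le⟩) (by linarith))
      (he.isV hz (hsub ⟨by linarith, by linarith⟩) (by linarith))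
      (hq x y h1 (by linarith) h4))
    (fun c d h1 h2 h3 => he.not_const hS h hs hz h1 h2 (hsub ⟨by linarith, h3.le⟩))
  exact ⟨ε, hε, hmon.mono inter_subset_left⟩

theorem Evolves.v_left (hS : IsSpace S) (h : RegularData S f g) (hs : 0 ≤ s)
    (he : Evolves S f g s f' g') (hf' : ContinuousOn f' S) (hz : z ∈ S) :
    ∃ ε > 0, StrictMonotoneOn f' (Icc (z - ε) z ∩ S) := by
  by_cases hg : IsLeast S z
  · refine ⟨1, one_pos, Or.inl fun x hx y hy hxy => ?_⟩
    linarith [hy.1.2, hg.2 hx.2]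
  obtain ⟨w, hw, hzw⟩ := exists_lt_of_not_isLeast hz hg
  obtain ⟨w₁, hzw₁, hw₁, hq⟩ : ∃ w₁, w₁ < z ∧ w ≤ w₁ ∧ ∀ x₁ x₂, w₁ < x₁ → x₁ < x₂ → x₂ < z →
      ∀ b, x₁ - s ∈ rightSet S f b → x₂ - s ∈ rightSet S f b →
        ∀ y ∈ S, y ∈ Icc (x₁ - s) (x₂ - s) → f y ≤ b := by
    rcases hS.lt_or_exists_isLeast hz (show z - s ≤ z by linarith) with ⟨hzs, e, heS, hez⟩ |
      ⟨a, ha, hza⟩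
    · obtain ⟨ε, hε, hmon⟩ := h.f_left _ hzs
      refine ⟨max w (max (z - ε) (e + s)), max_lt hzw (max_lt (by linarith) (by linarith)),
        le_max_left _ _, ?_⟩
      intro x₁ x₂ h1 h2 h3 b r₁ r₂ y hy hy'
      rw [max_lt_iff, max_lt_iff] at h1
      have m₁ : x₁ - s ∈ Icc (z - s - ε) (z - s) ∩ S := ⟨⟨by linarith, by linarith⟩,
        hS.Icc_subset heS hzs ⟨by linarith, by linarith⟩⟩
      have m₂ : x₂ - s ∈ Icc (z - s - ε) (z - s) ∩ S := ⟨⟨by linarith, by linarith⟩,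
        hS.Icc_subset heS hzs ⟨by linarith, by linarith⟩⟩
      have m : y ∈ Icc (z - s - ε) (z - s) ∩ S :=
        ⟨⟨by linarith [hy'.1], by linarith [hy'.2]⟩, hy⟩
      have l₁ : f (x₁ - s) ≤ b := r₁.elim (fun h => h.2) fun h => by linarith [h heS]
      have l₂ : f (x₂ - s) ≤ b := r₂.elim (fun h => h.2) fun h => by linarith [h heS]
      rcases hmon with hm | hm
      · exact (hm.monotoneOn m m₂ hy'.2).trans l₂
      · exact (hm.antitoneOn m₁ m hy'.1).trans l₁
    · refine ⟨w, hzw, le_rfl, ?_⟩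
      intro x₁ x₂ h1 h2 h3 b r₁ r₂ y hy hy'
      linarith [ha.2 hy, hy'.2]
  have hsub : Icc w₁ z ⊆ S := fun x hx => hS.Icc_subset hw hz ⟨hw₁.trans hx.1, hx.2⟩
  have hw₁S : w₁ ∈ S := hsub ⟨le_rfl, hzw₁.le⟩
  obtain ⟨ε, hε, hle, hmon⟩ := exists_strictMonotoneOn_left hzw₁ (hf'.mono hsub)
    (fun x y m h1 h2 h3 h4 => IsV.le_max hS h hs (hsub ⟨h1.le, by linarith⟩)
      (hsub ⟨by linarith, h4.le⟩) h2 h3 (he.isV hw₁S (hsub ⟨h1.le, by linarith⟩) h1)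
      (he.isV hw₁S (hsub ⟨by linarith, h4.le⟩) (by linarith))
      (he.isV hw₁S (hsub ⟨by linarith, by linarith⟩) (by linarith))
      (hq x y h1 (by linarith) h4))
    (fun c d h1 h2 h3 => he.not_const hS h hs hw₁S h1 h2 (hsub ⟨by linarith, h3.le⟩))
  exact ⟨ε, hε, hmon.mono inter_subset_left⟩

theorem Evolves.w_left (hS : IsSpace S) (h : RegularData S f g) (hs : 0 ≤ s)
    (he : Evolves S f g s f' g') (hg' : ContinuousOn g' S) (hz : z ∈ S) :
    ∃ ε > 0, StrictMonotoneOn g' (Icc (z - ε) z ∩ S) := by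
  obtain ⟨ε, hε, hm⟩ := he.reflect.v_right hS.reflect h.reflect hs (continuousOn_reflectData hg')
    (z := -z) (by simpa using hz)
  refine ⟨ε, hε, ?_⟩
  rw [← strictMonotoneOn_reflectData, reflectSet_inter, reflectSet_Icc]
  rwa [show -(z - ε) = -z + ε by ring]

theorem Evolves.w_right (hS : IsSpace S) (h : RegularData S f g) (hs : 0 ≤ s)
    (he : Evolves S f g s f' g') (hg' : ContinuousOn g' S) (hz : z ∈ S) :
    ∃ ε > 0, StrictMonotoneOn g' (Icc z (z + ε) ∩ S) := by
  obtain ⟨ε, hε, hm⟩ := he.reflect.v_left hS.reflect h.reflect hs (continuousOn_reflectData hg')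
    (z := -z) (by simpa using hz)
  refine ⟨ε, hε, ?_⟩
  rw [← strictMonotoneOn_reflectData, reflectSet_inter, reflectSet_Icc]
  rwa [show -(z + ε) = -z - ε by ring]

end preserved

theorem continuousOn_slice (hV : ContinuousOn (fun p : ℝ × ℝ => V p.1 p.2) (S ×ˢ Ici 0))
    (hs : 0 ≤ s) : ContinuousOn (fun x => V x s) S :=
  hV.comp (f := fun x => (x, s)) (by fun_prop) fun _ hx => ⟨hx, hs⟩

theorem IsExplicit.regularData (hS : IsSpace S) (h : RegularData S f g)
    (hE : IsExplicit S f g V W) (hs : 0 ≤ s) :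
    RegularData S (fun x => V x s) (fun x => W x s) where
  cont_f := continuousOn_slice (hE.continuousOn_v hS h) hs
  cont_g := continuousOn_slice (hE.continuousOn_w hS h) hs
  le := (hE s hs).le hS h hs
  eq_left x hx := ((hE s hs) x hx.1).2.2 (Or.inl hx)
  eq_right x hx := ((hE s hs) x hx.1).2.2 (Or.inr hx)
  f_left _ hz := (hE s hs).v_left hS h hs (continuousOn_slice (hE.continuousOn_v hS h) hs) hz
  f_right _ hz := (hE s hs).v_right hS h hs (continuousOn_slice (hE.continuousOn_v hS h) hs) hz
  g_left _ hz := (hE s hs).w_left hS h hs (continuousOn_slice (hE.continuousOn_w hS h) hs) hz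
  g_right _ hz := (hE s hs).w_right hS h hs (continuousOn_slice (hE.continuousOn_w hS h) hs) hz

end regularity

/-! ### Regularity of the initial data, local transport, and induction on time. -/

section explicitSolution

variable {S : Set ℝ} {f g : ℝ → ℝ} {V W : ℝ → ℝ → ℝ} {a b b' c d e e' x y z t s : ℝ}

/-! ### The initial data are regular -/

/-- Two equal values would enclose a local extremum, as in Rolle's theorem. So the function is
injective, and continuity makes it strictly monotone. -/
theorem strictMonotoneOn_of_no_isLocalExtr {F : ℝ → ℝ} (hab : a ≤ b)
    (hF : ContinuousOn F (Icc a b)) (hn : ∀ x ∈ Ioo a b, ¬ IsLocalExtr F x) :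
    StrictMonotoneOn F (Icc a b) := by
  refine ContinuousOn.strictMonoOn_of_injOn_Icc' hab hF ?_
  have key : ∀ x ∈ Icc a b, ∀ y ∈ Icc a b, x < y → F x ≠ F y := by
    intro x hx y hy hxy e
    obtain ⟨c, hc, hext⟩ := exists_isLocalExtr_Ioo hxy (hF.mono (Icc_subset_Icc hx.1 hy.2)) e
    exact hn c ⟨hx.1.trans_lt hc.1, hc.2.trans_le hy.2⟩ hext
  intro x hx y hy e
  rcases lt_trichotomy x y with h | h | h
  · exact absurd e (key x hx y hy h)
  · exact h
  · exact absurd e.symm (key y hy x hx h)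

section extrema

variable {F : ℝ → ℝ}

theorem exists_ball_no_isLocalExtrOn
    (hfin : ∀ c d : ℝ, {x | x ∈ S ∧ x ∈ Icc c d ∧ IsLocalExtrOn F S x}.Finite) (z : ℝ) :
    ∃ δ > 0, ∀ x ∈ S, x ≠ z → |x - z| < δ → ¬ IsLocalExtr F x := by
  have hE : IsClosed ({x | x ∈ S ∧ x ∈ Icc (z - 1) (z + 1) ∧ IsLocalExtrOn F S x} \ {z}) :=
    ((hfin _ _).subset sdiff_subset).isClosed
  obtain ⟨δ, hδ, hball⟩ := Metric.isOpen_iff.1 hE.isOpen_compl z (fun h => h.2 rfl)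
  refine ⟨min δ 1, by positivity, fun x hx hne hlt hext => ?_⟩
  rw [lt_min_iff, abs_lt, abs_lt] at hlt
  have hxb : x ∈ Metric.ball z δ := by
    rw [Metric.mem_ball, Real.dist_eq, abs_lt]
    exact hlt.1
  exact hball hxb ⟨⟨hx, ⟨by linarith [hlt.2.1], by linarith [hlt.2.2]⟩, hext.on S⟩, hne⟩

theorem exists_strictMonotoneOn_right_of_finite (hS : IsSpace S) (hF : ContinuousOn F S)
    (hfin : ∀ c d : ℝ, {x | x ∈ S ∧ x ∈ Icc c d ∧ IsLocalExtrOn F S x}.Finite) (hz : z ∈ S) :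
    ∃ ε > 0, StrictMonotoneOn F (Icc z (z + ε) ∩ S) := by
  by_cases hg : IsGreatest S z
  · refine ⟨1, one_pos, Or.inl fun x hx y hy hxy => ?_⟩
    linarith [hx.1.1, hg.2 hy.2]
  obtain ⟨w, hw, hzw⟩ := exists_gt_of_not_isGreatest hz hg
  obtain ⟨δ, hδ, hn⟩ := exists_ball_no_isLocalExtrOn hfin z
  obtain ⟨u, hzu, hu⟩ := exists_between (show z < min w (z + δ) by
    rw [lt_min_iff]; constructor <;> linarith)
  rw [lt_min_iff] at hu
  have hsub : Icc z u ⊆ S := fun x hx => hS.Icc_subset hz hw ⟨hx.1, by linarith [hx.2]⟩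
  refine ⟨u - z, by linarith, ?_⟩
  rw [add_sub_cancel]
  refine (strictMonotoneOn_of_no_isLocalExtr hzu.le (hF.mono hsub) fun x hx => ?_).mono
    inter_subset_left
  refine hn x (hsub ⟨hx.1.le, hx.2.le⟩) hx.1.ne' ?_
  rw [abs_lt]
  constructor <;> linarith [hx.1, hx.2]

theorem exists_strictMonotoneOn_left_of_finite (hS : IsSpace S) (hF : ContinuousOn F S)
    (hfin : ∀ c d : ℝ, {x | x ∈ S ∧ x ∈ Icc c d ∧ IsLocalExtrOn F S x}.Finite) (hz : z ∈ S) :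
    ∃ ε > 0, StrictMonotoneOn F (Icc (z - ε) z ∩ S) := by
  by_cases hg : IsLeast S z
  · refine ⟨1, one_pos, Or.inl fun x hx y hy hxy => ?_⟩
    linarith [hy.1.2, hg.2 hx.2]
  obtain ⟨w, hw, hwz⟩ := exists_lt_of_not_isLeast hz hg
  obtain ⟨δ, hδ, hn⟩ := exists_ball_no_isLocalExtrOn hfin z
  obtain ⟨u, hu, huz⟩ := exists_between (show max w (z - δ) < z by
    rw [max_lt_iff]; constructor <;> linarith)
  rw [max_lt_iff] at hu
  have hsub : Icc u z ⊆ S := fun x hx => hS.Icc_subset hw hz ⟨by linarith [hx.1], hx.2⟩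
  refine ⟨z - u, by linarith, ?_⟩
  rw [sub_sub_cancel]
  refine (strictMonotoneOn_of_no_isLocalExtr huz.le (hF.mono hsub) fun x hx => ?_).mono
    inter_subset_left
  refine hn x (hsub ⟨hx.1.le, hx.2.le⟩) hx.2.ne ?_
  rw [abs_lt]
  constructor <;> linarith [hx.1, hx.2]

end extrema

theorem InitialAssumption.regularData (hS : IsSpace S) (h : InitialAssumption S f g) :
    RegularData S f g := by
  obtain ⟨K, hf, hg⟩ := h.lipschitz
  exact
  { cont_f := hf.continuousOn
    cont_g := hg.continuousOn
    le := h.le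
    eq_left := h.eq_left
    eq_right := h.eq_right
    f_left := fun _ hz => exists_strictMonotoneOn_left_of_finite hS hf.continuousOn
      h.finite_extr_v hz
    f_right := fun _ hz => exists_strictMonotoneOn_right_of_finite hS hf.continuousOn
      h.finite_extr_v hz
    g_left := fun _ hz => exists_strictMonotoneOn_left_of_finite hS hg.continuousOn
      h.finite_extr_w hz
    g_right := fun _ hz => exists_strictMonotoneOn_right_of_finite hS hg.continuousOn
      h.finite_extr_w hz }

/-! ### The explicit solution -/

theorem exists_isExplicit (hS : IsSpace S) (h : RegularData S f g) :
    ∃ V W, IsExplicit S f g V W := by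
  have H : ∀ x t, ∃ q : ℝ × ℝ, x ∈ S → 0 ≤ t → EvolvesAt S f g t x q.1 q.2 := by
    intro x t
    by_cases hx : x ∈ S ∧ 0 ≤ t
    · obtain ⟨q, hq⟩ := exists_evolvesAt hS h hx.1 hx.2
      exact ⟨q, fun _ _ => hq⟩
    · exact ⟨0, fun h1 h2 => absurd ⟨h1, h2⟩ hx⟩
  choose q hq using H
  exact ⟨fun x t => (q x t).1, fun x t => (q x t).2, fun t ht x hx => hq x t hx ht⟩

theorem isV_zero (hx : x ∈ S) (hl : ¬ IsLeast S x) : IsV S f g 0 x (f x) := by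
  intro b
  rw [lowV, sub_zero, add_zero]
  constructor
  · refine fun hb => ⟨Or.inl ⟨hx, hb⟩, fun y hy => ?_⟩
    rw [Icc_self] at hy
    rw [hy, totalCharge_self]
  · rintro ⟨h1, -⟩
    exact h1.elim (fun h => h.2) fun h => absurd ⟨hx, h⟩ hl

theorem evolvesAt_zero (h : RegularData S f g) (hx : x ∈ S) : EvolvesAt S f g 0 x (f x) (g x) := by
  refine ⟨isV_zero hx, fun hl => ?_, fun he => he.elim (h.eq_left x) (h.eq_right x)⟩
  have := isV_zero (S := reflectSet S) (f := reflectData g) (g := reflectData f) (x := -x)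
    (by simpa using hx) (by rwa [isLeast_reflectSet, neg_neg])
  rw [isV_reflect] at this
  simpa [reflectData] using this

theorem IsExplicit.initial (hS : IsSpace S) (h : RegularData S f g) (hE : IsExplicit S f g V W)
    (hx : x ∈ S) : V x 0 = f x ∧ W x 0 = g x :=
  (hE 0 le_rfl x hx).unique hS (evolvesAt_zero h hx)

theorem IsExplicit.shift (hS : IsSpace S) (h : RegularData S f g) (hE : IsExplicit S f g V W)
    (hs : 0 ≤ s) : IsExplicit S (fun x => V x s) (fun x => W x s)
      (fun x t => V x (s + t)) (fun x t => W x (s + t)) := fun t ht x hx =>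
  ((hE s hs).evolvesAt_iff hS h hs ht).2 (hE (s + t) (add_nonneg hs ht) x hx)

/-- Near a liquid point the values are transported. -/
theorem IsExplicit.exists_transport (hS : IsSpace S) (h : RegularData S f g)
    (hE : IsExplicit S f g V W) (hs : 0 ≤ s) (he : e ∈ S) (hex : e < x) (he' : e' ∈ S)
    (hxe : x < e') (hlt : W x s < V x s) :
    ∃ η > 0, ∀ ρ ∈ Ico 0 η, V (x + ρ) (s + ρ) = V x s ∧ W (x - ρ) (s + ρ) = W x s := by
  obtain ⟨c, hc1, hc2⟩ := exists_between hlt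
  have hR := hE.regularData hS h hs
  have hx : x ∈ S := hS.Icc_subset he he' ⟨hex.le, hxe.le⟩
  obtain ⟨δ₁, h1, hV⟩ := exists_forall_lt hR.cont_f hx hc2
  obtain ⟨δ₂, h2, hW⟩ := exists_forall_gt hR.cont_g hx hc1
  obtain ⟨η, hη, hη'⟩ := exists_between (show 0 < min (min (x - e) (e' - x)) (min δ₁ δ₂) by
    simp only [lt_min_iff, sub_pos]; exact ⟨⟨hex, hxe⟩, h1, h2⟩)
  simp only [lt_min_iff] at hη'
  obtain ⟨⟨h3, h4⟩, h5, h6⟩ := hη'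
  -- The level c separates all values of V from all values of W near x, so every small window there
  -- is liquid.
  have hfg : ∀ y ∈ Icc (x - η) (x + η), ∀ z ∈ Icc (x - η) (x + η), W z s ≤ V y s := by
    intro y hy z hz
    have hy' := hV y (hS.Icc_subset he he' ⟨by linarith [hy.1], by linarith [hy.2]⟩) (by
      rw [abs_lt]; constructor <;> linarith [hy.1, hy.2])
    have hz' := hW z (hS.Icc_subset he he' ⟨by linarith [hz.1], by linarith [hz.2]⟩) (by
      rw [abs_lt]; constructor <;> linarith [hz.1, hz.2])
    linarith
  refine ⟨η / 2, by linarith, fun ρ hρ => ?_⟩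
  obtain ⟨hρ0, hρη⟩ := hρ
  have key : ∀ y, x - η ≤ y - ρ → y + ρ ≤ x + η →
      V y (s + ρ) = V (y - ρ) s ∧ W y (s + ρ) = W (y + ρ) s := by
    intro y hy1 hy2
    have hy : y ∈ S := hS.Icc_subset he he' ⟨by linarith, by linarith⟩
    refine (hE.shift hS h hs ρ hρ0 y hy).unique hS (evolvesAt_liquid hS hR hρ0
      ⟨e, he, by linarith⟩ ⟨e', he', by linarith⟩ (fun z hz => ?_) fun z hz => ?_)
    · exact hfg _ ⟨hy1, by linarith⟩ z ⟨by linarith [hz.1], by linarith [hz.2]⟩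
    · exact hfg z ⟨by linarith [hz.1], by linarith [hz.2]⟩ _ ⟨by linarith, hy2⟩
  constructor
  · rw [(key (x + ρ) (by linarith) (by linarith)).1, add_sub_cancel_right]
  · rw [(key (x - ρ) (by linarith) (by linarith)).2, sub_add_cancel]

/-! ### Induction on intervals -/

/-- The set of times up to which `Q` holds is closed by `h1` and extends to the right by `h2`. -/
theorem Icc_induction {Q : ℝ → Prop} {T : ℝ} (h1 : ∀ t ∈ Icc 0 T, (∀ t' ∈ Ico 0 t, Q t') → Q t)
    (h2 : ∀ t ∈ Ico 0 T, Q t → ∃ δ > 0, ∀ t' ∈ Ioo t (t + δ), t' ≤ T → Q t') :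
    ∀ t ∈ Icc 0 T, Q t := by
  have hsub : Icc 0 T ⊆ {t | ∀ t' ∈ Icc 0 t, t' ≤ T → Q t'} := by
    refine IsClosed.Icc_subset_of_forall_exists_gt ?_ ?_ ?_
    · refine isClosed_of_closure_subset fun t ht => ?_
      have htI : t ∈ Icc 0 T := closure_minimal inter_subset_right isClosed_Icc ht
      have hlt : ∀ t' ∈ Ico 0 t, Q t' := by
        intro t' ht'
        obtain ⟨u, hu1, hu2⟩ := mem_closure_iff.1 ht (Ioi t') isOpen_Ioi ht'.2
        exact hu2.1 t' ⟨ht'.1, (mem_Ioi.1 hu1).le⟩ (ht'.2.le.trans htI.2)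
      refine ⟨fun t' ht' _ => ?_, htI⟩
      rcases eq_or_lt_of_le ht'.2 with rfl | h
      · exact h1 _ htI hlt
      · exact hlt t' ⟨ht'.1, h⟩
    · intro t' ht' hT
      have : t' = 0 := le_antisymm ht'.2 ht'.1
      subst this
      exact h1 0 ⟨le_rfl, hT⟩ fun u hu => absurd hu.1 (not_le.2 hu.2)
    · rintro t ⟨ht, htI⟩ y hy
      obtain ⟨δ, hδ, H⟩ := h2 t htI (ht t ⟨htI.1, le_rfl⟩ htI.2.le)
      obtain ⟨u, hu, hu'⟩ := exists_between (show t < min y (t + δ) by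
        rw [lt_min_iff]; exact ⟨hy, by linarith⟩)
      rw [lt_min_iff] at hu'
      refine ⟨u, fun t' ht' hT => ?_, hu, hu'.1.le⟩
      rcases le_or_gt t' t with h | h
      · exact ht t' ⟨ht'.1, h⟩ hT
      · exact H t' ⟨h, by linarith [ht'.2]⟩ hT
  exact fun t ht => hsub ht t ⟨ht.1, le_rfl⟩ ht.2

/-- A continuous function which is locally constant to the right of every interior point is
constant. -/
theorem eq_of_locally_const_right {u : ℝ → ℝ} {T : ℝ} (hT : 0 ≤ T) (hu : ContinuousOn u (Icc 0 T))
    (h : ∀ r ∈ Ioo 0 T, ∃ η > 0, ∀ ρ ∈ Ico 0 η, r + ρ ≤ T → u (r + ρ) = u r) : u T = u 0 := by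
  rcases eq_or_lt_of_le hT with rfl | hT
  · rfl
  -- Nothing is assumed at 0, so the argument starts at r > 0 and reaches 0 by continuity.
  have key : ∀ r ∈ Ioo 0 T, u T = u r := by
    intro r hr
    have := Icc_induction (Q := fun t => u (r + t) = u r) (T := T - r) (fun t ht IH => ?_)
      (fun t ht IH => ?_) (T - r) ⟨by linarith [hr.2], le_rfl⟩
    · rwa [add_sub_cancel] at this
    · rcases eq_or_lt_of_le ht.1 with rfl | h0
      · rw [add_zero]
      · have hc : ContinuousWithinAt (fun t => u (r + t)) (Ico 0 t) t :=
          (hu (r + t) ⟨by linarith [hr.1], by linarith [ht.2]⟩).comp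
            (f := fun t => r + t) (by fun_prop) fun t' ht' =>
              ⟨by linarith [hr.1, ht'.1], by linarith [ht.2, ht'.2]⟩
        have : (𝓝[Ico 0 t] t).NeBot := right_nhdsWithin_Ico_neBot h0
        exact tendsto_nhds_unique (hc.congr' (eventually_mem_nhdsWithin.mono IH))
          tendsto_const_nhds
    · obtain ⟨η, hη, H⟩ := h (r + t) ⟨by linarith [hr.1, ht.1], by linarith [ht.2]⟩
      refine ⟨η, hη, fun t' ht' htT => ?_⟩
      have := H (t' - t) ⟨by linarith [ht'.1], by linarith [ht'.2]⟩ (by linarith)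
      rw [show r + t + (t' - t) = r + t' by ring] at this
      exact this.trans IH
  have hc : ContinuousWithinAt u (Ioo 0 T) 0 := (hu 0 ⟨le_rfl, hT.le⟩).mono Ioo_subset_Icc_self
  have : (𝓝[Ioo 0 T] (0 : ℝ)).NeBot := left_nhdsWithin_Ioo_neBot hT
  exact tendsto_nhds_unique (tendsto_const_nhds.congr' (eventually_mem_nhdsWithin.mono key)) hc

end explicitSolution

/-! ### The explicit solution satisfies the equations, and every constructed solution equals it. -/

section main

variable {S : Set ℝ} {f g : ℝ → ℝ} {V W : ℝ → ℝ → ℝ} {a b b' c d e e' x y z t s : ℝ}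

/-! ### The explicit solution is a solution -/

theorem transportOn_of_nonneg {v w : ℝ → ℝ → ℝ} {x₁ x₂ t₁ t₂ : ℝ}
    (h : ∀ x t δ : ℝ, 0 ≤ δ → x ∈ Ioo x₁ x₂ → t ∈ Ioo t₁ t₂ → t + δ ∈ Ioo t₁ t₂ →
      (x + δ ∈ Ioo x₁ x₂ → v (x + δ) (t + δ) = v x t) ∧
      (x - δ ∈ Ioo x₁ x₂ → w (x - δ) (t + δ) = w x t)) : TransportOn v w x₁ x₂ t₁ t₂ := by
  intro x t δ hx ht htδ
  rcases le_total 0 δ with hδ | hδ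
  · exact h x t δ hδ hx ht htδ
  · constructor
    · intro hxδ
      have := (h (x + δ) (t + δ) (-δ) (by linarith) hxδ htδ (by simpa using ht)).1
        (by simpa using hx)
      simpa using this.symm
    · intro hxδ
      have := (h (x - δ) (t + δ) (-δ) (by linarith) hxδ htδ (by simpa using ht)).2
        (by simpa using hx)
      simpa using this.symm

theorem IsExplicit.liquid (hS : IsSpace S) (h : RegularData S f g) (hE : IsExplicit S f g V W)
    {x₁ x₂ t₁ t₂ : ℝ} (hsub : Ioo x₁ x₂ ⊆ S) (ht₁ : 0 ≤ t₁)
    (hlt : ∀ x ∈ Ioo x₁ x₂, ∀ t ∈ Ioo t₁ t₂, W x t < V x t) : TransportOn V W x₁ x₂ t₁ t₂ := by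
  refine transportOn_of_nonneg fun x t δ hδ hx ht htδ => ⟨fun hxδ => ?_, fun hxδ => ?_⟩
  · have hmem : ∀ r ∈ Icc 0 δ, x + r ∈ Ioo x₁ x₂ := fun r hr =>
      ⟨by linarith [hx.1, hr.1], by linarith [hxδ.2, hr.2]⟩
    have := eq_of_locally_const_right (u := fun r => V (x + r) (t + r)) hδ
      ((hE.continuousOn_v hS h).comp (f := fun r => (x + r, t + r)) (by fun_prop) fun r hr =>
        ⟨hsub (hmem r hr), show 0 ≤ t + r by linarith [ht.1, hr.1]⟩) fun r hr => ?_
    · simpa using this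
    · obtain ⟨η, hη, H⟩ := hE.exists_transport hS h (s := t + r) (x := x + r)
        (by linarith [ht.1, hr.1]) (hsub hx) (by linarith [hr.1]) (hsub hxδ) (by linarith [hr.2])
        (hlt _ (hmem r ⟨hr.1.le, hr.2.le⟩) _ ⟨by linarith [ht.1, hr.1], by linarith [htδ.2, hr.2]⟩)
      exact ⟨η, hη, fun ρ hρ _ => by simpa only [add_assoc] using (H ρ hρ).1⟩
  · have hmem : ∀ r ∈ Icc 0 δ, x - r ∈ Ioo x₁ x₂ := fun r hr =>
      ⟨by linarith [hxδ.1, hr.2], by linarith [hx.2, hr.1]⟩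
    have := eq_of_locally_const_right (u := fun r => W (x - r) (t + r)) hδ
      ((hE.continuousOn_w hS h).comp (f := fun r => (x - r, t + r)) (by fun_prop) fun r hr =>
        ⟨hsub (hmem r hr), show 0 ≤ t + r by linarith [ht.1, hr.1]⟩) fun r hr => ?_
    · simpa using this
    · obtain ⟨η, hη, H⟩ := hE.exists_transport hS h (s := t + r) (x := x - r)
        (by linarith [ht.1, hr.1]) (hsub hxδ) (by linarith [hr.2]) (hsub hx) (by linarith [hr.1])
        (hlt _ (hmem r ⟨hr.1.le, hr.2.le⟩) _ ⟨by linarith [ht.1, hr.1], by linarith [htδ.2, hr.2]⟩)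
      exact ⟨η, hη, fun ρ hρ _ => by simpa only [add_assoc, sub_sub] using (H ρ hρ).2⟩

/-- Decreasing data which agree do not stay frozen. -/
theorem IsExplicit.exists_lt_of_strictAntiOn (hS : IsSpace S) (h : RegularData S f g)
    (hE : IsExplicit S f g V W) (hs : 0 ≤ s) (hcd : c < d) (hsub : Icc c d ⊆ S)
    (heq : ∀ x ∈ Icc c d, V x s = W x s) (hf : StrictAntiOn (fun x => V x s) (Icc c d))
    {η : ℝ} (hη : 0 < η) : ∃ x ∈ Ioo c d, ∃ ρ ∈ Ioo 0 η, W x (s + ρ) < V x (s + ρ) := by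
  obtain ⟨ρ, hρ, hρ'⟩ := exists_between (show 0 < min ((d - c) / 2) η by
    rw [lt_min_iff]; exact ⟨by linarith, hη⟩)
  rw [lt_min_iff] at hρ'
  refine ⟨(c + d) / 2, ⟨by linarith, by linarith⟩, ρ, ⟨hρ, hρ'.2⟩, ?_⟩
  have hsub' : Icc ((c + d) / 2 - ρ) ((c + d) / 2 + ρ) ⊆ Icc c d :=
    Icc_subset_Icc (by linarith) (by linarith)
  have hl : (c + d) / 2 - ρ ∈ Icc c d := ⟨by linarith, by linarith⟩
  have hr : (c + d) / 2 + ρ ∈ Icc c d := ⟨by linarith, by linarith⟩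
  have H := (hE.shift hS h hs ρ hρ.le ((c + d) / 2)
    (hsub ⟨by linarith, by linarith⟩)).unique hS
    (evolvesAt_liquid hS (hE.regularData hS h hs) hρ.le
      ⟨c, hsub ⟨le_rfl, hcd.le⟩, by linarith⟩ ⟨d, hsub ⟨hcd.le, le_rfl⟩, by linarith⟩
      (fun z hz => ?_) fun z hz => ?_)
  · calc W ((c + d) / 2) (s + ρ) = W ((c + d) / 2 + ρ) s := H.2
      _ = V ((c + d) / 2 + ρ) s := (heq _ hr).symm
      _ < V ((c + d) / 2 - ρ) s := hf hl hr (by linarith)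
      _ = V ((c + d) / 2) (s + ρ) := H.1.symm
  · rw [← heq z (hsub' hz)]
    exact hf.antitoneOn hl (hsub' hz) hz.1
  · rw [← heq _ hr]
    exact hf.antitoneOn (hsub' hz) hr hz.2

/-- In a frozen rectangle the common data cannot decrease on any interval, for this would create a
liquid point by `exists_lt_of_strictAntiOn`. So they increase on both sides of x, and freezing with
crossing time 0 keeps the value at x. -/
theorem IsExplicit.frozen (hS : IsSpace S) (h : RegularData S f g) (hE : IsExplicit S f g V W)
    {x₁ x₂ t₁ t₂ : ℝ} (hsub : Ioo x₁ x₂ ⊆ S) (ht₁ : 0 ≤ t₁)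
    (heq : ∀ x ∈ Ioo x₁ x₂, ∀ t ∈ Ioo t₁ t₂, V x t = W x t) : StationaryOn V W x₁ x₂ t₁ t₂ := by
  have key : ∀ x t δ : ℝ, 0 ≤ δ → x ∈ Ioo x₁ x₂ → t ∈ Ioo t₁ t₂ → t + δ ∈ Ioo t₁ t₂ →
      V x (t + δ) = V x t := by
    intro x t δ hδ hx ht htδ
    have := eq_of_locally_const_right (u := fun r => V x (t + r)) hδ
      ((hE.continuousOn_v hS h).comp (f := fun r => (x, t + r)) (by fun_prop) fun r hr =>
        ⟨hsub hx, show 0 ≤ t + r by linarith [ht.1, hr.1]⟩) fun r hr => ?_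
    · simpa using this
    have hs : 0 ≤ t + r := by linarith [ht.1, hr.1]
    have hst : t + r ∈ Ioo t₁ t₂ := ⟨by linarith [ht.1, hr.1], by linarith [htδ.2, hr.2]⟩
    have hR := hE.regularData hS h hs
    have hanti : ∀ c d, c < d → Icc c d ⊆ Ioo x₁ x₂ →
        ¬ StrictAntiOn (fun x => V x (t + r)) (Icc c d) := by
      intro c d hcd hI hf
      obtain ⟨y, hy, ρ, hρ, hlt⟩ := hE.exists_lt_of_strictAntiOn hS h hs hcd (hI.trans hsub)
        (fun y hy => heq y (hI hy) _ hst) hf (sub_pos.2 hst.2)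
      exact hlt.ne' (heq y (hI ⟨hy.1.le, hy.2.le⟩) _ ⟨by linarith [hρ.1, hst.1], by
        linarith [hρ.2]⟩)
    obtain ⟨ε₁, h1, m1⟩ := hR.f_left x (hsub hx)
    obtain ⟨ε₂, h2, m2⟩ := hR.f_right x (hsub hx)
    obtain ⟨η, hη, hη'⟩ := exists_between
      (show 0 < min (min (x - x₁) (x₂ - x)) (min ε₁ ε₂) by
        simp only [lt_min_iff, sub_pos]; exact ⟨hx, h1, h2⟩)
    simp only [lt_min_iff] at hη'
    obtain ⟨⟨h3, h4⟩, h5, h6⟩ := hη'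
    have hI : Icc (x - η) (x + η) ⊆ Ioo x₁ x₂ := fun y hy =>
      ⟨by linarith [hy.1], by linarith [hy.2]⟩
    have hl : Icc (x - η) x ⊆ Icc (x - ε₁) x ∩ S := fun y hy =>
      ⟨⟨by linarith [hy.1], hy.2⟩, hsub (hI ⟨hy.1, by linarith [hy.2]⟩)⟩
    have hr' : Icc x (x + η) ⊆ Icc x (x + ε₂) ∩ S := fun y hy =>
      ⟨⟨hy.1, by linarith [hy.2]⟩, hsub (hI ⟨by linarith [hy.1], hy.2⟩)⟩
    have m1' := (m1.mono hl).resolve_right (hanti _ _ (by linarith)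
      fun y hy => hI ⟨hy.1, by linarith [hy.2]⟩)
    have m2' := (m2.mono hr').resolve_right (hanti _ _ (by linarith)
      fun y hy => hI ⟨by linarith [hy.1], hy.2⟩)
    have m := m1'.Icc_union (by linarith) (by linarith) m2'
    have m' : StrictMonoOn (fun x => W x (t + r)) (Icc (x - η) (x + η)) := by
      intro y hy z hz hyz
      simp only
      rw [← heq y (hI hy) _ hst, ← heq z (hI hz) _ hst]
      exact m hy hz hyz
    refine ⟨η, hη, fun ρ hρ _ => ?_⟩
    have hsubρ : S ∩ Icc (x - ρ) (x + ρ) ⊆ Icc (x - η) (x + η) := fun y hy =>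
      ⟨by linarith [hy.2.1, hρ.2], by linarith [hy.2.2, hρ.2]⟩
    have H := (hE.shift hS h hs ρ hρ.1 x (hsub hx)).unique hS
      (evolvesAt_of_cross (s := 0) hS hR (hsub hx) (m.mono hsubρ) (m'.mono hsubρ)
        ⟨x + η, hsub (hI ⟨by linarith, le_rfl⟩), by linarith [hρ.2]⟩ ⟨le_rfl, hρ.1⟩
        (by simpa using hsub hx) (by simpa using heq x hx _ hst))
    simpa [add_assoc] using H.1
  have key' : ∀ x t δ : ℝ, x ∈ Ioo x₁ x₂ → t ∈ Ioo t₁ t₂ → t + δ ∈ Ioo t₁ t₂ →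
      V x (t + δ) = V x t := by
    intro x t δ hx ht htδ
    rcases le_total 0 δ with hδ | hδ
    · exact key x t δ hδ hx ht htδ
    · simpa using (key x (t + δ) (-δ) (by linarith) hx htδ (by simpa using ht)).symm
  intro x t δ hx ht htδ
  refine ⟨key' x t δ hx ht htδ, ?_⟩
  rw [← heq x hx _ htδ, ← heq x hx _ ht]
  exact key' x t δ hx ht htδ

/-- Small rectangles inside the open triangle give transport at positive heights; continuity carries
it down to the base. -/
theorem eq_base_of_transportOn {v w : ℝ → ℝ → ℝ} {x₁ x₂ : ℝ}
    (hv : ContinuousOn (fun p : ℝ × ℝ => v p.1 p.2) (triangle x₁ x₂ s))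
    (hw : ContinuousOn (fun p : ℝ × ℝ => w p.1 p.2) (triangle x₁ x₂ s))
    (H : ∀ y₁ y₂ t₁ t₂ : ℝ, Ioo y₁ y₂ ×ˢ Ioo t₁ t₂ ⊆ openTriangle x₁ x₂ s →
      TransportOn v w y₁ y₂ t₁ t₂) {x τ : ℝ} (hτ : 0 < τ) (h1 : x₁ < x - τ) (h2 : x + τ < x₂) :
    v x (s + τ) = v (x - τ) s ∧ w x (s + τ) = w (x + τ) s := by
  have key : ∀ y t, (y, t) ∈ openTriangle x₁ x₂ s → ∃ η > 0, ∀ ρ ∈ Ico 0 η,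
      v (y + ρ) (t + ρ) = v y t ∧ w (y - ρ) (t + ρ) = w y t := by
    rintro y t ⟨h1, h2, h3⟩
    simp only at h1 h2 h3
    obtain ⟨η, hη, hη'⟩ := exists_between (show 0 < min (t - s)
      (min (y - (x₁ + (t - s))) (x₂ - (t - s) - y)) by
        simp only [lt_min_iff, sub_pos]; exact ⟨h1, h2, h3⟩)
    simp only [lt_min_iff] at hη'
    refine ⟨η / 2, by linarith, fun ρ hρ => ?_⟩
    have hT := H (y - η / 2) (y + η / 2) (t - η / 2) (t + η / 2) (by
      rintro ⟨y', t'⟩ ⟨⟨h4, h5⟩, h6, h7⟩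
      simp only at h4 h5 h6 h7
      refine ⟨?_, ?_, ?_⟩ <;> simp only <;> linarith) y t ρ ⟨by linarith, by linarith⟩
      ⟨by linarith, by linarith⟩ ⟨by linarith [hρ.1], by linarith [hρ.2]⟩
    exact ⟨hT.1 ⟨by linarith [hρ.1], by linarith [hρ.2]⟩,
      hT.2 ⟨by linarith [hρ.2], by linarith [hρ.1]⟩⟩
  constructor
  · have := eq_of_locally_const_right (u := fun r => v (x - τ + r) (s + r)) hτ.le
      (hv.comp (f := fun r => (x - τ + r, s + r)) (by fun_prop) fun r hr => ?_) fun r hr => ?_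
    · simpa using this
    · refine ⟨?_, ?_, ?_⟩ <;> simp only <;> linarith [hr.1, hr.2]
    · obtain ⟨η, hη, K⟩ := key (x - τ + r) (s + r) (by
        refine ⟨?_, ?_, ?_⟩ <;> simp only <;> linarith [hr.1, hr.2])
      exact ⟨η, hη, fun ρ hρ _ => by simpa only [add_assoc] using (K ρ hρ).1⟩
  · have := eq_of_locally_const_right (u := fun r => w (x + τ - r) (s + r)) hτ.le
      (hw.comp (f := fun r => (x + τ - r, s + r)) (by fun_prop) fun r hr => ?_) fun r hr => ?_
    · simpa using this
    · refine ⟨?_, ?_, ?_⟩ <;> simp only <;> linarith [hr.1, hr.2]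
    · obtain ⟨η, hη, K⟩ := key (x + τ - r) (s + r) (by
        refine ⟨?_, ?_, ?_⟩ <;> simp only <;> linarith [hr.1, hr.2])
      exact ⟨η, hη, fun ρ hρ _ => by simpa only [add_assoc, sub_sub] using (K ρ hρ).2⟩

/-- Characteristics of the competing liquid evolution from a < b on the base meet above their
midpoint, where w < v, so the base data satisfy W(b) ≤ V(a). This is the condition for liquid
evolution, so the explicit values are transported from the same base. -/
theorem IsExplicit.thaw (hS : IsSpace S) (h : RegularData S f g) (hE : IsExplicit S f g V W)
    {x₁ x₂ : ℝ} {v w : ℝ → ℝ → ℝ} (hs : 0 ≤ s) (hsub : Ioo x₁ x₂ ⊆ S)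
    (hv : ContinuousOn (fun p : ℝ × ℝ => v p.1 p.2) (triangle x₁ x₂ s))
    (hw : ContinuousOn (fun p : ℝ × ℝ => w p.1 p.2) (triangle x₁ x₂ s))
    (hlt : ∀ p ∈ openTriangle x₁ x₂ s, w p.1 p.2 < v p.1 p.2)
    (H : ∀ y₁ y₂ t₁ t₂ : ℝ, Ioo y₁ y₂ ×ˢ Ioo t₁ t₂ ⊆ openTriangle x₁ x₂ s →
      TransportOn v w y₁ y₂ t₁ t₂)
    (h₀ : ∀ x ∈ Ioo x₁ x₂, v x s = V x s ∧ w x s = W x s) :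
    ∀ p ∈ openTriangle x₁ x₂ s, V p.1 p.2 = v p.1 p.2 ∧ W p.1 p.2 = w p.1 p.2 := by
  have hR := hE.regularData hS h hs
  have hbase : ∀ a ∈ Ioo x₁ x₂, ∀ b ∈ Ioo x₁ x₂, a ≤ b → W b s ≤ V a s := by
    intro a ha b hb hab
    rcases eq_or_lt_of_le hab with rfl | hab
    · exact hR.le a (hsub ha)
    have e := eq_base_of_transportOn hv hw H (x := (a + b) / 2) (τ := (b - a) / 2)
      (by linarith) (by linarith [ha.1]) (by linarith [hb.2])
    have := hlt ((a + b) / 2, s + (b - a) / 2) (by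
      refine ⟨?_, ?_, ?_⟩ <;> simp only <;> linarith [ha.1, hb.2])
    simp only at this
    rw [e.1, e.2, show (a + b) / 2 - (b - a) / 2 = a by ring,
      show (a + b) / 2 + (b - a) / 2 = b by ring, (h₀ a ha).1, (h₀ b hb).2] at this
    exact this.le
  rintro ⟨x, t⟩ ⟨h1, h2, h3⟩
  simp only at h1 h2 h3 ⊢
  obtain ⟨τ, rfl⟩ : ∃ τ, t = s + τ := ⟨t - s, by ring⟩
  rw [add_sub_cancel_left] at h2 h3
  have hτ : 0 < τ := by linarith
  have hl : x - τ ∈ Ioo x₁ x₂ := ⟨by linarith, by linarith⟩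
  have hr : x + τ ∈ Ioo x₁ x₂ := ⟨by linarith, by linarith⟩
  have e := eq_base_of_transportOn hv hw H hτ hl.1 hr.2
  rw [e.1, e.2, (h₀ _ hl).1, (h₀ _ hr).2]
  obtain ⟨e₁, he₁, he₁'⟩ := exists_between hl.1
  obtain ⟨e₂, he₂, he₂'⟩ := exists_between hr.2
  exact (hE.shift hS h hs τ hτ.le x (hsub ⟨by linarith, by linarith⟩)).unique hS
    (evolvesAt_liquid hS hR hτ.le ⟨e₁, hsub ⟨he₁, by linarith⟩, he₁'⟩
      ⟨e₂, hsub ⟨by linarith, he₂'⟩, he₂⟩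
      (fun z hz => hbase _ hl z ⟨by linarith [hz.1], by linarith [hz.2]⟩ hz.1)
      fun z hz => hbase z ⟨by linarith [hz.1], by linarith [hz.2]⟩ _ hr hz.2)

theorem IsExplicit.isSolution (hS : IsSpace S) (h : RegularData S f g)
    (hE : IsExplicit S f g V W) : IsSolution S V W where
  cont_v := hE.continuousOn_v hS h
  cont_w := hE.continuousOn_w hS h
  le x hx t ht := (hE t ht).le hS h ht x hx
  boundary x hx t ht := (hE t ht x (hx.elim (fun h => h.1) fun h => h.1)).2.2 hx
  liquid _ _ _ _ hsub ht₁ hlt := hE.liquid hS h hsub ht₁ hlt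
  frozen _ _ _ _ hsub ht₁ heq := hE.frozen hS h hsub ht₁ heq
  thaw _ _ _ _ _ hs _ hsub hv hw _ hlt H h₀ := hE.thaw hS h hs hsub hv hw hlt H h₀

theorem IsExplicit.isConstructedSolution (hS : IsSpace S) (h : RegularData S f g)
    (hE : IsExplicit S f g V W) : IsConstructedSolution S f g V W where
  initial _ hx := hE.initial hS h hx
  solution := hE.isSolution hS h
  construction s hs z hz := by
    obtain ⟨ε, hε⟩ := (hE.regularData hS h hs).exists_isWindow hS hz
    exact ⟨ε, hε, EvolvesOn.localConstruction hS (hE.regularData hS h hs) hε fun p hp =>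
      hE.shift hS h hs p.2 hp.1 p.1 hp.2.1⟩

/-! ### Uniqueness of the constructed solution -/

section unique

variable {v w : ℝ → ℝ → ℝ}

theorem IsConstructedSolution.regularData (hC : IsConstructedSolution S f g v w) (hs : 0 ≤ s) :
    RegularData S (fun x => v x s) (fun x => w x s) where
  cont_f := continuousOn_slice hC.solution.cont_v hs
  cont_g := continuousOn_slice hC.solution.cont_w hs
  le x hx := hC.solution.le x hx s hs
  eq_left x hx := hC.solution.boundary x (Or.inl hx) s hs
  eq_right x hx := hC.solution.boundary x (Or.inr hx) s hs
  f_left z hz := (hC.construction s hs z hz).imp fun _ h => ⟨h.1.pos, h.1.f_left⟩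
  f_right z hz := (hC.construction s hs z hz).imp fun _ h => ⟨h.1.pos, h.1.f_right⟩
  g_left z hz := (hC.construction s hs z hz).imp fun _ h => ⟨h.1.pos, h.1.g_left⟩
  g_right z hz := (hC.construction s hs z hz).imp fun _ h => ⟨h.1.pos, h.1.g_right⟩

theorem continuousOn_shift (hv : ContinuousOn (fun p : ℝ × ℝ => v p.1 p.2) (S ×ˢ Ici 0))
    (hs : 0 ≤ s) {ε : ℝ} :
    ContinuousOn (fun p : ℝ × ℝ => v p.1 (s + p.2)) (window S z ε) :=
  hv.comp (f := fun p : ℝ × ℝ => (p.1, s + p.2)) (by fun_prop) fun _ hp =>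
    ⟨hp.2.1, add_nonneg hs hp.1⟩

/-- On a compact set the local constructions are valid for a common time. -/
theorem IsConstructedSolution.exists_evolvesAt (hS : IsSpace S)
    (hC : IsConstructedSolution S f g v w) (hs : 0 ≤ s) {K : Set ℝ} (hK : IsCompact K)
    (hKS : K ⊆ S) : ∃ δ > 0, ∀ τ ∈ Ico 0 δ, ∀ x ∈ K,
      EvolvesAt S (fun x => v x s) (fun x => w x s) τ x (v x (s + τ)) (w x (s + τ)) := by
  choose! ε hε hL using hC.construction s hs
  -- A Lebesgue number of the cover by window balls is a time for which the base of the backward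
  -- cone of any point of `K` fits into a single window.
  obtain ⟨δ, hδ, H⟩ := lebesgue_number_lemma_of_metric (ι := S)
    (c := fun z => Metric.ball (z : ℝ) (ε z)) hK (fun _ => Metric.isOpen_ball) fun x hx =>
      mem_iUnion.2 ⟨⟨x, hKS hx⟩, Metric.mem_ball_self (hε x (hKS hx)).pos⟩
  refine ⟨δ, hδ, fun τ hτ x hx => ?_⟩
  obtain ⟨⟨z, hz⟩, hball⟩ := H x hx
  have key : ∀ y, |y - x| < δ → |y - z| < ε z := fun y hy => by
    simpa [Real.dist_eq] using hball (show y ∈ Metric.ball x δ by simpa [Real.dist_eq] using hy)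
  have h1 := abs_lt.1 (key (x - τ) (by rw [abs_lt]; constructor <;> linarith [hτ.1, hτ.2]))
  have h2 := abs_lt.1 (key (x + τ) (by rw [abs_lt]; constructor <;> linarith [hτ.1, hτ.2]))
  exact LocalConstruction.evolvesOn hS (hC.regularData hs) (hε z hz)
    (continuousOn_shift hC.solution.cont_v hs) (continuousOn_shift hC.solution.cont_w hs) (hL z hz)
    (x, τ) ⟨hτ.1, hKS hx, by simp only; linarith, by simp only; linarith⟩

/-- Induction on s within the backward cone [x - (t - s), x + (t - s)], whose part in `S` is
compact. Agreement passes to limits in time by continuity. Beyond a time of agreement both solutions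
follow the explicit formulas from equal data for a common short time. -/
theorem IsConstructedSolution.eq_explicit (hS : IsSpace S) (h : RegularData S f g)
    (hC : IsConstructedSolution S f g v w) (hE : IsExplicit S f g V W) (hx : x ∈ S)
    (ht : 0 ≤ t) : v x t = V x t ∧ w x t = W x t := by
  have key := Icc_induction (T := t) (Q := fun s => ∀ y ∈ S,
    y ∈ Icc (x - (t - s)) (x + (t - s)) → v y s = V y s ∧ w y s = W y s)
    (fun s hs IH y hy hy' => ?_) (fun s hs IH => ?_) t ⟨ht, le_rfl⟩ x hx (by simp)
  · exact key
  · rcases eq_or_lt_of_le hs.1 with rfl | h0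
    · rw [(hC.initial y hy).1, (hC.initial y hy).2, (hE.initial hS h hy).1,
        (hE.initial hS h hy).2]
      exact ⟨rfl, rfl⟩
    have IH' : ∀ s' ∈ Ico 0 s, v y s' = V y s' ∧ w y s' = W y s' := fun s' hs' =>
      IH s' hs' y hy ⟨by linarith [hy'.1, hs'.2], by linarith [hy'.2, hs'.2]⟩
    have hne : (𝓝[Ico 0 s] s).NeBot := right_nhdsWithin_Ico_neBot h0
    have hc : ∀ u : ℝ → ℝ → ℝ, ContinuousOn (fun p : ℝ × ℝ => u p.1 p.2) (S ×ˢ Ici 0) →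
        Tendsto (u y) (𝓝[Ico 0 s] s) (𝓝 (u y s)) := fun u hu =>
      (hu (y, s) ⟨hy, hs.1⟩).comp (f := fun s' => (y, s')) (by fun_prop) fun s' hs' => ⟨hy, hs'.1⟩
    exact ⟨tendsto_nhds_unique ((hc v hC.solution.cont_v).congr'
        (eventually_mem_nhdsWithin.mono fun s' hs' => (IH' s' hs').1))
        (hc V (hE.continuousOn_v hS h)),
      tendsto_nhds_unique ((hc w hC.solution.cont_w).congr'
        (eventually_mem_nhdsWithin.mono fun s' hs' => (IH' s' hs').2))
        (hc W (hE.continuousOn_w hS h))⟩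
  · obtain ⟨δ, hδ, H⟩ := hC.exists_evolvesAt hS hs.1 (K := S ∩ Icc (x - (t - s)) (x + (t - s)))
      (isCompact_Icc.inter_left hS.isClosed) inter_subset_left
    refine ⟨δ, hδ, fun s' hs' hs't y hy hy' => ?_⟩
    obtain ⟨τ, rfl⟩ : ∃ τ, s' = s + τ := ⟨s' - s, by ring⟩
    have hτ : 0 ≤ τ := by linarith [hs'.1]
    have H1 := H τ ⟨hτ, by linarith [hs'.2]⟩ y ⟨hy, ⟨by linarith [hy'.1], by linarith [hy'.2]⟩⟩
    refine EvolvesAt.unique hS ((evolvesAt_congr hτ (fun z hz hz' => ?_) fun z hz hz' => ?_).1 H1)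
      (hE.shift hS h hs.1 τ hτ y hy)
    · exact (IH z hz ⟨by linarith [hy'.1, hz'.1], by linarith [hy'.2, hz'.2]⟩).1
    · exact (IH z hz ⟨by linarith [hy'.1, hz'.1], by linarith [hy'.2, hz'.2]⟩).2

end unique

end main

end

theorem lemma6p1 (S : Set ℝ)
    (hS : S = Set.univ ∨ ∃ a₁ a₂ : ℝ, a₁ < a₂ ∧ S = Set.Icc a₁ a₂)
    (v₀ w₀ : ℝ → ℝ) (h₀ : InitialAssumption S v₀ w₀) :
    (∃ v w : ℝ → ℝ → ℝ, IsConstructedSolution S v₀ w₀ v w) ∧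
    ∀ v w : ℝ → ℝ → ℝ, IsConstructedSolution S v₀ w₀ v w →
      ∀ x ∈ S, ∀ t : ℝ, 0 ≤ t →
        (¬ IsLeast S x → vStar S v₀ w₀ x t = (v x t : EReal)) ∧
        (¬ IsGreatest S x → wStar S v₀ w₀ x t = (w x t : EReal)) ∧
        (IsLeast S x → wStar S v₀ w₀ x t = (v x t : EReal)) ∧
        (IsGreatest S x → vStar S v₀ w₀ x t = (w x t : EReal)) := by
  have hI : IsSpace S := hS
  have h := h₀.regularData hI
  obtain ⟨V, W, hE⟩ := exists_isExplicit hI h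
  refine ⟨⟨V, W, hE.isConstructedSolution hI h⟩, fun v w hC x hx t ht => ?_⟩
  obtain ⟨e₁, e₂⟩ := hC.eq_explicit hI h hE hx ht
  rw [e₁, e₂]
  obtain ⟨hv, hw, hb⟩ := hE t ht x hx
  refine ⟨fun hl => vStar_eq hI h hx ht (hv hl), fun hg => wStar_eq hI h hx ht (hw hg),
    fun hl => ?_, fun hg => ?_⟩
  · rw [show V x t = W x t from hb (Or.inl hl)]
    exact wStar_eq hI h hx ht (hw fun hg => hI.not_isLeast_isGreatest hl hg)
  · rw [← show V x t = W x t from hb (Or.inr hg)]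
    exact vStar_eq hI h hx ht (hv fun hl => hI.not_isLeast_isGreatest hl hg)
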